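/- Let $\mathrm G=\mathrm{SL}_2(\mathbb R)$ and write $\mathrm n[x]=\begin{pmatrix}1&x\\0&1\end{pmatrix}$, $\mathrm a[y]=\begin{pmatrix}\sqrt y&0\\0&1/\sqrt y\end{pmatrix}$ $(y>0)$, $\mathrm k[\theta]=\begin{pmatrix}\cos\theta&\sin\theta\\-\sin\theta&\cos\theta\end{pmatrix}$. For $g=\begin{pmatrix}a&b\\c&d\end{pmatrix}\in\mathrm G$ put $u(g)=\frac14(a^2+b^2+c^2+d^2-2)$, and let $\langle f_1,f_2\rangle_{\mathrm G}=\int_{\mathrm G}f_1\overline{f_2}\,dg$, where $dg=\frac{dx\,dy\,d\theta}{2\pi y^2}$ in the Iwasawa coordinates $g=\mathrm n[x]\mathrm a[y]\mathrm k[\theta]$, $\theta\in[0,2\pi)$. Differential operators. Put $\partial_\varphi f(g)=\frac{d}{dt}f(\mathrm k[t]g)|_{t=0}$ and $\partial_\vartheta f(g)=\frac{d}{dt}f(g\,\mathrm k[t])|_{t=0}$ (the derivatives in the angles of the Cartan coordinates $g=\mathrm k[\varphi]\mathrm a[e^{-\varrho}]\mathrm k[\vartheta]$). Put $\mathrm x_jf(g)=\frac{d}{dt}f(g\exp(tX_j))|_{t=0}$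 with $X_1=\begin{pmatrix}0&1\\0&0\end{pmatrix}$, $X_2=\begin{pmatrix}1&0\\0&-1\end{pmatrix}$, $X_3=\begin{pmatrix}0&1\\-1&0\end{pmatrix}$, $\mathrm e^{\pm}=\pm2i\,\mathrm x_1+\mathrm x_2\mp i\,\mathrm x_3$, and let $\Omega=-\frac14\mathrm e^+\mathrm e^-+\frac14\mathrm x_3^2-\frac i2\mathrm x_3$ be the Casimir operator; in Iwasawa coordinates $\Omega=-y^2(\partial_x^2+\partial_y^2)+y\,\partial_x\partial_\theta$. Harmonics. For $\nu\in\mathbb C$ and $\ell\in\mathbb Z$ let $\phi_\ell(g,\nu)=y^{1/2+\nu}e^{i\ell\theta}$ in Iwasawa coordinates, and for $\ell_1\equiv\ell_2\pmod 2$ let $\phi_{\ell_1,\ell_2}(g,\nu)=\frac1{2\pi}\int_0^{2\pi}\phi_{\ell_2}(\mathrm k[\varphi]g,\nu)e^{-i\ell_1\varphi}\,d\varphi$. For an integer $\ell\ge0$ let $\kappa\in\{0,1\}$, $\kappa\equiv\ell\pmod 2$, and put $$G_\phi(\nu,\ell)=2^{-(\ell-\kappa)/2}\,\frac{\Gamma(\frac{1+\kappa}2+\nu)}{\Gamma(\frac{1+\ell}2+\nu)},$$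 $$G(\nu,\ell)=\begin{cases}2^{-(\ell-\kappa)/2}\left|\dfrac{\Gamma(\nu+\frac{1+\kappa}2)\Gamma(-\nu+\frac{1+\kappa}2)}{\Gamma(\nu+\frac{1+\ell}2)\Gamma(-\nu+\frac{1+\ell}2)}\right|^{1/2},&\Re\nu\in[0,\tfrac12),\\[2ex]2^{-(\ell-k)/2}\left|\dfrac{\Gamma(k)}{\Gamma(\frac{\ell+k}2)\Gamma(\frac{\ell-k}2+1)}\right|^{1/2},&\nu=\frac{k-1}2,\ k\ge1,\ \ell\ge k,\ \ell\equiv k\ (2)\end{cases}$$ (the two cases agree where both apply). Define $$\mathcal P_\nu^{(\ell_1,\ell_2)}(g)=\frac{G_\phi(\nu,|\ell_1|)}{G_\phi(\nu,|\ell_2|)}\,\frac{G(\nu,|\ell_2|)}{G(\nu,|\ell_1|)}\,\phi_{\ell_1,\ell_2}(g,\nu).$$ Proposition. For every integer $J\ge0$ there is a constant $K=K(J)>0$ with the following property. Let $\delta>0$, $U\ge1$, $B\geq 0$, and let $F:\mathrm G\to\mathbb C$ be smooth and compactly supported, supported on $u(g)\le U$, such that $$|\Omega^{J_0}\partial_\varphi^{J_1}\partial_\vartheta^{J_2}F(g)|\le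 B\,\delta^{-2J_0-J_1-J_2}\qquad\text{for all }g\in\mathrm G\text{ and all integers }J_0,J_1,J_2\ge0\text{ with }2J_0+J_1+J_2\le2J.$$ (i) For $\nu\in i\mathbb R$ and integers $\ell_1\equiv\ell_2\pmod2$, $$|\langle F,\mathcal P_\nu^{(\ell_1,\ell_2)}\rangle_{\mathrm G}|\le K B\,U^{1/2}\,\frac{\log(1+U)}{(1+(\delta|\nu|)^2+(\delta\ell_1)^2+(\delta\ell_2)^2)^J}.$$ (ii) For $\nu\in(0,1/2)$ and integers $\ell_1\equiv\ell_2\pmod2$, $$|\langle F,\mathcal P_\nu^{(\ell_1,\ell_2)}\rangle_{\mathrm G}|\le K B\,U^{1/2+\nu}\,\frac{\min\{\nu^{-1},\log(1+U)\}(1+|\ell_1|)(1+|\ell_2|)}{(1+(\delta\ell_1)^2+(\delta\ell_2)^2)^J}.$$ (iii) For $\nu=(k-1)/2$ with an integer $k\ge1$, and integers $|\ell_1|,|\ell_2|\ge k$ with $\ell_1\equiv\ell_2\equiv k\pmod2$, $$|\langle F,\mathcal P_\nu^{(\ell_1,\ell_2)}\rangle_{\mathrm G}|\le K B\,U^{1/2}\,\frac1{(1+(\delta|\nu|)^2+(\delta\ell_1)^2+(\delta\ell_2)^2)^J}.$$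 -/

import Mathlib

open scoped ContDiff

noncomputable section

namespace SL2Spectral

/-- The Lie group `G = SL₂(ℝ)`. -/
abbrev G : Type := Matrix.SpecialLinearGroup (Fin 2) ℝ

/-! ### Coordinates -/

/-- `n[x] = (1, x; 0, 1)`. -/
def nMat (x : ℝ) : G := ⟨!![1, x; 0, 1], by simp [Matrix.det_fin_two_of]⟩

/-- `a[y] = (√y, 0; 0, 1/√y)` for `y > 0` (and the identity for the irrelevant `y ≤ 0`). -/
def aMat (y : ℝ) : G :=
  if h : 0 < y then
    ⟨!![√y, 0; 0, 1 / √y], by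
      rw [Matrix.det_fin_two_of]
      simp [(Real.sqrt_pos.2 h).ne']⟩
  else 1

/-- `k[θ] = (cos θ, sin θ; -sin θ, cos θ)`. -/
def kMat (θ : ℝ) : G :=
  ⟨!![Real.cos θ, Real.sin θ; -Real.sin θ, Real.cos θ], by
    rw [Matrix.det_fin_two_of]
    nlinarith [Real.sin_sq_add_cos_sq θ]⟩

/-- The Iwasawa coordinate `y = 1 / (c² + d²)` of `g = (a, b; c, d) = n[x] a[y] k[θ]`. -/
def iwasawaY (g : G) : ℝ := 1 / (g 1 0 ^ 2 + g 1 1 ^ 2)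

/-- The number `e^{iθ} = (d - ic) / √(c² + d²)` for `g = (a, b; c, d) = n[x] a[y] k[θ]`. -/
def iwasawaPhase (g : G) : ℂ :=
  ((g 1 1 : ℂ) - Complex.I * (g 1 0 : ℂ)) / ((√(g 1 0 ^ 2 + g 1 1 ^ 2) : ℝ) : ℂ)

/-- `u(g) = (a² + b² + c² + d² - 2) / 4`. -/
def uFun (g : G) : ℝ := (g 0 0 ^ 2 + g 0 1 ^ 2 + g 1 0 ^ 2 + g 1 1 ^ 2 - 2) / 4

/-! ### Smooth functions and differential operators -/

/-- Smooth functions on `G`, a closed submanifold of the space of real `2 × 2` matrices: those that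
near every point agree with the restriction of a smooth function of the four matrix entries. -/
def SmoothOnG (F : G → ℂ) : Prop :=
  ∀ g : G, ∃ f : (Fin 2 → Fin 2 → ℝ) → ℂ, ContDiff ℝ ∞ f ∧
    ∀ᶠ h : G in nhds g, F h = f (fun i j => h i j)

/-- The right Lie differential along `X₁ = (0, 1; 0, 0)`, where `exp (t X₁) = n[t]`. -/
def x1 (f : G → ℂ) (g : G) : ℂ := deriv (fun t : ℝ => f (g * nMat t)) 0

/-- The right Lie differential along `X₂ = (1, 0; 0, -1)`, where `exp (t X₂) = a[e^{2t}]`. -/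
def x2 (f : G → ℂ) (g : G) : ℂ := deriv (fun t : ℝ => f (g * aMat (Real.exp (2 * t)))) 0

/-- The right Lie differential along `X₃ = (0, 1; -1, 0)`, where `exp (t X₃) = k[t]`. -/
def x3 (f : G → ℂ) (g : G) : ℂ := deriv (fun t : ℝ => f (g * kMat t)) 0

/-- The raising operator `2i x₁ + x₂ - i x₃`. -/
def raising (f : G → ℂ) (g : G) : ℂ :=
  2 * Complex.I * x1 f g + x2 f g - Complex.I * x3 f g

/-- The lowering operator `-2i x₁ + x₂ + i x₃`. -/
def lowering (f : G → ℂ) (g : G) : ℂ :=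
  -2 * Complex.I * x1 f g + x2 f g + Complex.I * x3 f g

/-- The Casimir operator `Ω = -¼ e⁺ e⁻ + ¼ x₃² - ½ i x₃`; in Iwasawa coordinates it equals
`-y² (∂ₓ² + ∂_y²) + y ∂ₓ ∂_θ`. -/
def casimir (f : G → ℂ) (g : G) : ℂ :=
  -(1 / 4) * raising (lowering f) g + (1 / 4) * x3 (x3 f) g - (1 / 2) * Complex.I * x3 f g

/-- `∂_φ` in Cartan coordinates `g = k[φ] a[e^{-ϱ}] k[ϑ]`: left rotation. As a left Lie
differential it is defined on all of `G`, also where the Cartan coordinates are not unique. -/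
def dphi (f : G → ℂ) (g : G) : ℂ := deriv (fun t : ℝ => f (kMat t * g)) 0

/-- `∂_ϑ` in Cartan coordinates `g = k[φ] a[e^{-ϱ}] k[ϑ]`: right rotation. -/
def dtheta (f : G → ℂ) (g : G) : ℂ := deriv (fun t : ℝ => f (g * kMat t)) 0

/-! ### Integration -/

/-- The Haar integral `∫_G f(g) dg = ∫ f(n[x] a[y] k[θ]) dx dy dθ / (2π y²)` over `x ∈ ℝ`, `y > 0`,
`θ ∈ [0, 2π)`. -/
def integralG (f : G → ℂ) : ℂ :=
  ∫ p in (Set.univ ×ˢ (Set.Ioi 0 ×ˢ Set.Ico 0 (2 * Real.pi)) : Set (ℝ × ℝ × ℝ)),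
    f (nMat p.1 * aMat p.2.1 * kMat p.2.2) * ((1 / (2 * Real.pi * p.2.1 ^ 2) : ℝ) : ℂ)

/-- `⟨f₁, f₂⟩_G = ∫_G f₁(g) conj(f₂(g)) dg`. -/
def innerG (f₁ f₂ : G → ℂ) : ℂ := integralG fun g => f₁ g * (starRingEnd ℂ) (f₂ g)

/-! ### The harmonics -/

/-- `φ_ℓ(g, ν) = y^{1/2 + ν} e^{iℓθ}` in Iwasawa coordinates. -/
def phiBasic (ℓ : ℤ) (ν : ℂ) (g : G) : ℂ :=
  (iwasawaY g : ℂ) ^ (1 / 2 + ν) * iwasawaPhase g ^ ℓ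

/-- `φ_{ℓ₁,ℓ₂}(g, ν) = (1/2π) ∫₀^{2π} φ_{ℓ₂}(k[φ] g, ν) e^{-iℓ₁φ} dφ`. -/
def phiTyped (ℓ₁ ℓ₂ : ℤ) (ν : ℂ) (g : G) : ℂ :=
  ((1 / (2 * Real.pi) : ℝ) : ℂ) * ∫ t in (0 : ℝ)..(2 * Real.pi),
    phiBasic ℓ₂ ν (kMat t * g) * Complex.exp (-Complex.I * (ℓ₁ : ℂ) * (t : ℂ))

/-- `G_φ(ν, ℓ) = 2^{-(ℓ-κ)/2} Γ((1+κ)/2 + ν) / Γ((1+ℓ)/2 + ν)` with `κ ∈ {0, 1}`,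
`κ ≡ ℓ (mod 2)`. -/
def gPhi (ν : ℂ) (ℓ : ℕ) : ℂ :=
  (((2 : ℝ) ^ (-((ℓ : ℝ) - (ℓ % 2 : ℕ)) / 2) : ℝ) : ℂ) *
    (Complex.Gamma ((1 + ((ℓ % 2 : ℕ) : ℂ)) / 2 + ν) / Complex.Gamma ((1 + (ℓ : ℂ)) / 2 + ν))

/-- The normalising factor `G(ν, ℓ)`: for `Re ν ∈ [0, 1/2)` it is
`2^{-(ℓ-κ)/2} |Γ(ν+(1+κ)/2) Γ(-ν+(1+κ)/2) / (Γ(ν+(1+ℓ)/2) Γ(-ν+(1+ℓ)/2))|^{1/2}`, `κ ∈ {0, 1}`,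
`κ ≡ ℓ (mod 2)`, and for `ν = (k-1)/2` with an integer `k ≥ 2` and `ℓ ≥ k` it is
`2^{-(ℓ-k)/2} |Γ(k) / (Γ((ℓ+k)/2) Γ((ℓ-k)/2+1))|^{1/2}` (so `k = 2ν + 1`). -/
def gNorm (ν : ℂ) (ℓ : ℕ) : ℝ :=
  if ν.re < 1 / 2 then
    (2 : ℝ) ^ (-((ℓ : ℝ) - (ℓ % 2 : ℕ)) / 2) *
      √‖Complex.Gamma (ν + (1 + ((ℓ % 2 : ℕ) : ℂ)) / 2) *
          Complex.Gamma (-ν + (1 + ((ℓ % 2 : ℕ) : ℂ)) / 2) /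
        (Complex.Gamma (ν + (1 + (ℓ : ℂ)) / 2) * Complex.Gamma (-ν + (1 + (ℓ : ℂ)) / 2))‖
  else
    (2 : ℝ) ^ (-((ℓ : ℝ) - (2 * ν.re + 1)) / 2) *
      √|Real.Gamma (2 * ν.re + 1) /
        (Real.Gamma (((ℓ : ℝ) + (2 * ν.re + 1)) / 2) *
          Real.Gamma (((ℓ : ℝ) - (2 * ν.re + 1)) / 2 + 1))|

/-- The unitarily normalised harmonic
`𝒫_ν^{(ℓ₁,ℓ₂)} = (G_φ(ν,|ℓ₁|) / G_φ(ν,|ℓ₂|)) (G(ν,|ℓ₂|) / G(ν,|ℓ₁|)) φ_{ℓ₁,ℓ₂}(·, ν)`. -/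
def harmonicP (ℓ₁ ℓ₂ : ℤ) (ν : ℂ) (g : G) : ℂ :=
  gPhi ν ℓ₁.natAbs / gPhi ν ℓ₂.natAbs *
    ((gNorm ν ℓ₂.natAbs / gNorm ν ℓ₁.natAbs : ℝ) : ℂ) * phiTyped ℓ₁ ℓ₂ ν g

end SL2Spectral

end

/-!
Each bound comes from moving derivatives from `F` to the harmonic and then estimating trivially: if
`D F` is bounded by `B'` and the harmonic is an eigenfunction of the transpose of `D`, with
eigenvalue `c`, then `‖c‖ ‖⟨F, 𝒫⟩‖ ≤ B' ∫_{u ≤ U} ‖𝒫‖` (`norm_mul_innerG_le`). For `D` one takes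
the identity, the `2J`-th powers of the two rotations, with eigenvalues `± ℓ₁ ^ (2J)` and
`± ℓ₂ ^ (2J)`, and on the imaginary axis the `J`-th power of the Casimir operator, with eigenvalue
`(1/4 - ν²) ^ J`. In the discrete series `|ν| < |ℓ₁|`, so that the rotations suffice.

Integration by parts needs the unimodularity of `G`. It is visible in the coordinates given by the
bottom row `(c, d)` and the unipotent translation `x`: in polar coordinates for `(c, d)` the measure
`dx dc dd` is the Haar measure in Iwasawa form (`lintegral_haarG`). The measure `dx dc dd` is
invariant on the right because `G` acts on bottom rows by linear maps of determinant one
(`rowIntegral_mul_right`), and on the left because it is symmetric under the reflection of matrices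
in the antidiagonal (`rowIntegral_antiTranspose`). A derivative along a measure preserving flow then
integrates to zero (`IsLinearFlow.integral_eq_zero`), and the Casimir eigenvalue comes from the
action of the raising and lowering operators on `φ_ℓ` (`IsTest.integral_casimir_mul_phiBasic`).

It remains to bound `∫_{u ≤ U} ‖𝒫‖`.

* For `Re ν < 1/2` one has `|φ_{ℓ₁,ℓ₂}| ≤ sphericalAvg (1/2 + Re ν)`, whose integral over the ball is
  that of `y ^ (1/2 + Re ν)` (`setLIntegral_sphericalAvg_le`), since the ball is invariant under left
  rotations. The normalising factors have absolute value one on the imaginary axis. For real `ν`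
  they cost a factor `1 + |ℓ₂|` (`normRatio_real_le_mul`), except that for `ℓ₁ = 0 ≠ ℓ₂` they behave
  like `(1/2 - ν) ^ (-1/2)` as `ν → 1/2`. There `φ_{0,ℓ₂}` itself is `O(1/2 - ν)` times the spherical
  average (`norm_phiTyped_zero_le`), as one sees by integrating the defining Fourier integral by
  parts.
* In the discrete series the Fourier integral of `φ_{ℓ₁,ℓ₂}` is computed by Lagrange inversion
  (`integral_eq_coeff_su2Poly`). With its normalisation the harmonic becomes `(1 + u) ^ (-1/2)` times
  a matrix coefficient of a unitary representation of `SU(2)`, which is at most one in absolute value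
  (`sq_norm_harmonicP_discrete`). The integral of `(1 + u) ^ (-1/2)` over the ball is `O(U ^ (1/2))`
  (`setLIntegral_inv_sqrt_le`).
-/

namespace SL2Spectral

/-! ### Matrix coefficients of `SU(2)` -/

open Polynomial in
/-- The image of the monomial `z ^ m` under the substitution of degree `N` attached to the element
`(c, t; -t̄, c)` of `SU(2)`. Its coefficients are, up to binomial factors, the matrix coefficients
of the irreducible representation of dimension `N + 1`. -/
noncomputable def su2Poly (c : ℝ) (t : ℂ) (N m : ℕ) : ℂ[X] :=
  (C (c : ℂ) * X + C t) ^ m * (C (c : ℂ) - C ((starRingEnd ℂ) t) * X) ^ (N - m)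

open Polynomial in
lemma coeff_linear_pow (a b : ℂ) (N j : ℕ) :
    ((C a + C b * X : ℂ[X]) ^ N).coeff j = (N.choose j : ℂ) * (b ^ j * a ^ (N - j)) := by
  rw [add_comm, add_pow, finsetSum_coeff]
  have : ∀ k ∈ Finset.range (N + 1),
      ((C b * X) ^ k * C a ^ (N - k) * ((N.choose k : ℕ) : ℂ[X])).coeff j
        = if k = j then (N.choose j : ℂ) * (b ^ j * a ^ (N - j)) else 0 := by
    intro k _
    have : (C b * X) ^ k * C a ^ (N - k) * ((N.choose k : ℕ) : ℂ[X])
        = C (b ^ k * a ^ (N - k) * (N.choose k : ℂ)) * X ^ k := by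
      simp only [map_mul, map_pow, map_natCast]; ring
    rw [this, coeff_C_mul, coeff_X_pow]
    by_cases h : k = j
    · subst h; simp; ring
    · simp [h, Ne.symm h]
  rw [Finset.sum_congr rfl this]
  simp only [Finset.sum_ite_eq', Finset.mem_range]
  split_ifs with h
  · rfl
  · rw [Nat.choose_eq_zero_of_lt (by omega)]; simp

open Polynomial in
lemma su2Poly_natDegree_le (c : ℝ) (t : ℂ) {N m : ℕ} (h : m ≤ N) :
    (su2Poly c t N m).natDegree ≤ N := by
  unfold su2Poly
  have h1 : (C (c : ℂ) * X + C t : ℂ[X]).natDegree ≤ 1 := natDegree_linear_le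
  have h2 : (C (c : ℂ) - C ((starRingEnd ℂ) t) * X : ℂ[X]).natDegree ≤ 1 := by
    have : (C (c : ℂ) - C ((starRingEnd ℂ) t) * X : ℂ[X])
      = C (-(starRingEnd ℂ) t) * X + C (c : ℂ) := by simp only [map_neg]; ring
    rw [this]; exact natDegree_linear_le
  refine natDegree_mul_le.trans ?_
  have := natDegree_pow_le_of_le m h1
  have := natDegree_pow_le_of_le (N - m) h2
  omega

open Polynomial in
/-- Reciprocity between the coefficients of `su2Poly c t N m` in `z ^ j` and those of the
substitution attached to the transposed matrix: both come from the expansion of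
`(c - t̄ z + y (c z + t)) ^ N` in powers of `y` and `z`. -/
lemma choose_mul_coeff_su2Poly (c : ℝ) (t : ℂ) {N m j : ℕ} (hm : m ≤ N) :
    (N.choose m : ℂ) * (su2Poly c t N m).coeff j = (N.choose j : ℂ) *
      ((C (c : ℂ) * X - C ((starRingEnd ℂ) t)) ^ j * (C (c : ℂ) + C t * X) ^ (N - j)).coeff m := by
  set s := (starRingEnd ℂ) t
  have key : (∑ k ∈ Finset.range (N + 1), C ((N.choose k : ℂ) * (su2Poly c t N k).coeff j) * X ^ k)
      = C (N.choose j : ℂ) * ((C (c : ℂ) * X - C s) ^ j * (C (c : ℂ) + C t * X) ^ (N - j)) := by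
    refine Polynomial.funext fun y => ?_
    have e1 : ((C (c + t * y) + C (c * y - s) * X : ℂ[X]) ^ N).coeff j
        = (N.choose j : ℂ) * ((c * y - s) ^ j * (c + t * y) ^ (N - j)) := coeff_linear_pow _ _ _ _
    have e2 : (C (c + t * y) + C (c * y - s) * X : ℂ[X]) ^ N =
        ∑ k ∈ Finset.range (N + 1), C ((N.choose k : ℂ) * y ^ k) * su2Poly c t N k := by
      have : (C (c + t * y) + C (c * y - s) * X : ℂ[X])
        = C y * (C (c : ℂ) * X + C t) + (C (c : ℂ) - C s * X) := by
        simp only [map_add, map_mul, map_sub]; ring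
      rw [this, add_pow]
      refine Finset.sum_congr rfl fun k _ => ?_
      simp only [su2Poly, map_mul, map_pow, map_natCast, mul_pow, s]; ring
    rw [e2, finsetSum_coeff] at e1
    simp only [eval_finsetSum, eval_mul, eval_C, eval_pow, eval_X, eval_sub, eval_add, ← e1,
      coeff_C_mul]
    refine Finset.sum_congr rfl fun k _ => by ring
  have := congrArg (fun p => p.coeff m) key
  simp only [finsetSum_coeff, coeff_C_mul, coeff_X_pow, mul_ite, mul_one, mul_zero,
    Finset.sum_ite_eq, Finset.mem_range] at this
  rwa [if_pos (by omega)] at this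

open Polynomial in
/-- The substitution attached to the inverse matrix undoes `su2Poly`. -/
lemma sum_coeff_su2Poly_mul (c : ℝ) (t : ℂ) (hc : c ≠ 0) (hct : (c : ℂ) ^ 2 + t * (starRingEnd ℂ) t = 1)
    {N m : ℕ} (hm : m ≤ N) :
    ∑ j ∈ Finset.range (N + 1), C ((su2Poly c t N m).coeff j) *
      ((C (c : ℂ) * X - C t) ^ j * (C (c : ℂ) + C ((starRingEnd ℂ) t) * X) ^ (N - j)) = X ^ m := by
  set s := (starRingEnd ℂ) t with hs
  refine Polynomial.eq_of_infinite_eval_eq _ _ (Set.Infinite.mono ?_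
    (Set.Finite.infinite_compl (Polynomial.finite_setOfPred_isRoot
      (p := (C (c : ℂ) + C s * X : ℂ[X])) ?_)))
  · intro y hy
    have hB : (c : ℂ) + s * y ≠ 0 := by
      simpa [IsRoot.def] using hy
    set B := (c : ℂ) + s * y with hBdef
    set A := (c : ℂ) * y - t with hA
    simp only [Set.mem_ofPred_eq, eval_finsetSum, eval_mul, eval_C, eval_pow, eval_X, eval_sub,
      eval_add]
    have h1 : ((su2Poly c t N m).eval (A / B)) * B ^ N = y ^ m := by
      have ea : c * (A / B) + t = y / B := by
        rw [eq_div_iff hB, add_mul, mul_assoc, div_mul_cancel₀ _ hB, hA, hBdef]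
        linear_combination y * hct
      have eb : c - s * (A / B) = 1 / B := by
        rw [eq_div_iff hB, sub_mul, mul_assoc, div_mul_cancel₀ _ hB, hA, hBdef]
        linear_combination hct
      simp only [su2Poly, ← hs, eval_mul, eval_pow, eval_add, eval_sub, eval_C, eval_X, ea, eb]
      rw [div_pow, div_pow, ← Nat.add_sub_cancel' hm, Nat.add_sub_cancel_left, pow_add]
      field_simp
      rw [one_pow, mul_one]
    rw [← h1, eval_eq_sum_range' (Nat.lt_succ_of_le (su2Poly_natDegree_le c t hm)), Finset.sum_mul]
    refine Finset.sum_congr rfl fun j hj => ?_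
    have hj : j ≤ N := by simpa [Nat.lt_succ_iff] using hj
    rw [← Nat.add_sub_cancel' hj, Nat.add_sub_cancel_left, pow_add, div_pow, ← hA, ← hBdef]
    field_simp
  · intro h
    have := congrArg (fun p => p.coeff 0) h
    simp at this
    exact hc this

open Polynomial in
/-- The matrix coefficients of a unitary representation of `SU(2)` are at most `1` in size. -/
lemma choose_mul_norm_coeff_su2Poly_le (c : ℝ) (t : ℂ) (hc : c ≠ 0)
    (hct : (c : ℂ) ^ 2 + t * (starRingEnd ℂ) t = 1) {N m j : ℕ} (hm : m ≤ N) (hj : j ≤ N) :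
    (N.choose m : ℝ) * ‖(su2Poly c t N m).coeff j‖ ^ 2 ≤ N.choose j := by
  have hch : ∀ i ≤ N, (0 : ℝ) < N.choose i := fun i hi => by exact_mod_cast Nat.choose_pos hi
  have key := congrArg (fun p => p.coeff m) (sum_coeff_su2Poly_mul c t hc hct hm)
  simp only [finsetSum_coeff, coeff_C_mul, coeff_X_pow, if_true] at key
  have hconj : ∀ i, ((C (c : ℂ) * X - C t) ^ i *
      (C (c : ℂ) + C ((starRingEnd ℂ) t) * X) ^ (N - i)).coeff m = (starRingEnd ℂ)
      (((C (c : ℂ) * X - C ((starRingEnd ℂ) t)) ^ i * (C (c : ℂ) + C t * X) ^ (N - i)).coeff m) := by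
    intro i
    rw [← coeff_map]
    simp [Polynomial.map_mul, Polynomial.map_pow]
  have hterm : ∀ i ∈ Finset.range (N + 1), (su2Poly c t N m).coeff i *
      ((C (c : ℂ) * X - C t) ^ i * (C (c : ℂ) + C ((starRingEnd ℂ) t) * X) ^ (N - i)).coeff m
      = (((N.choose m : ℝ) / N.choose i * ‖(su2Poly c t N m).coeff i‖ ^ 2 : ℝ) : ℂ) := by
    intro i hi
    have hi : i ≤ N := by simpa [Nat.lt_succ_iff] using hi
    have h0 : (N.choose i : ℂ) ≠ 0 := by exact_mod_cast (Nat.choose_pos hi).ne'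
    have h1 := choose_mul_coeff_su2Poly c t (j := i) hm
    have h2 : ((C (c : ℂ) * X - C ((starRingEnd ℂ) t)) ^ i * (C (c : ℂ) + C t * X) ^ (N - i)).coeff m
        = (N.choose m : ℂ) / (N.choose i : ℂ) * (su2Poly c t N m).coeff i := by
      rw [div_mul_eq_mul_div, h1]; field_simp
    rw [hconj, h2]
    push_cast
    rw [← Complex.mul_conj']
    simp
    ring
  rw [Finset.sum_congr rfl hterm, ← Complex.ofReal_sum] at key
  have key' : ∑ i ∈ Finset.range (N + 1),
      ((N.choose m : ℝ) / N.choose i * ‖(su2Poly c t N m).coeff i‖ ^ 2) = 1 := by exact_mod_cast key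
  have := Finset.single_le_sum (f := fun i => ((N.choose m : ℝ) / N.choose i *
    ‖(su2Poly c t N m).coeff i‖ ^ 2)) (fun i _ => by positivity)
    (Finset.mem_range.2 (Nat.lt_succ_of_le hj))
  rw [key'] at this
  have h3 := hch j hj
  rw [div_mul_eq_mul_div, div_le_one h3] at this
  exact this

end SL2Spectral
namespace SL2Spectral

/-! ### Fourier coefficients on the circle -/

open Complex in
/-- The mean value property along the doubly traversed unit circle `φ ↦ e^{2iφ}`. -/
lemma integral_exp_two_mul (h : ℂ → ℂ) (hd : DiffContOnCl ℂ h (Metric.ball 0 1)) :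
    ∫ φ in (0 : ℝ)..(2 * Real.pi), h (exp (2 * φ * I)) = 2 * Real.pi * h 0 := by
  have hsq : DiffContOnCl ℂ (fun z : ℂ => h (z ^ 2)) (Metric.ball 0 |1|) := by
    rw [abs_one]
    refine hd.comp (g := fun z : ℂ => z ^ 2)
      (Differentiable.diffContOnCl (by fun_prop)) fun z hz => ?_
    simp only [Metric.mem_ball, dist_zero_right, norm_pow] at hz ⊢
    exact pow_lt_one₀ (norm_nonneg _) hz two_ne_zero
  have := hsq.circleAverage
  rw [Real.circleAverage_def] at this
  have e : ∀ φ : ℝ, h (circleMap 0 1 φ ^ 2) = h (exp (2 * φ * I)) := fun φ => by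
    simp only [circleMap, ofReal_one, one_mul, zero_add, ← exp_nat_mul]
    congr 2; push_cast; ring
  simp only [e] at this
  rw [zero_pow two_ne_zero] at this
  rw [← this, real_smul, ← mul_assoc]
  push_cast
  rw [mul_inv_cancel₀, one_mul]
  simp [Real.pi_ne_zero]

lemma one_add_mul_ne_zero {t w : ℂ} (ht : ‖t‖ < 1) (hw : ‖w‖ ≤ 1) : 1 + t * w ≠ 0 := by
  intro h
  have : ‖t * w‖ = 1 := by
    rw [show t * w = -1 by linear_combination h]; simp
  rw [norm_mul] at this
  nlinarith [norm_nonneg t, norm_nonneg w]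

open Complex in
lemma integral_pow_mul_div (t : ℂ) (ht : ‖t‖ < 1) (p m r : ℕ) :
    ∫ φ in (0 : ℝ)..(2 * Real.pi), exp (2 * φ * I) ^ p * (exp (2 * φ * I) + (starRingEnd ℂ) t) ^ m /
      (1 + t * exp (2 * φ * I)) ^ r = 2 * Real.pi * (0 ^ p * (starRingEnd ℂ) t ^ m) := by
  rw [integral_exp_two_mul (fun w => w ^ p * (w + (starRingEnd ℂ) t) ^ m / (1 + t * w) ^ r)]
  · simp
  · refine DifferentiableOn.diffContOnCl fun w hw => ?_
    have hw : ‖w‖ ≤ 1 := by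
      rw [closure_ball _ one_ne_zero] at hw; simpa using hw
    have := pow_ne_zero r (one_add_mul_ne_zero ht hw)
    refine DifferentiableAt.differentiableWithinAt ?_
    exact DifferentiableAt.div (by fun_prop) (by fun_prop) this

open Complex in
lemma integral_zpow_mul_zpow (t : ℂ) (ht : ‖t‖ < 1) (j n : ℕ) :
    ∫ φ in (0 : ℝ)..(2 * Real.pi), exp (2 * φ * I) ^ ((j : ℤ) - n) *
      (1 + t * exp (2 * φ * I)) ^ ((n : ℤ) - 1 - j) = if j = n then 2 * (Real.pi : ℂ) else 0 := by
  rcases le_or_gt n j with h | h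
  · obtain ⟨p, rfl⟩ := Nat.exists_eq_add_of_le h
    have := integral_pow_mul_div t ht p 0 (p + 1)
    simp only [pow_zero, mul_one] at this
    convert this using 2
    · ext φ
      rw [show (((n + p : ℕ) : ℤ) - n) = (p : ℤ) by push_cast; ring,
        show ((n : ℤ) - 1 - ((n + p : ℕ) : ℤ)) = -((p + 1 : ℕ) : ℤ) by push_cast; ring,
        zpow_neg, zpow_natCast, zpow_natCast]
      rfl
    · rcases Nat.eq_zero_or_pos p with rfl | hp
      · simp
      · simp [hp.ne']
  · obtain ⟨p, rfl⟩ := Nat.exists_eq_add_of_lt h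
    rw [if_neg (by omega)]
    -- for `j < n` the integrand is antiholomorphic, with mean value zero
    have := integral_pow_mul_div t ht 1 p 0
    simp only [pow_zero, div_one, pow_one, zero_mul, mul_zero] at this
    have h2 := congrArg (starRingEnd ℂ) this
    rw [intervalIntegral.integral_of_le (by positivity), ← integral_conj, map_zero,
      ← intervalIntegral.integral_of_le (by positivity)] at h2
    rw [← h2]
    refine intervalIntegral.integral_congr fun φ _ => ?_
    have hE : (starRingEnd ℂ) (exp (2 * φ * I)) = (exp (2 * φ * I))⁻¹ := by
      rw [← exp_conj, ← exp_neg]; congr 1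
      simp [show (starRingEnd ℂ) 2 = 2 from map_ofNat _ 2]
    have h0 := exp_ne_zero (2 * φ * I)
    simp only [map_mul, map_pow, map_add, hE, conj_conj]
    rw [show ((j : ℤ) - ((j + p + 1 : ℕ) : ℤ)) = -((p + 1 : ℕ) : ℤ) by push_cast; ring,
      show (((j + p + 1 : ℕ) : ℤ) - 1 - j) = (p : ℤ) by push_cast; ring, zpow_neg, zpow_natCast,
      zpow_natCast]
    have : (exp (2 * φ * I))⁻¹ + t = (exp (2 * φ * I))⁻¹ * (1 + t * exp (2 * φ * I)) := by
      field_simp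
    rw [this, mul_pow]
    field_simp
    rw [pow_succ', mul_right_comm, one_div, inv_pow]
    field_simp

/-- Integrands of discrete series type have the matrix coefficients of `SU(2)` as their Fourier
coefficients: this is the Lagrange inversion formula for the substitution `z = c w / (1 + t̄ w)`,
which carries `c z + t` to `(w + t) / (1 + t̄ w)` and `c - t̄ z` to `c / (1 + t̄ w)`. -/
lemma integral_eq_coeff_su2Poly (c : ℝ) (t : ℂ) (hc : c ≠ 0)
    (hct : (c : ℂ) ^ 2 + t * (starRingEnd ℂ) t = 1) (ht : ‖t‖ < 1) (m b n : ℕ) :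
    (c : ℂ) ^ b * ∫ φ in (0 : ℝ)..(2 * Real.pi), (Complex.exp (2 * φ * Complex.I) ^ n)⁻¹ *
      (Complex.exp (2 * φ * Complex.I) + t) ^ m /
      (1 + (starRingEnd ℂ) t * Complex.exp (2 * φ * Complex.I)) ^ (m + b + 1) =
      2 * Real.pi * (su2Poly c t (m + n + b) m).coeff n := by
  set s := (starRingEnd ℂ) t with hs
  have hs1 : ‖s‖ < 1 := by simpa [hs] using ht
  have hc' : (c : ℂ) ≠ 0 := by exact_mod_cast hc
  have hpt : ∀ w : ℂ, ‖w‖ = 1 → (c : ℂ) ^ (n + b) * ((w ^ n)⁻¹ * (w + t) ^ m / (1 + s * w) ^ (m + b + 1))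
      = ∑ j ∈ Finset.range (m + n + b + 1), ((su2Poly c t (m + n + b) m).coeff j * c ^ j) *
        (w ^ ((j : ℤ) - n) * (1 + s * w) ^ ((n : ℤ) - 1 - j)) := by
    intro w hw
    have hD : 1 + s * w ≠ 0 := one_add_mul_ne_zero hs1 hw.le
    obtain ⟨D, hDe⟩ : ∃ D, D = 1 + s * w := ⟨_, rfl⟩
    rw [← hDe] at hD ⊢
    have hw0 : w ≠ 0 := by rintro rfl; simp at hw
    have h1 := Polynomial.eval_eq_sum_range' (Nat.lt_succ_of_le
      (su2Poly_natDegree_le c t (N := m + n + b) (m := m) (by omega))) (c * w / D)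
    have ea : c * (c * w / D) + t = (w + t) / D := by
      field_simp; rw [hDe]; linear_combination w * hct
    have eb : c - s * (c * w / D) = c / D := by
      field_simp; rw [hDe]; ring
    have h1' : ((w + t) / D) ^ m * (c / D) ^ (n + b)
        = (su2Poly c t (m + n + b) m).eval (c * w / D) := by
      simp only [su2Poly, ← hs, Polynomial.eval_mul, Polynomial.eval_pow, Polynomial.eval_add,
        Polynomial.eval_sub, Polynomial.eval_C, Polynomial.eval_X, ea, eb]
      rw [show m + n + b - m = n + b by omega]
    have h2 : (c : ℂ) ^ (n + b) * ((w ^ n)⁻¹ * (w + t) ^ m / D ^ (m + b + 1))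
        = (((w + t) / D) ^ m * (c / D) ^ (n + b)) *
          ((w ^ n)⁻¹ * D ^ ((n : ℤ) - 1)) := by
      rw [zpow_sub₀ hD, zpow_natCast, zpow_one, div_pow, div_pow]
      field_simp
      ring
    rw [h2, h1', h1, Finset.sum_mul]
    refine Finset.sum_congr rfl fun j _ => ?_
    rw [zpow_sub₀ hD, zpow_sub₀ hD, zpow_sub₀ hD, zpow_sub₀ hw0, div_pow, mul_pow]
    simp only [zpow_natCast, zpow_one]
    field_simp
  have hE : ∀ φ : ℝ, ‖Complex.exp (2 * φ * Complex.I)‖ = 1 := fun φ => by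
    have := Complex.norm_exp_ofReal_mul_I (2 * φ); push_cast at this; exact this
  have hcont : ∀ j : ℤ, Continuous fun φ : ℝ => Complex.exp (2 * φ * Complex.I) ^ j *
      (1 + s * Complex.exp (2 * φ * Complex.I)) ^ ((n : ℤ) - 1 - (j + n)) := fun j =>
    (Continuous.zpow₀ (by fun_prop) _ fun φ => Or.inl (Complex.exp_ne_zero _)).mul
      (Continuous.zpow₀ (by fun_prop) _ fun φ => Or.inl (one_add_mul_ne_zero hs1 (hE φ).le))
  have hint : (c : ℂ) ^ (n + b) * ∫ φ in (0 : ℝ)..(2 * Real.pi), (Complex.exp (2 * φ * Complex.I) ^ n)⁻¹ *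
      (Complex.exp (2 * φ * Complex.I) + t) ^ m /
      (1 + s * Complex.exp (2 * φ * Complex.I)) ^ (m + b + 1)
      = ∑ j ∈ Finset.range (m + n + b + 1), ((su2Poly c t (m + n + b) m).coeff j * c ^ j) *
        (if j = n then 2 * (Real.pi : ℂ) else 0) := by
    rw [← intervalIntegral.integral_const_mul]
    rw [intervalIntegral.integral_congr (g := fun φ : ℝ => ∑ j ∈ Finset.range (m + n + b + 1),
      ((su2Poly c t (m + n + b) m).coeff j * c ^ j) * (Complex.exp (2 * φ * Complex.I) ^ ((j : ℤ) - n)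
      * (1 + s * Complex.exp (2 * φ * Complex.I)) ^ ((n : ℤ) - 1 - j)))
      fun φ _ => hpt _ (hE φ)]
    rw [intervalIntegral.integral_finsetSum]
    · refine Finset.sum_congr rfl fun j _ => ?_
      rw [intervalIntegral.integral_const_mul, integral_zpow_mul_zpow s hs1]
    · intro j _
      refine (Continuous.const_mul ?_ _).intervalIntegrable _ _
      simpa using hcont (j - n)
  simp only [mul_ite, mul_zero, Finset.sum_ite_eq', Finset.mem_range] at hint
  rw [if_pos (by omega), pow_add, mul_assoc] at hint
  have := mul_left_cancel₀ (pow_ne_zero n hc') (hint.trans (by ring : _ = (c : ℂ) ^ n *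
    (2 * Real.pi * (su2Poly c t (m + n + b) m).coeff n)))
  exact this

end SL2Spectral
namespace SL2Spectral

/-! ### The harmonics in terms of the bottom row -/

/-- The bottom row `(c, d)` of `g` as the complex number `d - ic`. -/
noncomputable def rowC (g : G) : ℂ := (g 1 1 : ℂ) - Complex.I * (g 1 0 : ℂ)

/-- The coefficient of `e^{iφ}` in the bottom row of `k[φ] g`. -/
noncomputable def cartanP (g : G) : ℂ :=
  ((g 1 1 : ℂ) + g 0 0 + Complex.I * (g 0 1 - g 1 0)) / 2

/-- The coefficient of `e^{-iφ}` in the bottom row of `k[φ] g`. -/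
noncomputable def cartanQ (g : G) : ℂ :=
  ((g 1 1 : ℂ) - g 0 0 - Complex.I * (g 0 1 + g 1 0)) / 2

lemma det_eq (g : G) : g 0 0 * g 1 1 - g 0 1 * g 1 0 = 1 := by
  have := g.det_coe
  rwa [Matrix.det_fin_two] at this

lemma normSq_rowC (g : G) : ‖rowC g‖ ^ 2 = g 1 0 ^ 2 + g 1 1 ^ 2 := by
  rw [Complex.sq_norm, Complex.normSq_apply]
  simp [rowC]; ring

lemma rowC_ne_zero (g : G) : rowC g ≠ 0 := by
  intro h
  have h1 := normSq_rowC g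
  rw [h, norm_zero] at h1
  have h0 : g 1 0 = 0 := by nlinarith [sq_nonneg (g 1 0), sq_nonneg (g 1 1)]
  have h2 : g 1 1 = 0 := by nlinarith [sq_nonneg (g 1 0), sq_nonneg (g 1 1)]
  have := det_eq g
  rw [h0, h2] at this
  simp at this

lemma iwasawaY_eq (g : G) : iwasawaY g = (‖rowC g‖ ^ 2)⁻¹ := by
  rw [normSq_rowC, iwasawaY, one_div]

lemma iwasawaY_pos (g : G) : 0 < iwasawaY g := by
  rw [iwasawaY_eq]; have := norm_pos_iff.2 (rowC_ne_zero g); positivity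

lemma iwasawaPhase_eq (g : G) : iwasawaPhase g = rowC g / ‖rowC g‖ := by
  rw [iwasawaPhase, rowC, ← normSq_rowC, Real.sqrt_sq (norm_nonneg _), rowC]

lemma norm_iwasawaPhase (g : G) : ‖iwasawaPhase g‖ = 1 := by
  rw [iwasawaPhase_eq, norm_div]
  simp [rowC_ne_zero]

lemma iwasawaPhase_ne_zero (g : G) : iwasawaPhase g ≠ 0 :=
  norm_ne_zero_iff.1 (by rw [norm_iwasawaPhase]; exact one_ne_zero)

lemma norm_phiBasic (ℓ : ℤ) (ν : ℂ) (g : G) :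
    ‖phiBasic ℓ ν g‖ = iwasawaY g ^ (1 / 2 + ν.re) := by
  rw [phiBasic, norm_mul, norm_zpow, norm_iwasawaPhase, one_zpow, mul_one,
    Complex.norm_cpow_eq_rpow_re_of_pos (iwasawaY_pos g)]
  simp

lemma conj_phiBasic (ℓ : ℤ) (ν : ℂ) (g : G) :
    (starRingEnd ℂ) (phiBasic ℓ ν g) = phiBasic (-ℓ) ((starRingEnd ℂ) ν) g := by
  have h1 : (starRingEnd ℂ) (iwasawaPhase g) = (iwasawaPhase g)⁻¹ := by
    rw [Complex.inv_def, Complex.normSq_eq_norm_sq, norm_iwasawaPhase]; simp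
  rw [phiBasic, phiBasic, map_mul, map_zpow₀, h1, inv_zpow, zpow_neg]
  congr 1
  have := Complex.conj_cpow (iwasawaY g : ℂ) (1 / 2 + (starRingEnd ℂ) ν) ?_
  · rw [Complex.conj_ofReal] at this
    rw [this]; simp [show (starRingEnd ℂ) 2 = 2 from map_ofNat _ 2]
  · rw [Complex.arg_ofReal_of_nonneg (iwasawaY_pos g).le]; exact Real.pi_pos.ne

lemma conj_phiTyped (ℓ₁ ℓ₂ : ℤ) (ν : ℂ) (g : G) :
    (starRingEnd ℂ) (phiTyped ℓ₁ ℓ₂ ν g) = phiTyped (-ℓ₁) (-ℓ₂) ((starRingEnd ℂ) ν) g := by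
  rw [phiTyped, phiTyped, map_mul, Complex.conj_ofReal,
    intervalIntegral.integral_of_le (by positivity), ← integral_conj,
    ← intervalIntegral.integral_of_le (by positivity)]
  congr 1
  refine intervalIntegral.integral_congr fun t _ => ?_
  simp only [map_mul, conj_phiBasic, ← Complex.exp_conj]
  simp

@[simp] lemma kMat_00 (t : ℝ) : (kMat t) 0 0 = Real.cos t := rfl
@[simp] lemma kMat_01 (t : ℝ) : (kMat t) 0 1 = Real.sin t := rfl
@[simp] lemma kMat_10 (t : ℝ) : (kMat t) 1 0 = -Real.sin t := rfl
@[simp] lemma kMat_11 (t : ℝ) : (kMat t) 1 1 = Real.cos t := rfl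
@[simp] lemma nMat_00 (t : ℝ) : (nMat t) 0 0 = 1 := rfl
@[simp] lemma nMat_01 (t : ℝ) : (nMat t) 0 1 = t := rfl
@[simp] lemma nMat_10 (t : ℝ) : (nMat t) 1 0 = 0 := rfl
@[simp] lemma nMat_11 (t : ℝ) : (nMat t) 1 1 = 1 := rfl

lemma mul_apply' (g h : G) (i j : Fin 2) : (g * h) i j = g i 0 * h 0 j + g i 1 * h 1 j := by
  rw [Matrix.SpecialLinearGroup.coe_mul, Matrix.mul_apply, Fin.sum_univ_two]

lemma ext' {g h : G} (h00 : g 0 0 = h 0 0) (h01 : g 0 1 = h 0 1) (h10 : g 1 0 = h 1 0)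
    (h11 : g 1 1 = h 1 1) : g = h := by
  refine Matrix.SpecialLinearGroup.ext _ _ fun i j => ?_
  fin_cases i <;> fin_cases j <;> assumption

lemma kMat_add (s t : ℝ) : kMat (s + t) = kMat s * kMat t := by
  apply ext' <;> simp [mul_apply', Real.cos_add, Real.sin_add] <;> ring

lemma nMat_add (s t : ℝ) : nMat (s + t) = nMat s * nMat t := by
  apply ext' <;> simp [mul_apply', add_comm]

@[simp] lemma kMat_zero : kMat 0 = 1 := by apply ext' <;> simp
@[simp] lemma nMat_zero : nMat 0 = 1 := by apply ext' <;> simp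

lemma rowC_mul_kMat (g : G) (t : ℝ) : rowC (g * kMat t) = rowC g * Complex.exp (Complex.I * t) := by
  rw [mul_comm Complex.I, Complex.exp_mul_I]
  simp only [rowC, mul_apply', kMat_00, kMat_01, kMat_10, kMat_11]
  push_cast
  linear_combination (g 1 0 : ℂ) * Complex.sin t * Complex.I_sq

lemma rowC_kMat_mul (g : G) (t : ℝ) : rowC (kMat t * g) =
    cartanP g * Complex.exp (Complex.I * t) + cartanQ g * Complex.exp (-(Complex.I * t)) := by
  rw [mul_comm Complex.I, ← neg_mul, Complex.exp_mul_I, Complex.exp_mul_I]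
  simp only [rowC, mul_apply', kMat_10, kMat_11, cartanP, cartanQ]
  push_cast
  rw [Complex.cos_neg, Complex.sin_neg]
  linear_combination (-(g 0 1 : ℂ)) * Complex.sin t * Complex.I_sq

lemma normSq_cartanP (g : G) : ‖cartanP g‖ ^ 2 = 1 + uFun g := by
  rw [Complex.sq_norm, Complex.normSq_apply]
  simp [cartanP, uFun]; nlinarith [det_eq g]

lemma normSq_cartanQ (g : G) : ‖cartanQ g‖ ^ 2 = uFun g := by
  rw [Complex.sq_norm, Complex.normSq_apply]
  simp [cartanQ, uFun]; nlinarith [det_eq g]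

lemma uFun_nonneg (g : G) : 0 ≤ uFun g := by
  rw [← normSq_cartanQ]; positivity

lemma phiBasic_mul_kMat (ℓ : ℤ) (ν : ℂ) (g : G) (t : ℝ) :
    phiBasic ℓ ν (g * kMat t) = Complex.exp (Complex.I * ℓ * t) * phiBasic ℓ ν g := by
  have hn : ‖rowC (g * kMat t)‖ = ‖rowC g‖ := by
    rw [rowC_mul_kMat, norm_mul, mul_comm Complex.I, Complex.norm_exp_ofReal_mul_I, mul_one]
  have hE : Complex.exp (Complex.I * ℓ * t) = Complex.exp (Complex.I * t) ^ ℓ := by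
    rw [← Complex.exp_int_mul]; congr 1; ring
  rw [phiBasic, phiBasic, iwasawaY_eq, iwasawaY_eq, iwasawaPhase_eq, iwasawaPhase_eq, hn,
    rowC_mul_kMat, hE, mul_div_right_comm, mul_zpow]
  ring

lemma phiTyped_mul_kMat (ℓ₁ ℓ₂ : ℤ) (ν : ℂ) (g : G) (t : ℝ) :
    phiTyped ℓ₁ ℓ₂ ν (g * kMat t) = Complex.exp (Complex.I * ℓ₂ * t) * phiTyped ℓ₁ ℓ₂ ν g := by
  simp only [phiTyped, ← mul_assoc, phiBasic_mul_kMat]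
  simp only [mul_assoc, intervalIntegral.integral_const_mul]
  ring

lemma kMat_two_pi : kMat (2 * Real.pi) = 1 := by apply ext' <;> simp

lemma phiTyped_kMat_mul (ℓ₁ ℓ₂ : ℤ) (ν : ℂ) (g : G) (t : ℝ) :
    phiTyped ℓ₁ ℓ₂ ν (kMat t * g) = Complex.exp (Complex.I * ℓ₁ * t) * phiTyped ℓ₁ ℓ₂ ν g := by
  set F : ℝ → ℂ := fun s => phiBasic ℓ₂ ν (kMat s * g) * Complex.exp (-Complex.I * (ℓ₁ : ℂ) * s)
  have hper : Function.Periodic F (2 * Real.pi) := by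
    intro s
    simp only [F, kMat_add, kMat_two_pi, mul_one]
    congr 1
    rw [Complex.exp_eq_exp_iff_exists_int]
    exact ⟨-ℓ₁, by push_cast; ring⟩
  have hsh : ∀ s : ℝ, phiBasic ℓ₂ ν (kMat s * (kMat t * g)) * Complex.exp (-Complex.I * (ℓ₁ : ℂ) * s)
      = Complex.exp (Complex.I * ℓ₁ * t) * F (s + t) := by
    intro s
    simp only [F, kMat_add, mul_assoc]
    rw [mul_left_comm (Complex.exp _), ← Complex.exp_add]
    congr 2
    push_cast; ring
  simp only [phiTyped, hsh]
  rw [intervalIntegral.integral_const_mul, intervalIntegral.integral_comp_add_right (fun s => F s)]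
  have := hper.intervalIntegral_add_eq t 0
  rw [zero_add] at this
  rw [zero_add, add_comm, this]
  ring

end SL2Spectral
namespace SL2Spectral

/-! ### The discrete series -/

/-- At the points `ν = (k - 1) / 2` the function `φ_ℓ` with `ℓ = 2m + k` is the quotient of a power
of `d - ic` by a power of `d + ic`. -/
lemma phiBasic_discrete (k m : ℕ) (g : G) :
    phiBasic (2 * m + k : ℤ) (((k : ℂ) - 1) / 2) g
      = rowC g ^ m / (starRingEnd ℂ) (rowC g) ^ (m + k) := by
  have hr := rowC_ne_zero g
  have hn : (‖rowC g‖ : ℂ) ≠ 0 := by exact_mod_cast norm_ne_zero_iff.2 hr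
  have hc : (starRingEnd ℂ) (rowC g) = (‖rowC g‖ : ℂ) ^ 2 / rowC g := by
    rw [eq_div_iff hr, ← Complex.mul_conj', mul_comm]
  have h1 : (iwasawaY g : ℂ) ^ (1 / 2 + ((k : ℂ) - 1) / 2) = ((‖rowC g‖ : ℂ) ^ k)⁻¹ := by
    have e : (1 / 2 + ((k : ℂ) - 1) / 2) = ((k / 2 : ℝ) : ℂ) := by push_cast; ring
    rw [e, ← Complex.ofReal_cpow (iwasawaY_pos g).le, iwasawaY_eq, ← Real.rpow_natCast, ← Complex.ofReal_pow,
      ← Complex.ofReal_inv]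
    congr 1
    rw [Real.inv_rpow (by positivity), ← Real.rpow_mul (norm_nonneg _)]
    congr 1
    rw [← Real.rpow_natCast]; congr 1; push_cast; ring
  rw [phiBasic, h1, iwasawaPhase_eq, hc,
    show (2 * m + k : ℤ) = ((2 * m + k : ℕ) : ℤ) by push_cast; ring, zpow_natCast]
  rw [div_pow, div_pow, div_div_eq_mul_div, inv_mul_eq_div, div_div, div_eq_div_iff
    (by positivity) (by positivity)]
  ring

lemma cartanP_ne_zero (g : G) : cartanP g ≠ 0 := by
  intro h
  have := normSq_cartanP g
  rw [h, norm_zero] at this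
  nlinarith [uFun_nonneg g]

/-- The Fourier integral of the discrete series harmonics in the variable `w = e^{2iφ}`. -/
lemma phiTyped_discrete (k m : ℕ) (n : ℤ) (g : G) :
    phiTyped (2 * n + k : ℤ) (2 * m + k : ℤ) (((k : ℂ) - 1) / 2) g =
      (1 / (2 * Real.pi) : ℝ) * (cartanP g ^ m / (starRingEnd ℂ) (cartanP g) ^ (m + k) *
      ∫ φ in (0 : ℝ)..(2 * Real.pi), Complex.exp (2 * φ * Complex.I) ^ (-n) *
      (Complex.exp (2 * φ * Complex.I) + cartanQ g / cartanP g) ^ m /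
      (1 + (starRingEnd ℂ) (cartanQ g / cartanP g) * Complex.exp (2 * φ * Complex.I)) ^ (m + k)) := by
  rw [phiTyped]
  congr 1
  rw [← intervalIntegral.integral_const_mul]
  refine intervalIntegral.integral_congr fun φ _ => ?_
  have hP := cartanP_ne_zero g
  have hP' : (starRingEnd ℂ) (cartanP g) ≠ 0 := by simpa using hP
  set e := Complex.exp (Complex.I * φ) with he
  have he0 : e ≠ 0 := Complex.exp_ne_zero _
  have hw : Complex.exp (2 * φ * Complex.I) = e ^ 2 := by
    rw [he, ← Complex.exp_nat_mul]; congr 1; push_cast; ring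
  have hconj : (starRingEnd ℂ) e = e⁻¹ := by
    rw [he, ← Complex.exp_conj, ← Complex.exp_neg]; congr 1; simp
  have hl : Complex.exp (-Complex.I * ((2 * n + k : ℤ) : ℂ) * φ) = (e ^ 2) ^ (-n) * (e ^ k)⁻¹ := by
    rw [← zpow_natCast e k, ← zpow_neg, ← zpow_natCast e 2, ← zpow_mul, ← zpow_add₀ he0, he,
      ← Complex.exp_int_mul]
    congr 1; push_cast; ring
  have hf : rowC (kMat φ * g) = cartanP g * e⁻¹ * (e ^ 2 + cartanQ g / cartanP g) := by
    rw [rowC_kMat_mul, Complex.exp_neg, ← he]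
    field_simp
  have hf' : (starRingEnd ℂ) (rowC (kMat φ * g)) = (starRingEnd ℂ) (cartanP g) * e⁻¹ *
      (1 + (starRingEnd ℂ) (cartanQ g / cartanP g) * e ^ 2) := by
    rw [rowC_kMat_mul, Complex.exp_neg, ← he]
    simp only [map_add, map_mul, hconj, map_inv₀, map_div₀]
    field_simp
  simp only [phiBasic_discrete, hl, hf', hw]
  rw [hf, mul_pow, mul_pow, mul_pow, mul_pow, pow_add e⁻¹]
  simp only [inv_pow]
  field_simp

lemma norm_cartanQ_div_lt (g : G) : ‖cartanQ g / cartanP g‖ < 1 := by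
  rw [norm_div, div_lt_one (norm_pos_iff.2 (cartanP_ne_zero g))]
  refine lt_of_pow_lt_pow_left₀ 2 (norm_nonneg _) ?_
  rw [normSq_cartanP, normSq_cartanQ]; linarith

/-- Harmonics of positive weight `ℓ₂` in the discrete series have no negative weights on the left. -/
lemma phiTyped_discrete_of_neg (k m : ℕ) {n : ℤ} (hn : n < 0) (g : G) :
    phiTyped (2 * n + k : ℤ) (2 * m + k : ℤ) (((k : ℂ) - 1) / 2) g = 0 := by
  obtain ⟨p, rfl⟩ : ∃ p : ℕ, n = -((p + 1 : ℕ) : ℤ) := ⟨(-n - 1).toNat, by omega⟩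
  rw [phiTyped_discrete]
  have h := integral_pow_mul_div ((starRingEnd ℂ) (cartanQ g / cartanP g))
    (by simpa using norm_cartanQ_div_lt g) (p + 1) m (m + k)
  rw [Complex.conj_conj] at h
  simp only [neg_neg, zpow_natCast]
  rw [h]
  simp

lemma norm_phiTyped_discrete (b m n : ℕ) (g : G) :
    ‖phiTyped (2 * n + (b + 1 : ℕ) : ℤ) (2 * m + (b + 1 : ℕ) : ℤ) ((((b + 1 : ℕ) : ℂ) - 1) / 2) g‖ =
      ‖cartanP g‖⁻¹ * ‖(su2Poly ‖cartanP g‖⁻¹ (cartanQ g / cartanP g) (m + n + b) m).coeff n‖ := by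
  have hP := cartanP_ne_zero g
  have hPn : ‖cartanP g‖ ≠ 0 := norm_ne_zero_iff.2 hP
  have h := integral_eq_coeff_su2Poly ‖cartanP g‖⁻¹ (cartanQ g / cartanP g) (inv_ne_zero hPn) ?_
    (norm_cartanQ_div_lt g) m b n
  · rw [phiTyped_discrete]
    simp only [zpow_neg, zpow_natCast, ← add_assoc]
    have h2 := congrArg (‖·‖) h
    simp only [norm_mul, norm_pow, Complex.norm_real, norm_inv, RCLike.norm_ofNat,
      Real.norm_eq_abs] at h2
    rw [abs_of_pos Real.pi_pos] at h2
    rw [norm_mul, norm_mul, norm_div, norm_pow, norm_pow, RCLike.norm_conj, Complex.norm_real,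
      Real.norm_eq_abs, abs_of_pos (by positivity)]
    have h3 := Real.pi_pos
    set A := ‖cartanP g‖
    set I₀ := ‖∫ φ in (0 : ℝ)..(2 * Real.pi), (Complex.exp (2 * φ * Complex.I) ^ n)⁻¹ *
      (Complex.exp (2 * φ * Complex.I) + cartanQ g / cartanP g) ^ m /
      (1 + (starRingEnd ℂ) (cartanQ g / cartanP g) * Complex.exp (2 * φ * Complex.I)) ^ (m + b + 1)‖
    have : A ^ m / A ^ (m + b + 1) * I₀ = A⁻¹ * (A⁻¹ ^ b * I₀) := by
      rw [inv_pow, div_mul_eq_mul_div, div_eq_iff (by positivity), pow_succ, pow_add]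
      field_simp
    rw [abs_of_pos (by positivity)] at h2
    rw [this, h2]
    field_simp
  · rw [Complex.mul_conj']
    have h1 := normSq_cartanP g
    have h2 := normSq_cartanQ g
    rw [norm_div]
    norm_cast
    rw [div_pow, h2, inv_pow, h1]
    have := uFun_nonneg g
    field_simp

end SL2Spectral
namespace SL2Spectral

/-! ### The normalising factors -/

/-- The square of the ratio of the two normalising factors of weight `ℓ`. -/
noncomputable def normRatio (ν : ℂ) (ℓ : ℕ) : ℝ := (‖gPhi ν ℓ‖ / gNorm ν ℓ) ^ 2

lemma sq_norm_harmonicP (ℓ₁ ℓ₂ : ℤ) (ν : ℂ) (g : G) : ‖harmonicP ℓ₁ ℓ₂ ν g‖ ^ 2 =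
    normRatio ν ℓ₁.natAbs / normRatio ν ℓ₂.natAbs * ‖phiTyped ℓ₁ ℓ₂ ν g‖ ^ 2 := by
  rw [harmonicP, norm_mul, norm_mul, norm_div, Complex.norm_real, mul_pow, mul_pow, normRatio,
    normRatio, Real.norm_eq_abs, sq_abs, ← div_pow, ← mul_pow]
  congr 2
  rw [div_div_div_eq, div_mul_div_comm]
  ring

section complementary

variable {ν : ℂ}

lemma Gamma_ne_zero_of_abs_lt (hν : |ν.re| < 1 / 2) (x : ℕ) :
    Complex.Gamma (ν + (1 + (x : ℂ)) / 2) ≠ 0 := by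
  refine Complex.Gamma_ne_zero_of_re_pos ?_
  rw [show (1 + (x : ℂ)) / 2 = (((1 + x) / 2 : ℝ) : ℂ) by push_cast; ring]
  rw [Complex.add_re, Complex.ofReal_re]
  have : (0 : ℝ) ≤ x := Nat.cast_nonneg x
  have := neg_lt_of_abs_lt hν
  linarith

lemma add_half_ne_zero (hν : |ν.re| < 1 / 2) (x : ℕ) : ν + (1 + (x : ℂ)) / 2 ≠ 0 := by
  intro h
  have := congrArg Complex.re h
  rw [show (1 + (x : ℂ)) / 2 = (((1 + x) / 2 : ℝ) : ℂ) by push_cast; ring] at this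
  rw [Complex.add_re, Complex.ofReal_re, Complex.zero_re] at this
  have h1 : (0 : ℝ) ≤ x := Nat.cast_nonneg x
  have := neg_lt_of_abs_lt hν
  linarith

lemma normRatio_eq (hν : |ν.re| < 1 / 2) (ℓ : ℕ) : normRatio ν ℓ =
    ‖Complex.Gamma (ν + (1 + ((ℓ % 2 : ℕ) : ℂ)) / 2)‖ * ‖Complex.Gamma (-ν + (1 + (ℓ : ℂ)) / 2)‖ /
    (‖Complex.Gamma (-ν + (1 + ((ℓ % 2 : ℕ) : ℂ)) / 2)‖ * ‖Complex.Gamma (ν + (1 + (ℓ : ℂ)) / 2)‖) := by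
  have hν' : |(-ν).re| < 1 / 2 := by simpa using hν
  have h1 := norm_pos_iff.2 (Gamma_ne_zero_of_abs_lt hν (ℓ % 2))
  have h2 := norm_pos_iff.2 (Gamma_ne_zero_of_abs_lt hν ℓ)
  have h3 := norm_pos_iff.2 (Gamma_ne_zero_of_abs_lt hν' (ℓ % 2))
  have h4 := norm_pos_iff.2 (Gamma_ne_zero_of_abs_lt hν' ℓ)
  have h5 : (0 : ℝ) < 2 ^ (-((ℓ : ℝ) - (ℓ % 2 : ℕ)) / 2) := Real.rpow_pos_of_pos two_pos _
  rw [normRatio, gPhi, gNorm, if_pos (lt_of_abs_lt hν), norm_mul, Complex.norm_real,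
    Real.norm_of_nonneg h5.le, div_pow, mul_pow, mul_pow, Real.sq_sqrt (norm_nonneg _), norm_div, norm_div,
    norm_mul, norm_mul, add_comm _ ν, add_comm _ ν]
  field_simp

lemma normRatio_pos (hν : |ν.re| < 1 / 2) (ℓ : ℕ) : 0 < normRatio ν ℓ := by
  have hν' : |(-ν).re| < 1 / 2 := by simpa using hν
  have h1 := norm_pos_iff.2 (Gamma_ne_zero_of_abs_lt hν (ℓ % 2))
  have h2 := norm_pos_iff.2 (Gamma_ne_zero_of_abs_lt hν ℓ)
  have h3 := norm_pos_iff.2 (Gamma_ne_zero_of_abs_lt hν' (ℓ % 2))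
  have h4 := norm_pos_iff.2 (Gamma_ne_zero_of_abs_lt hν' ℓ)
  rw [normRatio_eq hν]; positivity

lemma normRatio_of_lt_two (hν : |ν.re| < 1 / 2) {ℓ : ℕ} (hℓ : ℓ < 2) : normRatio ν ℓ = 1 := by
  have hν' : |(-ν).re| < 1 / 2 := by simpa using hν
  have h2 := norm_pos_iff.2 (Gamma_ne_zero_of_abs_lt hν ℓ)
  have h4 := norm_pos_iff.2 (Gamma_ne_zero_of_abs_lt hν' ℓ)
  rw [normRatio_eq hν, Nat.mod_eq_of_lt hℓ, mul_comm, div_self (by positivity)]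

/-- The recursion for the Gamma factors. -/
lemma normRatio_add_two (hν : |ν.re| < 1 / 2) (ℓ : ℕ) : normRatio ν (ℓ + 2) =
    normRatio ν ℓ * (‖-ν + (1 + (ℓ : ℂ)) / 2‖ / ‖ν + (1 + (ℓ : ℂ)) / 2‖) := by
  have hν' : |(-ν).re| < 1 / 2 := by simpa using hν
  have e : ∀ z : ℂ, z + (1 + ((ℓ + 2 : ℕ) : ℂ)) / 2 = z + (1 + (ℓ : ℂ)) / 2 + 1 := fun z => by
    push_cast; ring
  rw [normRatio_eq hν, normRatio_eq hν, Nat.add_mod_right, e, e,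
    Complex.Gamma_add_one _ (add_half_ne_zero hν ℓ), Complex.Gamma_add_one _ (add_half_ne_zero hν' ℓ),
    norm_mul, norm_mul, div_mul_div_comm]
  ring

/-- On the unitary axis the normalising factors have absolute value one. -/
lemma normRatio_of_re_eq_zero (hν : ν.re = 0) (ℓ : ℕ) : normRatio ν ℓ = 1 := by
  have hν' : |ν.re| < 1 / 2 := by rw [hν]; norm_num
  induction ℓ using Nat.twoStepInduction with
  | zero => exact normRatio_of_lt_two hν' (by norm_num)
  | one => exact normRatio_of_lt_two hν' (by norm_num)
  | more n ih _ =>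
    rw [normRatio_add_two hν', ih, one_mul]
    have : -ν + (1 + (n : ℂ)) / 2 = (starRingEnd ℂ) (ν + (1 + (n : ℂ)) / 2) := by
      apply Complex.ext <;>
      simp only [Complex.add_re, Complex.add_im, Complex.conj_re, Complex.conj_im, Complex.neg_re,
        Complex.neg_im, hν] <;>
      rw [show (1 + (n : ℂ)) / 2 = (((1 + n) / 2 : ℝ) : ℂ) by push_cast; ring] <;>
      simp
    rw [this, RCLike.norm_conj, div_self]
    exact norm_ne_zero_iff.2 (add_half_ne_zero hν' n)

end complementary

section real

variable {ν : ℝ} (h0 : 0 < ν) (h1 : ν < 1 / 2)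
include h0 h1

lemma normRatio_real_pos (ℓ : ℕ) : 0 < normRatio ν ℓ :=
  normRatio_pos (by simpa [abs_of_pos h0] using h1) ℓ

lemma normRatio_real_of_lt_two {ℓ : ℕ} (hℓ : ℓ < 2) : normRatio ν ℓ = 1 :=
  normRatio_of_lt_two (by simpa [abs_of_pos h0] using h1) hℓ

lemma normRatio_real_add_two (ℓ : ℕ) :
    normRatio ν (ℓ + 2) * ((1 + ℓ) / 2 + ν) = normRatio ν ℓ * ((1 + ℓ) / 2 - ν) := by
  have hℓ : (0 : ℝ) ≤ ℓ := Nat.cast_nonneg ℓ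
  rw [normRatio_add_two (by simpa [abs_of_pos h0] using h1),
    show -(ν : ℂ) + (1 + (ℓ : ℂ)) / 2 = ((((1 + ℓ) / 2 - ν) : ℝ) : ℂ) by push_cast; ring,
    show (ν : ℂ) + (1 + (ℓ : ℂ)) / 2 = ((((1 + ℓ) / 2 + ν) : ℝ) : ℂ) by push_cast; ring,
    Complex.norm_real, Complex.norm_real, Real.norm_of_nonneg (by linarith),
    Real.norm_of_nonneg (by linarith)]
  field_simp

lemma normRatio_real_add_two_le (ℓ : ℕ) : normRatio ν (ℓ + 2) ≤ normRatio ν ℓ := by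
  have hℓ : (0 : ℝ) ≤ ℓ := Nat.cast_nonneg ℓ
  have e := normRatio_real_add_two h0 h1 ℓ
  have p := normRatio_real_pos h0 h1 ℓ
  have : normRatio ν (ℓ + 2) * ((1 + ℓ) / 2 + ν) ≤ normRatio ν ℓ * ((1 + ℓ) / 2 + ν) := by
    rw [e]; exact mul_le_mul_of_nonneg_left (by linarith) p.le
  exact le_of_mul_le_mul_right this (by positivity)

lemma mul_normRatio_real_le (ℓ : ℕ) :
    ℓ * normRatio ν ℓ ≤ ((ℓ + 2 : ℕ) : ℝ) * normRatio ν (ℓ + 2) := by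
  have hℓ : (0 : ℝ) ≤ ℓ := Nat.cast_nonneg ℓ
  have e := normRatio_real_add_two h0 h1 ℓ
  have p := normRatio_real_pos h0 h1 ℓ
  have : ℓ * normRatio ν ℓ * ((1 + ℓ) / 2 + ν)
      ≤ ((ℓ + 2 : ℕ) : ℝ) * normRatio ν (ℓ + 2) * ((1 + ℓ) / 2 + ν) := by
    rw [mul_assoc ((ℓ + 2 : ℕ) : ℝ), e]
    push_cast
    have : (ℓ : ℝ) * ((1 + ℓ) / 2 + ν) ≤ (ℓ + 2) * ((1 + ℓ) / 2 - ν) := by nlinarith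
    nlinarith
  exact le_of_mul_le_mul_right this (by positivity)

lemma normRatio_real_le_two (j : ℕ) : normRatio ν (2 * j + 2) ≤ normRatio ν 2 := by
  induction j with
  | zero => simp
  | succ j ih => exact (normRatio_real_add_two_le h0 h1 (2 * j + 2)).trans ih

lemma two_mul_normRatio_real_two_le (j : ℕ) :
    2 * normRatio ν 2 ≤ ((2 * j + 2 : ℕ) : ℝ) * normRatio ν (2 * j + 2) := by
  induction j with
  | zero => simp
  | succ j ih => exact ih.trans (mul_normRatio_real_le h0 h1 (2 * j + 2))

lemma one_le_mul_normRatio_real_odd (j : ℕ) :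
    1 ≤ ((2 * j + 1 : ℕ) : ℝ) * normRatio ν (2 * j + 1) := by
  induction j with
  | zero => simp [normRatio_real_of_lt_two h0 h1]
  | succ j ih => exact ih.trans (mul_normRatio_real_le h0 h1 (2 * j + 1))

lemma normRatio_real_le_one (ℓ : ℕ) : normRatio ν ℓ ≤ 1 := by
  induction ℓ using Nat.twoStepInduction with
  | zero => exact (normRatio_real_of_lt_two h0 h1 (by norm_num)).le
  | one => exact (normRatio_real_of_lt_two h0 h1 (by norm_num)).le
  | more n ih _ => exact (normRatio_real_add_two_le h0 h1 n).trans ih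

/-- The normalising factors grow at most polynomially, except for the passage from weight `0` to
other even weights, which degenerates as `ν → 1/2`. -/
lemma normRatio_real_le_mul {a b : ℕ} (hab : a % 2 = b % 2) (h : a ≠ 0 ∨ b = 0) :
    normRatio ν a ≤ (1 + b) * normRatio ν b := by
  have hb := normRatio_real_pos h0 h1 b
  rcases Nat.even_or_odd' b with ⟨j, rfl | rfl⟩
  · rcases j with _ | j
    · simpa [normRatio_real_of_lt_two h0 h1] using normRatio_real_le_one h0 h1 a
    · have ha : a ≠ 0 := by omega
      obtain ⟨i, rfl⟩ : ∃ i, a = 2 * i + 2 := ⟨a / 2 - 1, by omega⟩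
      have e1 := normRatio_real_le_two h0 h1 i
      have e2 := two_mul_normRatio_real_two_le h0 h1 j
      have e3 := normRatio_real_pos h0 h1 2
      rw [show 2 * (j + 1) = 2 * j + 2 by ring] at hb ⊢
      nlinarith
  · have e1 := one_le_mul_normRatio_real_odd h0 h1 j
    have e2 := normRatio_real_le_one h0 h1 a
    nlinarith

/-- The degenerate passage from weight `0`: the factor `1/2 - ν` is that of the recursion at
`ℓ = 0`. -/
lemma half_sub_mul_normRatio_zero_le {b : ℕ} (hb : b % 2 = 0) (hb0 : b ≠ 0) :
    (1 / 2 - ν) * normRatio ν 0 ≤ b * normRatio ν b := by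
  obtain ⟨j, rfl⟩ : ∃ i, b = 2 * i + 2 := ⟨b / 2 - 1, by omega⟩
  have e2 := two_mul_normRatio_real_two_le h0 h1 j
  have e := normRatio_real_add_two h0 h1 0
  have p := normRatio_real_pos h0 h1 2
  simp only [zero_add, Nat.cast_zero, add_zero] at e
  nlinarith

end real

/-- The ratio of normalising factors in the discrete series. -/
lemma normRatio_discrete (b m n : ℕ) :
    normRatio ((((b + 1 : ℕ) : ℂ) - 1) / 2) (2 * n + (b + 1)) * ((n + b).factorial * m.factorial)
      = normRatio ((((b + 1 : ℕ) : ℂ) - 1) / 2) (2 * m + (b + 1)) *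
        ((m + b).factorial * n.factorial) ∧
    0 < normRatio ((((b + 1 : ℕ) : ℂ) - 1) / 2) (2 * m + (b + 1)) := by
  rcases Nat.eq_zero_or_pos b with rfl | hb
  · have : ((((0 + 1 : ℕ) : ℂ) - 1) / 2).re = 0 := by simp
    rw [normRatio_of_re_eq_zero this, normRatio_of_re_eq_zero this]
    simp; ring
  set ν := (((b + 1 : ℕ) : ℂ) - 1) / 2 with hν
  have hνr : ν = ((b / 2 : ℝ) : ℂ) := by rw [hν]; push_cast; ring
  have hre : ν.re = b / 2 := by rw [hνr, Complex.ofReal_re]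
  have hb1 : (1 : ℝ) ≤ b := by exact_mod_cast hb
  have hneg : ¬ ν.re < 1 / 2 := by rw [hre]; linarith
  -- both factors are explicit; the powers of two and the parity factor do not depend on `m`
  obtain ⟨A, hA, key⟩ : ∃ A : ℝ, 0 < A ∧ ∀ i : ℕ, normRatio ν (2 * i + (b + 1)) =
      A * (i.factorial / (i + b).factorial) := by
    set κ := (b + 1) % 2 with hκ
    have hmod : ∀ i, (2 * i + (b + 1)) % 2 = κ := fun i => by omega
    set g₀ := ‖Complex.Gamma ((1 + (κ : ℂ)) / 2 + ν)‖ with hg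
    have hg0 : 0 < g₀ := by
      refine norm_pos_iff.2 (Complex.Gamma_ne_zero_of_re_pos ?_)
      rw [show (1 + (κ : ℂ)) / 2 + ν = (((1 + κ) / 2 + b / 2 : ℝ) : ℂ) by rw [hνr]; push_cast; ring,
        Complex.ofReal_re]
      positivity
    refine ⟨((2 : ℝ) ^ (-((b + 1 : ℝ) - κ) / 2)) ^ 2 * g₀ ^ 2 / b.factorial, by positivity, fun i => ?_⟩
    have hG1 : ‖Complex.Gamma ((1 + ((2 * i + (b + 1) : ℕ) : ℂ)) / 2 + ν)‖ = (i + b).factorial := by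
      rw [show (1 + ((2 * i + (b + 1) : ℕ) : ℂ)) / 2 + ν = ((i + b : ℕ) : ℂ) + 1 by
        rw [hν]; push_cast; ring, Complex.Gamma_nat_eq_factorial]
      simp
    have hG2 : Real.Gamma (2 * ν.re + 1) = b.factorial := by
      rw [hre, show (2 * ((b : ℝ) / 2) + 1) = (b : ℝ) + 1 by ring, Real.Gamma_nat_eq_factorial]
    have hG3 : Real.Gamma ((((2 * i + (b + 1) : ℕ) : ℝ) + (2 * ν.re + 1)) / 2) = (i + b).factorial := by
      rw [hre, show ((((2 * i + (b + 1) : ℕ) : ℝ) + (2 * ((b : ℝ) / 2) + 1)) / 2) = ((i + b : ℕ) : ℝ) + 1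
        by push_cast; ring, Real.Gamma_nat_eq_factorial]
    have hG4 : Real.Gamma ((((2 * i + (b + 1) : ℕ) : ℝ) - (2 * ν.re + 1)) / 2 + 1) = i.factorial := by
      rw [hre, show ((((2 * i + (b + 1) : ℕ) : ℝ) - (2 * ((b : ℝ) / 2) + 1)) / 2 + 1) = (i : ℝ) + 1
        by push_cast; ring, Real.Gamma_nat_eq_factorial]
    have hpow1 : (2 : ℝ) ^ (-(((2 * i + (b + 1) : ℕ) : ℝ) - κ) / 2)
        = 2 ^ (-(i : ℝ)) * 2 ^ (-((b + 1 : ℝ) - κ) / 2) := by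
      rw [← Real.rpow_add two_pos]; congr 1; push_cast; ring
    have hpow2 : (2 : ℝ) ^ (-(((2 * i + (b + 1) : ℕ) : ℝ) - (2 * ν.re + 1)) / 2) = 2 ^ (-(i : ℝ)) := by
      rw [hre]; congr 1; push_cast; ring
    have p1 : (0 : ℝ) < 2 ^ (-(i : ℝ)) := Real.rpow_pos_of_pos two_pos _
    have p2 : (0 : ℝ) < 2 ^ (-((b + 1 : ℝ) - κ) / 2) := Real.rpow_pos_of_pos two_pos _
    rw [normRatio, gPhi, gNorm, if_neg hneg, hmod, norm_mul, norm_div, hG1, hG2, hG3, hG4, hpow1,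
      hpow2, ← hg, Complex.norm_real, Real.norm_of_nonneg (by positivity), div_pow, mul_pow, mul_pow _ (√_),
      Real.sq_sqrt (abs_nonneg _), abs_of_pos (by positivity)]
    field_simp
  rw [key, key]
  refine ⟨?_, by positivity⟩
  field_simp

/-- In the discrete series the normalised harmonics are, up to a phase, matrix coefficients of
`SU(2)` divided by `√(1 + u)`. -/
lemma sq_norm_harmonicP_discrete_nat (b m n : ℕ) (g : G) :
    ‖harmonicP (2 * n + (b + 1 : ℕ) : ℤ) (2 * m + (b + 1 : ℕ) : ℤ) ((((b + 1 : ℕ) : ℂ) - 1) / 2) g‖ ^ 2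
      ≤ (1 + uFun g)⁻¹ := by
  obtain ⟨hr, hpos⟩ := normRatio_discrete b m n
  have hP := cartanP_ne_zero g
  have hPn : ‖cartanP g‖ ≠ 0 := norm_ne_zero_iff.2 hP
  have hu := uFun_nonneg g
  have hsu := choose_mul_norm_coeff_su2Poly_le ‖cartanP g‖⁻¹ (cartanQ g / cartanP g)
    (inv_ne_zero hPn) ?_ (N := m + n + b) (m := m) (j := n) (by omega) (by omega)
  · rw [sq_norm_harmonicP, norm_phiTyped_discrete, mul_pow, inv_pow, normSq_cartanP,
      show (2 * n + (b + 1 : ℕ) : ℤ).natAbs = 2 * n + (b + 1) by omega,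
      show (2 * m + (b + 1 : ℕ) : ℤ).natAbs = 2 * m + (b + 1) by omega]
    set q := ‖(su2Poly ‖cartanP g‖⁻¹ (cartanQ g / cartanP g) (m + n + b) m).coeff n‖
    have c1 := Nat.choose_mul_factorial_mul_factorial (n := m + n + b) (k := m) (by omega)
    have c2 := Nat.choose_mul_factorial_mul_factorial (n := m + n + b) (k := n) (by omega)
    rw [show m + n + b - m = n + b by omega] at c1
    rw [show m + n + b - n = m + b by omega] at c2
    have d1 : ((m + n + b).choose m : ℝ) = (m + n + b).factorial / (m.factorial * (n + b).factorial) := by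
      rw [eq_div_iff (by positivity)]; exact_mod_cast (by rw [← mul_assoc]; exact c1)
    have d2 : ((m + n + b).choose n : ℝ) = (m + n + b).factorial / (n.factorial * (m + b).factorial) := by
      rw [eq_div_iff (by positivity)]; exact_mod_cast (by rw [← mul_assoc]; exact c2)
    rw [d1, d2] at hsu
    have hsu' : q ^ 2 * (n.factorial * (m + b).factorial) ≤ m.factorial * (n + b).factorial := by
      have hF : (0 : ℝ) < (m + n + b).factorial := by positivity
      rw [div_mul_eq_mul_div, div_le_div_iff₀ (by positivity) (by positivity)] at hsu
      refine le_of_mul_le_mul_left ?_ hF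
      linarith
    set A := normRatio ((((b + 1 : ℕ) : ℂ) - 1) / 2) (2 * n + (b + 1))
    set D := normRatio ((((b + 1 : ℕ) : ℂ) - 1) / 2) (2 * m + (b + 1))
    have hA : A / D = ((m + b).factorial * n.factorial) / ((n + b).factorial * m.factorial) := by
      rw [div_eq_div_iff hpos.ne' (by positivity), hr]; ring
    have : A / D * q ^ 2 ≤ 1 := by
      rw [hA, div_mul_eq_mul_div, div_le_one (by positivity)]; linarith
    calc A / D * ((1 + uFun g)⁻¹ * q ^ 2) = (A / D * q ^ 2) * (1 + uFun g)⁻¹ := by ring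
      _ ≤ 1 * (1 + uFun g)⁻¹ := by gcongr
      _ = _ := one_mul _
  · rw [Complex.mul_conj']
    have h1 := normSq_cartanP g
    have h2 := normSq_cartanQ g
    rw [norm_div]
    norm_cast
    rw [div_pow, h2, inv_pow, h1]
    field_simp

lemma norm_harmonicP_neg (ℓ₁ ℓ₂ : ℤ) (ν : ℝ) (g : G) :
    ‖harmonicP (-ℓ₁) (-ℓ₂) ν g‖ = ‖harmonicP ℓ₁ ℓ₂ ν g‖ := by
  have h := conj_phiTyped ℓ₁ ℓ₂ ν g
  rw [Complex.conj_ofReal] at h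
  rw [← sq_eq_sq₀ (norm_nonneg _) (norm_nonneg _), sq_norm_harmonicP, sq_norm_harmonicP, ← h,
    RCLike.norm_conj, Int.natAbs_neg, Int.natAbs_neg]

lemma sq_norm_harmonicP_discrete {k : ℕ} {ℓ₁ ℓ₂ : ℤ} (hk : 1 ≤ k) (h1 : (k : ℤ) ≤ |ℓ₁|)
    (h2 : (k : ℤ) ≤ |ℓ₂|) (e1 : ℓ₁ ≡ (k : ℤ) [ZMOD 2]) (e2 : ℓ₂ ≡ (k : ℤ) [ZMOD 2]) (g : G) :
    ‖harmonicP ℓ₁ ℓ₂ (((k : ℂ) - 1) / 2) g‖ ^ 2 ≤ (1 + uFun g)⁻¹ := by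
  obtain ⟨b, rfl⟩ : ∃ b, k = b + 1 := ⟨k - 1, by omega⟩
  -- complex conjugation exchanges the holomorphic and the antiholomorphic discrete series
  wlog hpos : 0 ≤ ℓ₂ generalizing ℓ₁ ℓ₂
  · have := this (ℓ₁ := -ℓ₁) (ℓ₂ := -ℓ₂) (by rwa [abs_neg]) (by rwa [abs_neg])
      (by unfold Int.ModEq at *; omega) (by unfold Int.ModEq at *; omega) (by omega)
    have e : ((((b + 1 : ℕ) : ℂ) - 1) / 2) = ((b / 2 : ℝ) : ℂ) := by push_cast; ring
    rw [e] at this ⊢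
    rwa [norm_harmonicP_neg] at this
  rw [abs_of_nonneg hpos] at h2
  unfold Int.ModEq at e1 e2
  obtain ⟨m, rfl⟩ : ∃ m : ℕ, ℓ₂ = 2 * m + (b + 1 : ℕ) :=
    ⟨((ℓ₂ - (b + 1 : ℕ)) / 2).toNat, by omega⟩
  rcases le_or_gt 0 ℓ₁ with hl | hl
  · rw [abs_of_nonneg hl] at h1
    obtain ⟨n, rfl⟩ : ∃ n : ℕ, ℓ₁ = 2 * n + (b + 1 : ℕ) :=
      ⟨((ℓ₁ - (b + 1 : ℕ)) / 2).toNat, by omega⟩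
    exact sq_norm_harmonicP_discrete_nat b m n g
  · obtain ⟨n, hn⟩ : ∃ n : ℤ, ℓ₁ = 2 * n + (b + 1 : ℕ) := ⟨(ℓ₁ - (b + 1 : ℕ)) / 2, by omega⟩
    have := uFun_nonneg g
    rw [sq_norm_harmonicP, hn, phiTyped_discrete_of_neg (b + 1) m (by omega)]
    simp only [norm_zero, ne_eq, OfNat.ofNat_ne_zero, not_false_eq_true, zero_pow, mul_zero]
    positivity

end SL2Spectral
namespace SL2Spectral

/-! ### The Haar measure -/

open MeasureTheory Set
open scoped ENNReal

instance : MeasurableSpace G := borel G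
instance : BorelSpace G := ⟨rfl⟩

lemma continuousOn_G {X : Type*} [TopologicalSpace X] {f : X → G} {s : Set X}
    (h : ∀ i j, ContinuousOn (fun x => f x i j) s) : ContinuousOn f s := by
  have hi : Topology.IsInducing (fun g : G => (g : Matrix (Fin 2) (Fin 2) ℝ)) :=
    Topology.IsInducing.subtypeVal
  rw [hi.continuousOn_iff]
  exact continuousOn_pi.2 fun i => continuousOn_pi.2 fun j => h i j

lemma continuous_G {X : Type*} [TopologicalSpace X] {f : X → G}
    (h : ∀ i j, Continuous (fun x => f x i j)) : Continuous f := by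
  rw [← continuousOn_univ]
  exact continuousOn_G fun i j => (h i j).continuousOn

@[fun_prop]
lemma continuous_entry (i j : Fin 2) : Continuous fun g : G => g i j := by
  have h1 : Continuous fun g : G => g i := by fun_prop
  exact (continuous_apply j).comp h1

@[fun_prop]
lemma continuous_kMat : Continuous kMat := by
  refine continuous_G fun i j => ?_
  fin_cases i <;> fin_cases j <;> simp <;> fun_prop

@[fun_prop]
lemma continuous_nMat : Continuous nMat := by
  refine continuous_G fun i j => ?_
  fin_cases i <;> fin_cases j <;> simp <;> fun_prop

/-- The element of `G` with first column `(a, c)` and bottom row `(c, d)`, for `c ≠ 0`. These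
coordinates cover almost all of `G`. -/
noncomputable def bruhat (a c d : ℝ) : G :=
  if h : c ≠ 0 then ⟨!![a, (a * d - 1) / c; c, d], by
    rw [Matrix.det_fin_two_of]; field_simp; ring⟩ else 1

section
variable {a c d : ℝ} (h : c ≠ 0)
include h
lemma bruhat_00 : (bruhat a c d) 0 0 = a := by exact congrArg (fun g : G => g _ _) (dif_pos h)
lemma bruhat_01 : (bruhat a c d) 0 1 = (a * d - 1) / c := by exact congrArg (fun g : G => g _ _) (dif_pos h)
lemma bruhat_10 : (bruhat a c d) 1 0 = c := by exact congrArg (fun g : G => g _ _) (dif_pos h)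
lemma bruhat_11 : (bruhat a c d) 1 1 = d := by exact congrArg (fun g : G => g _ _) (dif_pos h)
end

lemma eq_bruhat {g : G} (h : g 1 0 ≠ 0) : g = bruhat (g 0 0) (g 1 0) (g 1 1) := by
  apply ext'
  · rw [bruhat_00 h]
  · rw [bruhat_01 h, eq_div_iff h]; linarith [det_eq g]
  · rw [bruhat_10 h]
  · rw [bruhat_11 h]

lemma measurable_bruhat : Measurable fun p : ℝ × ℝ × ℝ => bruhat p.1 p.2.1 p.2.2 := by
  have hm : MeasurableSet {p : ℝ × ℝ × ℝ | p.2.1 ≠ 0} :=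
    (isOpen_ne_fun (by fun_prop) (by fun_prop)).measurableSet
  have : (fun p : ℝ × ℝ × ℝ => bruhat p.1 p.2.1 p.2.2)
      = {p : ℝ × ℝ × ℝ | p.2.1 ≠ 0}.piecewise (fun p => bruhat p.1 p.2.1 p.2.2) (fun _ => 1) := by
    ext1 p
    by_cases hp : p.2.1 ≠ 0
    · rw [piecewise_eq_of_mem _ _ _ hp]
    · rw [piecewise_eq_of_notMem _ _ _ hp]
      exact dif_neg hp
  rw [this]
  refine ContinuousOn.measurable_piecewise (continuousOn_G fun i j => ?_) continuousOn_const hm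
  have e : ∀ (φ : ℝ × ℝ × ℝ → ℝ), ContinuousOn φ {p | p.2.1 ≠ 0} →
      (∀ p : ℝ × ℝ × ℝ, p.2.1 ≠ 0 → (bruhat p.1 p.2.1 p.2.2) i j = φ p) →
      ContinuousOn (fun p : ℝ × ℝ × ℝ => (bruhat p.1 p.2.1 p.2.2) i j) {p | p.2.1 ≠ 0} :=
    fun φ hφ he => hφ.congr fun p hp => he p hp
  fin_cases i <;> fin_cases j
  · exact e (fun p => p.1) (by fun_prop) fun p hp => bruhat_00 hp
  · exact e (fun p => (p.1 * p.2.2 - 1) / p.2.1)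
      (ContinuousOn.div (by fun_prop) (by fun_prop) fun p hp => hp) fun p hp => bruhat_01 hp
  · exact e (fun p => p.2.1) (by fun_prop) fun p hp => bruhat_10 hp
  · exact e (fun p => p.2.2) (by fun_prop) fun p hp => bruhat_11 hp

/-- The measure `dx dc dd` in the coordinates `g = n[x] s(c, d)`, where `s(c, d)` is a section of the
map from `g` to its bottom row. -/
noncomputable def rowIntegral (f : G → ℝ≥0∞) : ℝ≥0∞ :=
  ∫⁻ v : ℝ × ℝ, ∫⁻ x : ℝ, f (bruhat (x * v.1) v.1 v.2)

lemma ae_fst_ne_zero : ∀ᵐ v : ℝ × ℝ, v.1 ≠ 0 := by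
  have : (volume : Measure (ℝ × ℝ)) = (volume : Measure ℝ).prod volume := rfl
  rw [this]
  refine Measure.ae_prod_iff_ae_ae ?_ |>.2 ?_
  · exact measurableSet_eq_fun measurable_fst measurable_const |>.compl
  · filter_upwards [Measure.ae_ne volume (0 : ℝ)] with x hx
    exact Filter.Eventually.of_forall fun y => hx

/-- Right multiplication by `h` on bottom rows. -/
noncomputable def rowMap (h : G) : ℝ × ℝ →ₗ[ℝ] ℝ × ℝ :=
  Matrix.toLin (Module.Basis.finTwoProd ℝ) (Module.Basis.finTwoProd ℝ)
    !![h 0 0, h 1 0; h 0 1, h 1 1]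

lemma rowMap_apply (h : G) (v : ℝ × ℝ) :
    rowMap h v = (v.1 * h 0 0 + v.2 * h 1 0, v.1 * h 0 1 + v.2 * h 1 1) := by
  rw [rowMap, Matrix.toLin_finTwoProd_apply]
  ext <;> simp <;> ring

lemma measurePreserving_rowMap (h : G) : MeasurePreserving (rowMap h) := by
  have hdet : LinearMap.det (rowMap h) = 1 := by
    rw [rowMap, LinearMap.det_toLin, Matrix.det_fin_two_of]; linarith [det_eq h]
  refine ⟨(rowMap h).continuous_of_finiteDimensional.measurable, ?_⟩
  rw [Measure.map_linearMap_addHaar_eq_smul_addHaar _ (by rw [hdet]; exact one_ne_zero), hdet]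
  simp

lemma measurable_inner {f : G → ℝ≥0∞} (hf : Measurable f) :
    Measurable fun v : ℝ × ℝ => ∫⁻ x : ℝ, f (bruhat (x * v.1) v.1 v.2) := by
  refine Measurable.lintegral_prod_right' (f := fun p : (ℝ × ℝ) × ℝ =>
    f (bruhat (p.2 * p.1.1) p.1.1 p.1.2)) ?_
  exact hf.comp (measurable_bruhat.comp (g := fun p : ℝ × ℝ × ℝ => bruhat p.1 p.2.1 p.2.2)
    (f := fun p : (ℝ × ℝ) × ℝ => (p.2 * p.1.1, p.1.1, p.1.2)) (by fun_prop))

lemma rowIntegral_mul_right {f : G → ℝ≥0∞} (hf : Measurable f) (h : G) :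
    rowIntegral (fun g => f (g * h)) = rowIntegral f := by
  rw [rowIntegral, rowIntegral]
  rw [← (measurePreserving_rowMap h).lintegral_comp (measurable_inner hf)]
  refine lintegral_congr_ae ?_
  filter_upwards [ae_fst_ne_zero, (measurePreserving_rowMap h).quasiMeasurePreserving.ae
    ae_fst_ne_zero] with v hv hw
  rw [rowMap_apply] at hw ⊢
  dsimp only at hw ⊢
  set w₁ := v.1 * h 0 0 + v.2 * h 1 0 with hw1
  rw [← lintegral_sub_right_eq_self (fun x => f (bruhat (x * w₁) w₁ _)) (h 1 0 / (v.1 * w₁))]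
  refine lintegral_congr fun x => ?_
  congr 1
  have e10 : (bruhat (x * v.1) v.1 v.2 * h) 1 0 = w₁ := by
    rw [mul_apply', bruhat_10 hv, bruhat_11 hv]
  rw [eq_bruhat (g := bruhat (x * v.1) v.1 v.2 * h) (by rwa [e10]), e10]
  congr 1
  · rw [mul_apply', bruhat_00 hv, bruhat_01 hv, sub_mul]
    field_simp
    rw [hw1]; ring
  · rw [mul_apply', bruhat_10 hv, bruhat_11 hv]

lemma lintegral_mul_right_scale {F : ℝ → ℝ≥0∞} (hF : Measurable F) {c : ℝ} (hc : c ≠ 0) :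
    ∫⁻ x, F (x * c) = ENNReal.ofReal |c⁻¹| * ∫⁻ x, F x := by
  rw [← lintegral_map hF (measurable_mul_const c), Real.map_volume_mul_right hc, lintegral_smul_measure]
  rfl

/-- The measure in the coordinates given by the first column and the bottom row. -/
lemma rowIntegral_eq {f : G → ℝ≥0∞} (hf : Measurable f) : rowIntegral f =
    ∫⁻ c : ℝ, ENNReal.ofReal |c⁻¹| * ∫⁻ d : ℝ, ∫⁻ a : ℝ, f (bruhat a c d) := by
  rw [rowIntegral]
  rw [show (volume : Measure (ℝ × ℝ)) = (volume : Measure ℝ).prod volume from rfl]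
  rw [lintegral_prod _ (measurable_inner hf).aemeasurable]
  refine lintegral_congr_ae ?_
  filter_upwards [Measure.ae_ne volume (0 : ℝ)] with c hc
  have hm : Measurable fun p : ℝ × ℝ => f (bruhat p.2 c p.1) :=
    hf.comp (measurable_bruhat.comp (g := fun p : ℝ × ℝ × ℝ => bruhat p.1 p.2.1 p.2.2)
      (f := fun p : ℝ × ℝ => (p.2, c, p.1)) (by fun_prop))
  rw [← lintegral_const_mul _ hm.lintegral_prod_right']
  refine lintegral_congr fun d => ?_
  exact lintegral_mul_right_scale (F := fun a => f (bruhat a c d))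
    (hm.comp (measurable_const.prodMk measurable_id)) hc

/-- The reflection in the antidiagonal, an anti-automorphism of `G`. -/
def antiTranspose (g : G) : G := ⟨!![g 1 1, g 0 1; g 1 0, g 0 0], by
  rw [Matrix.det_fin_two_of]; linarith [det_eq g]⟩

@[simp] lemma antiTranspose_00 (g : G) : (antiTranspose g) 0 0 = g 1 1 := rfl
@[simp] lemma antiTranspose_01 (g : G) : (antiTranspose g) 0 1 = g 0 1 := rfl
@[simp] lemma antiTranspose_10 (g : G) : (antiTranspose g) 1 0 = g 1 0 := rfl
@[simp] lemma antiTranspose_11 (g : G) : (antiTranspose g) 1 1 = g 0 0 := rfl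

lemma antiTranspose_mul (g h : G) : antiTranspose (g * h) = antiTranspose h * antiTranspose g := by
  apply ext' <;> simp [mul_apply'] <;> ring

lemma antiTranspose_antiTranspose (g : G) : antiTranspose (antiTranspose g) = g := by
  apply ext' <;> simp

lemma continuous_antiTranspose : Continuous antiTranspose := by
  refine continuous_G fun i j => ?_
  fin_cases i <;> fin_cases j <;> simp <;> fun_prop

lemma antiTranspose_bruhat {a c d : ℝ} (h : c ≠ 0) :
    antiTranspose (bruhat a c d) = bruhat d c a := by
  apply ext' <;> simp [bruhat_00 h, bruhat_01 h, bruhat_10 h, bruhat_11 h, mul_comm]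

lemma rowIntegral_antiTranspose {f : G → ℝ≥0∞} (hf : Measurable f) :
    rowIntegral (fun g => f (antiTranspose g)) = rowIntegral f := by
  rw [rowIntegral_eq hf, rowIntegral_eq (f := fun g => f (antiTranspose g)) (hf.comp continuous_antiTranspose.measurable)]
  refine lintegral_congr_ae ?_
  filter_upwards [Measure.ae_ne volume (0 : ℝ)] with c hc
  simp only [antiTranspose_bruhat hc]
  congr 1
  refine lintegral_lintegral_swap (f := fun d a => f (bruhat d c a)) ?_
  exact (hf.comp (measurable_bruhat.comp (g := fun p : ℝ × ℝ × ℝ => bruhat p.1 p.2.1 p.2.2)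
      (f := fun p : ℝ × ℝ => (p.1, c, p.2)) (by fun_prop))).aemeasurable

lemma rowIntegral_mul_left {f : G → ℝ≥0∞} (hf : Measurable f) (h : G) :
    rowIntegral (fun g => f (h * g)) = rowIntegral f := by
  have h1 := rowIntegral_antiTranspose (f := fun g => f (h * g))
    (hf.comp (measurable_const_mul h))
  have h2 := rowIntegral_mul_right (hf.comp continuous_antiTranspose.measurable) (antiTranspose h)
  simp only [Function.comp_def, antiTranspose_mul, antiTranspose_antiTranspose] at h2
  rw [← h1, h2, rowIntegral_antiTranspose hf]

end SL2Spectral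
namespace SL2Spectral

open MeasureTheory Set
open scoped ENNReal

/-- The product `n[x] a[y] k[θ]`. -/
noncomputable def iwasawaMap (p : ℝ × ℝ × ℝ) : G := nMat p.1 * aMat p.2.1 * kMat p.2.2

/-- The domain of the Iwasawa coordinates. -/
def iwasawaDomain : Set (ℝ × ℝ × ℝ) := univ ×ˢ (Ioi 0 ×ˢ Ico 0 (2 * Real.pi))

/-- The Haar measure of `G`, defined through Iwasawa coordinates. -/
noncomputable def haarG : Measure G :=
  ((volume.restrict iwasawaDomain).withDensity
    fun p => ENNReal.ofReal (1 / (2 * Real.pi * p.2.1 ^ 2))).map iwasawaMap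

lemma aMat_eq {y : ℝ} (hy : 0 < y) : aMat y = ⟨!![√y, 0; 0, 1 / √y], by
    rw [Matrix.det_fin_two_of]
    simp [(Real.sqrt_pos.2 hy).ne']⟩ := dif_pos hy

lemma aMat_00 {y : ℝ} (hy : 0 < y) : (aMat y) 0 0 = √y := by rw [aMat_eq hy]; rfl
lemma aMat_01 {y : ℝ} (hy : 0 < y) : (aMat y) 0 1 = 0 := by rw [aMat_eq hy]; rfl
lemma aMat_10 {y : ℝ} (hy : 0 < y) : (aMat y) 1 0 = 0 := by rw [aMat_eq hy]; rfl
lemma aMat_11 {y : ℝ} (hy : 0 < y) : (aMat y) 1 1 = 1 / √y := by rw [aMat_eq hy]; rfl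

section
variable (x : ℝ) {y : ℝ} (hy : 0 < y) (θ : ℝ)
include hy
lemma iwasawaMap_00 : (iwasawaMap (x, y, θ)) 0 0 = √y * Real.cos θ - x / √y * Real.sin θ := by
  simp [iwasawaMap, mul_apply', aMat_00 hy, aMat_01 hy, aMat_10 hy, aMat_11 hy]; ring
lemma iwasawaMap_01 : (iwasawaMap (x, y, θ)) 0 1 = √y * Real.sin θ + x / √y * Real.cos θ := by
  simp only [iwasawaMap, mul_apply', aMat_00 hy, aMat_01 hy, aMat_10 hy, aMat_11 hy, nMat_00, nMat_01,
    kMat_01, kMat_11]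
  ring
lemma iwasawaMap_10 : (iwasawaMap (x, y, θ)) 1 0 = -((√y)⁻¹ * Real.sin θ) := by
  simp [iwasawaMap, mul_apply', aMat_00 hy, aMat_01 hy, aMat_10 hy, aMat_11 hy]
lemma iwasawaMap_11 : (iwasawaMap (x, y, θ)) 1 1 = (√y)⁻¹ * Real.cos θ := by
  simp [iwasawaMap, mul_apply', aMat_00 hy, aMat_01 hy, aMat_10 hy, aMat_11 hy]
end

lemma continuousOn_aMat : ContinuousOn aMat (Ioi 0) := by
  refine continuousOn_G fun i j => ?_
  have e : ∀ (φ : ℝ → ℝ), ContinuousOn φ (Ioi 0) → (∀ y, 0 < y → (aMat y) i j = φ y) →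
      ContinuousOn (fun y => (aMat y) i j) (Ioi 0) := fun φ hφ he => hφ.congr fun p hp => he p hp
  fin_cases i <;> fin_cases j
  · exact e (fun y => √y) (by fun_prop) fun y hy => aMat_00 hy
  · exact e (fun y => 0) (by fun_prop) fun y hy => aMat_01 hy
  · exact e (fun y => 0) (by fun_prop) fun y hy => aMat_10 hy
  · exact e (fun y => 1 / √y) (ContinuousOn.div (by fun_prop) (by fun_prop)
      fun y hy => (Real.sqrt_pos.2 hy).ne') fun y hy => aMat_11 hy

lemma measurable_aMat : Measurable aMat := by
  have : aMat = (Ioi (0 : ℝ)).piecewise aMat (fun _ => 1) := by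
    ext1 y
    by_cases hy : y ∈ Ioi (0 : ℝ)
    · rw [piecewise_eq_of_mem _ _ _ hy]
    · rw [piecewise_eq_of_notMem _ _ _ hy]
      exact dif_neg hy
  rw [this]
  exact ContinuousOn.measurable_piecewise continuousOn_aMat continuousOn_const measurableSet_Ioi

instance : SecondCountableTopology G :=
  haveI : SecondCountableTopology (Matrix (Fin 2) (Fin 2) ℝ) :=
    inferInstanceAs (SecondCountableTopology (Fin 2 → Fin 2 → ℝ))
  Topology.IsInducing.secondCountableTopology (Topology.IsInducing.subtypeVal :
    Topology.IsInducing (fun g : G => (g : Matrix (Fin 2) (Fin 2) ℝ)))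

lemma measurable_iwasawaMap : Measurable iwasawaMap := by
  have h1 : Measurable kMat := continuous_kMat.measurable
  have h2 : Measurable nMat := continuous_nMat.measurable
  have h3 := measurable_aMat
  unfold iwasawaMap
  fun_prop

/-- The integral over `G` in Iwasawa coordinates, as an iterated integral. -/
lemma lintegral_haarG_iwasawa {f : G → ℝ≥0∞} (hf : Measurable f) : ∫⁻ g, f g ∂haarG =
    ∫⁻ y in Ioi (0 : ℝ), ENNReal.ofReal (1 / (2 * Real.pi * y ^ 2)) *
      ∫⁻ θ in Ico (0 : ℝ) (2 * Real.pi), ∫⁻ x : ℝ, f (iwasawaMap (x, y, θ)) := by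
  have hw : Measurable fun p : ℝ × ℝ × ℝ => ENNReal.ofReal (1 / (2 * Real.pi * p.2.1 ^ 2)) := by
    fun_prop
  have hfm : Measurable fun p => f (iwasawaMap p) := hf.comp measurable_iwasawaMap
  have hres : (volume.restrict iwasawaDomain : Measure (ℝ × ℝ × ℝ)) = (volume : Measure ℝ).prod
      ((volume.restrict (Ioi (0 : ℝ))).prod (volume.restrict (Ico (0 : ℝ) (2 * Real.pi)))) := by
    rw [Measure.prod_restrict, ← Measure.restrict_univ (μ := (volume : Measure ℝ)), Measure.prod_restrict,
      Measure.restrict_univ]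
    rfl
  have hm1 : ∀ y, Measurable fun q : ℝ × ℝ => f (iwasawaMap (q.2, y, q.1)) := fun y =>
    hfm.comp (f := fun q : ℝ × ℝ => (q.2, y, q.1)) (by fun_prop)
  have hm2 : ∀ y θ, Measurable fun x : ℝ => f (iwasawaMap (x, y, θ)) := fun y θ =>
    hfm.comp (f := fun x : ℝ => (x, y, θ)) (by fun_prop)
  have hm3 : Measurable fun p : ℝ × ℝ × ℝ =>
      ENNReal.ofReal (1 / (2 * Real.pi * p.2.1 ^ 2)) * f (iwasawaMap p) := hw.mul hfm
  calc ∫⁻ g, f g ∂haarG = ∫⁻ p in iwasawaDomain,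
        ENNReal.ofReal (1 / (2 * Real.pi * p.2.1 ^ 2)) * f (iwasawaMap p) := by
        rw [haarG, lintegral_map hf measurable_iwasawaMap,
          lintegral_withDensity_eq_lintegral_mul _ hw hfm]
        rfl
    _ = ∫⁻ q, (∫⁻ x : ℝ, ENNReal.ofReal (1 / (2 * Real.pi * q.1 ^ 2)) * f (iwasawaMap (x, q)))
          ∂((volume.restrict (Ioi (0 : ℝ))).prod (volume.restrict (Ico (0 : ℝ) (2 * Real.pi)))) := by
        rw [hres, lintegral_prod_symm _ hm3.aemeasurable]
    _ = ∫⁻ q, (ENNReal.ofReal (1 / (2 * Real.pi * q.1 ^ 2)) * ∫⁻ x : ℝ, f (iwasawaMap (x, q)))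
          ∂((volume.restrict (Ioi (0 : ℝ))).prod (volume.restrict (Ico (0 : ℝ) (2 * Real.pi)))) :=
        lintegral_congr fun q => lintegral_const_mul _ (hm2 q.1 q.2)
    _ = ∫⁻ y in Ioi (0 : ℝ), ∫⁻ θ in Ico (0 : ℝ) (2 * Real.pi),
          ENNReal.ofReal (1 / (2 * Real.pi * y ^ 2)) * ∫⁻ x : ℝ, f (iwasawaMap (x, y, θ)) := by
        refine lintegral_prod _ (Measurable.aemeasurable ?_)
        have : Measurable fun q : ℝ × ℝ => ENNReal.ofReal (1 / (2 * Real.pi * q.1 ^ 2)) := by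
          fun_prop
        exact this.mul hfm.lintegral_prod_left'
    _ = _ := by
        refine lintegral_congr fun y => ?_
        exact lintegral_const_mul _ (hm1 y).lintegral_prod_right'

lemma lintegral_Ico_eq_Ioo {F : ℝ → ℝ≥0∞} (hF : Function.Periodic F (2 * Real.pi)) :
    ∫⁻ θ in Ico (0 : ℝ) (2 * Real.pi), F θ = ∫⁻ θ in Ioo (-Real.pi) Real.pi, F θ := by
  rw [setLIntegral_congr (Ioo_ae_eq_Ioc (a := -Real.pi) (b := Real.pi)),
    setLIntegral_congr (Ico_ae_eq_Ioc (a := (0 : ℝ)) (b := 2 * Real.pi))]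
  have h1 := isAddFundamentalDomain_Ioc Real.two_pi_pos 0
  have h2 := isAddFundamentalDomain_Ioc Real.two_pi_pos (-Real.pi)
  rw [zero_add] at h1
  rw [show -Real.pi + 2 * Real.pi = Real.pi by ring] at h2
  refine h1.setLIntegral_eq h2 _ ?_
  rintro ⟨g, n, rfl⟩ x
  have := hF.zsmul n x
  change F (n • (2 * Real.pi) + x) = F x
  rwa [add_comm]

lemma ae_sin_ne_zero : ∀ᵐ θ : ℝ, Real.sin θ ≠ 0 := by
  have : {θ : ℝ | ¬ Real.sin θ ≠ 0} ⊆ range fun n : ℤ => (n : ℝ) * Real.pi := by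
    intro θ hθ
    simp only [ne_eq, not_not, mem_ofPred_eq] at hθ
    obtain ⟨n, hn⟩ := Real.sin_eq_zero_iff.1 hθ
    exact ⟨n, hn⟩
  exact measure_mono_null this ((countable_range _).measure_zero volume)

/-- Polar coordinates in the plane of bottom rows turn `dx dc dd` into the Iwasawa form of the Haar
measure. -/
lemma lintegral_haarG {f : G → ℝ≥0∞} (hf : Measurable f) :
    ∫⁻ g, f g ∂haarG = ENNReal.ofReal (1 / Real.pi) * rowIntegral f := by
  set H : ℝ × ℝ → ℝ≥0∞ := fun v => ∫⁻ x : ℝ, f (bruhat (x * v.1) v.1 v.2) with hH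
  have hHm : Measurable H := measurable_inner hf
  have hπ := Real.pi_pos
  -- the inner integral depends on the bottom row only
  have hinner : ∀ y : ℝ, 0 < y → ∀ θ : ℝ, Real.sin θ ≠ 0 → ∫⁻ x : ℝ, f (iwasawaMap (x, y, θ)) =
      H (-((√y)⁻¹ * Real.sin θ), (√y)⁻¹ * Real.cos θ) := by
    intro y hy θ hθ
    have hsy := Real.sqrt_pos.2 hy
    set c := -((√y)⁻¹ * Real.sin θ) with hc
    have hc0 : c ≠ 0 := neg_ne_zero.2 (mul_ne_zero (inv_ne_zero hsy.ne') hθ)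
    rw [hH]
    dsimp only
    rw [← lintegral_add_right_eq_self (fun x => f (bruhat (x * c) c _)) (√y * Real.cos θ / c)]
    refine lintegral_congr fun x => ?_
    congr 1
    rw [eq_bruhat (g := iwasawaMap (x, y, θ)) (by rwa [iwasawaMap_10 x hy]), iwasawaMap_10 x hy,
      iwasawaMap_11 x hy, iwasawaMap_00 x hy]
    congr 1
    rw [add_mul, div_mul_cancel₀ _ hc0, hc]
    field_simp
    ring
  set Θ : ℝ → ℝ≥0∞ := fun r => ∫⁻ θ in Ioo (-Real.pi) Real.pi,
    H (-(r * Real.sin θ), r * Real.cos θ) with hΘ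
  have step1 : ∫⁻ g, f g ∂haarG = ∫⁻ y in Ioi (0 : ℝ),
      ENNReal.ofReal (1 / (2 * Real.pi * y ^ 2)) * Θ ((√y)⁻¹) := by
    rw [lintegral_haarG_iwasawa hf]
    refine setLIntegral_congr_fun measurableSet_Ioi fun y hy => ?_
    rw [hΘ]
    dsimp only
    rw [← lintegral_Ico_eq_Ioo (F := fun θ => H (-((√y)⁻¹ * Real.sin θ), (√y)⁻¹ * Real.cos θ))
      fun θ => by simp]
    congr 1
    refine lintegral_congr_ae ?_
    filter_upwards [ae_restrict_of_ae ae_sin_ne_zero] with θ hθ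
    exact hinner y hy θ hθ
  -- the change of variables `y = r ^ (-2)`
  have step2 : ∫⁻ y in Ioi (0 : ℝ), ENNReal.ofReal (1 / (2 * Real.pi * y ^ 2)) * Θ ((√y)⁻¹) =
      ∫⁻ r in Ioi (0 : ℝ), ENNReal.ofReal (1 / Real.pi) * (ENNReal.ofReal r * Θ r) := by
    have himg : (fun r : ℝ => (r ^ 2)⁻¹) '' Ioi 0 = Ioi 0 := by
      ext y
      constructor
      · rintro ⟨r, hr, rfl⟩
        have : (0 : ℝ) < r := hr
        exact mem_Ioi.2 (by positivity)
      · intro hy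
        have hy' : (0 : ℝ) < y := hy
        refine ⟨(√y)⁻¹, mem_Ioi.2 (by positivity), ?_⟩
        dsimp only
        rw [inv_pow, inv_inv, Real.sq_sqrt hy'.le]
    have hinj : InjOn (fun r : ℝ => (r ^ 2)⁻¹) (Ioi 0) := by
      intro r hr s hs h
      have h' : r ^ 2 = s ^ 2 := inv_injective h
      exact (pow_left_inj₀ (le_of_lt hr) (le_of_lt hs) two_ne_zero).1 h'
    have hder : ∀ r ∈ Ioi (0 : ℝ), HasDerivWithinAt (fun r : ℝ => (r ^ 2)⁻¹) (-(2 * r) / (r ^ 2) ^ 2)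
        (Ioi 0) r := by
      intro r hr
      have hr' : (0 : ℝ) < r := hr
      have := ((hasDerivAt_pow 2 r).inv (by positivity)).hasDerivWithinAt (s := Ioi 0)
      refine this.congr_deriv ?_
      simp
    rw [← himg, lintegral_image_eq_lintegral_abs_deriv_mul measurableSet_Ioi hder hinj, himg]
    refine setLIntegral_congr_fun measurableSet_Ioi fun r hr => ?_
    have hr' : (0 : ℝ) < r := hr
    rw [Real.sqrt_inv, Real.sqrt_sq hr'.le, inv_inv, ← mul_assoc, ← mul_assoc,
      ← ENNReal.ofReal_mul (abs_nonneg _), ← ENNReal.ofReal_mul (by positivity)]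
    congr 2
    rw [abs_div, abs_neg, abs_of_pos (by positivity), abs_of_pos (by positivity)]
    field_simp
  have hmp := measurePreserving_rowMap (kMat (Real.pi / 2))
  have hrot : ∫⁻ p : ℝ × ℝ, H (-p.2, p.1) = rowIntegral f := by
    rw [rowIntegral, ← hmp.lintegral_comp hHm]
    refine lintegral_congr fun p => ?_
    rw [rowMap_apply]
    simp
  rw [step1, step2, ← hrot, ← lintegral_comp_polarCoord_symm, polarCoord_target]
  have hΘm : Measurable fun q : ℝ × ℝ => H (-(q.1 * Real.sin q.2), q.1 * Real.cos q.2) :=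
    hHm.comp (by fun_prop)
  rw [show (volume : Measure (ℝ × ℝ)) = (volume : Measure ℝ).prod volume from rfl,
    ← Measure.prod_restrict, lintegral_prod]
  · rw [lintegral_const_mul]
    · congr 1
      refine lintegral_congr fun r => ?_
      rw [hΘ]
      dsimp only
      simp only [polarCoord_symm_apply, smul_eq_mul]
      exact (lintegral_const_mul _ (f := fun θ => H (-(r * Real.sin θ), r * Real.cos θ))
        (hΘm.comp (measurable_const.prodMk measurable_id))).symm
    · exact ENNReal.measurable_ofReal.mul hΘm.lintegral_prod_right'
  · refine Measurable.aemeasurable ?_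
    simp only [polarCoord_symm_apply, smul_eq_mul]
    exact (by fun_prop : Measurable fun q : ℝ × ℝ => ENNReal.ofReal q.1).mul hΘm

instance : haarG.IsMulLeftInvariant := by
  refine ⟨fun h => Measure.ext_of_lintegral _ fun f hf => ?_⟩
  rw [lintegral_map hf (measurable_const_mul h), lintegral_haarG hf,
    lintegral_haarG (f := fun g => f (h * g)) (hf.comp (measurable_const_mul h)), rowIntegral_mul_left hf]

instance : haarG.IsMulRightInvariant := by
  refine ⟨fun h => Measure.ext_of_lintegral _ fun f hf => ?_⟩
  rw [lintegral_map hf (measurable_mul_const h), lintegral_haarG hf,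
    lintegral_haarG (f := fun g => f (g * h)) (hf.comp (measurable_mul_const h)), rowIntegral_mul_right hf]

lemma integralG_eq {f : G → ℂ} (hf : Measurable f) : integralG f = ∫ g, f g ∂haarG := by
  have hw : Measurable fun p : ℝ × ℝ × ℝ => ENNReal.ofReal (1 / (2 * Real.pi * p.2.1 ^ 2)) := by
    fun_prop
  rw [haarG, integral_map measurable_iwasawaMap.aemeasurable hf.aestronglyMeasurable,
    integral_withDensity_eq_integral_toReal_smul hw (by simp), integralG]
  refine integral_congr_ae (Filter.Eventually.of_forall fun p => ?_)
  dsimp only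
  rw [ENNReal.toReal_ofReal (by positivity), mul_comm, Complex.real_smul]
  rfl

end SL2Spectral
namespace SL2Spectral

/-! ### Integrals over balls -/

open MeasureTheory Set
open scoped ENNReal

@[fun_prop]
lemma continuous_uFun : Continuous uFun := by
  unfold uFun; fun_prop

@[fun_prop]
lemma continuous_rowC : Continuous rowC := by
  unfold rowC; fun_prop

@[fun_prop]
lemma continuous_iwasawaY : Continuous iwasawaY := by
  have : iwasawaY = fun g => (‖rowC g‖ ^ 2)⁻¹ := funext iwasawaY_eq
  rw [this]
  exact Continuous.inv₀ (by fun_prop) fun g => pow_ne_zero 2 (norm_ne_zero_iff.2 (rowC_ne_zero g))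

lemma iwasawaY_iwasawaMap (x : ℝ) {y : ℝ} (hy : 0 < y) (θ : ℝ) :
    iwasawaY (iwasawaMap (x, y, θ)) = y := by
  have hs := Real.sqrt_pos.2 hy
  rw [iwasawaY, iwasawaMap_10 x hy, iwasawaMap_11 x hy, neg_sq, mul_pow, mul_pow, ← mul_add,
    Real.sin_sq_add_cos_sq, inv_pow, Real.sq_sqrt hy.le]
  simp

lemma uFun_iwasawaMap (x : ℝ) {y : ℝ} (hy : 0 < y) (θ : ℝ) :
    uFun (iwasawaMap (x, y, θ)) = ((y - 1) ^ 2 + x ^ 2) / (4 * y) := by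
  have hs := Real.sqrt_pos.2 hy
  have h2 := Real.sq_sqrt hy.le
  rw [uFun, iwasawaMap_10 x hy, iwasawaMap_11 x hy, iwasawaMap_00 x hy, iwasawaMap_01 x hy]
  set s := √y
  rw [← h2]
  field_simp
  linear_combination (s ^ 4 + x ^ 2 + 1) * Real.sin_sq_add_cos_sq θ

lemma lintegral_haarG_le {f : G → ℝ≥0∞} (hf : Measurable f) (F : ℝ → ℝ → ℝ≥0∞)
    (h : ∀ x y θ, 0 < y → x ≠ 0 → f (iwasawaMap (x, y, θ)) ≤ F y x) :
    ∫⁻ g, f g ∂haarG ≤ ∫⁻ y in Ioi (0 : ℝ), ENNReal.ofReal (1 / y ^ 2) * ∫⁻ x, F y x := by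
  rw [lintegral_haarG_iwasawa hf]
  refine setLIntegral_mono' measurableSet_Ioi fun y hy => ?_
  have hy' : (0 : ℝ) < y := hy
  have hπ := Real.pi_pos
  calc _ ≤ ENNReal.ofReal (1 / (2 * Real.pi * y ^ 2)) *
        ∫⁻ θ in Ico (0 : ℝ) (2 * Real.pi), ∫⁻ x, F y x := by
        refine mul_le_mul_right (lintegral_mono fun θ => lintegral_mono_ae ?_) _
        filter_upwards [Measure.ae_ne volume (0 : ℝ)] with x hx
        exact h x y θ hy hx
    _ = _ := by
        rw [lintegral_const, Measure.restrict_apply_univ, Real.volume_Ico, mul_comm (lintegral _ _),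
          ← mul_assoc, ← ENNReal.ofReal_mul (by positivity)]
        congr 2
        field_simp
        ring

/-- The Iwasawa coordinates of points of the ball `u ≤ U`. -/
lemma mem_of_uFun_le {x y U : ℝ} (hy : 0 < y) (h : ((y - 1) ^ 2 + x ^ 2) / (4 * y) ≤ U) :
    y ∈ Icc (4 * U + 2)⁻¹ (4 * U + 2) ∧ x ∈ Icc (-(2 * √(y * U))) (2 * √(y * U)) := by
  rw [div_le_iff₀ (by positivity)] at h
  have hU : 0 ≤ U := by
    by_contra hneg
    nlinarith [sq_nonneg (y - 1), sq_nonneg x]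
  refine ⟨⟨?_, ?_⟩, ?_⟩
  · rw [inv_le_iff_one_le_mul₀ (by positivity)]; nlinarith [sq_nonneg x, sq_nonneg y]
  · by_contra hc
    nlinarith [sq_nonneg x]
  · rw [mem_Icc, ← abs_le]
    have h1 : √(x ^ 2) ≤ √(4 * (y * U)) := Real.sqrt_le_sqrt (by nlinarith [sq_nonneg (y - 1)])
    rw [Real.sqrt_sq_eq_abs] at h1
    rwa [Real.sqrt_mul (by norm_num), show (4 : ℝ) = 2 ^ 2 by norm_num, Real.sqrt_sq (by norm_num)] at h1

lemma setLIntegral_uFun_le {U : ℝ} {φ : ℝ → ℝ≥0∞} (hφ : Measurable φ) :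
    ∫⁻ g in {g | uFun g ≤ U}, φ (iwasawaY g) ∂haarG ≤
      ∫⁻ y in Icc (4 * U + 2)⁻¹ (4 * U + 2), ENNReal.ofReal (4 * √(y * U) / y ^ 2) * φ y := by
  have hm : MeasurableSet {g : G | uFun g ≤ U} := measurableSet_le (by fun_prop) (by fun_prop)
  rw [← lintegral_indicator hm, ← lintegral_indicator measurableSet_Icc]
  refine (lintegral_haarG_le ((hφ.comp continuous_iwasawaY.measurable).indicator hm)
    (fun y x => (Icc (4 * U + 2)⁻¹ (4 * U + 2)).indicator φ y *
      (Icc (-(2 * √(y * U))) (2 * √(y * U))).indicator 1 x) ?_).trans ?_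
  · intro x y θ hy hx
    by_cases h : uFun (iwasawaMap (x, y, θ)) ≤ U
    · rw [indicator_of_mem (by exact h)]
      rw [uFun_iwasawaMap x hy] at h
      obtain ⟨h1, h2⟩ := mem_of_uFun_le hy h
      rw [indicator_of_mem h1, indicator_of_mem h2, Function.comp_apply, iwasawaY_iwasawaMap x hy]
      simp
    · rw [indicator_of_notMem (by exact h)]; exact zero_le
  · refine (setLIntegral_mono' measurableSet_Ioi fun y hy => ?_).trans (setLIntegral_le_lintegral _ _)
    have hy' : (0 : ℝ) < y := hy
    rw [lintegral_const_mul _ (measurable_one.indicator measurableSet_Icc),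
      lintegral_indicator_one measurableSet_Icc, Real.volume_Icc]
    by_cases h : y ∈ Icc (4 * U + 2)⁻¹ (4 * U + 2)
    · rw [indicator_of_mem h, indicator_of_mem h, mul_comm (φ y), ← mul_assoc,
        ← ENNReal.ofReal_mul (by positivity)]
      refine le_of_eq ?_
      congr 2
      ring
    · rw [indicator_of_notMem h, indicator_of_notMem h]; simp

lemma haarG_uFun_lt_top (U : ℝ) : haarG {g | uFun g ≤ U} < ⊤ := by
  rcases lt_or_ge U 0 with hU | hU
  · have : {g : G | uFun g ≤ U} = ∅ := by
      ext g; simpa using hU.trans_le (uFun_nonneg g)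
    rw [this]; simp
  have h := setLIntegral_uFun_le (U := U) (φ := fun _ => 1) measurable_const
  rw [setLIntegral_one] at h
  refine h.trans_lt ?_
  simp only [mul_one]
  have hc : ContinuousOn (fun y : ℝ => 4 * √(y * U) / y ^ 2) (Icc (4 * U + 2)⁻¹ (4 * U + 2)) := by
    refine ContinuousOn.div (by fun_prop) (by fun_prop) fun y hy => ?_
    have : (0 : ℝ) < y := lt_of_lt_of_le (by positivity) hy.1
    positivity
  exact (hc.integrableOn_compact isCompact_Icc).lintegral_lt_top

instance : IsFiniteMeasureOnCompacts haarG := by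
  refine ⟨fun K hK => ?_⟩
  obtain ⟨U, hU⟩ := (hK.image continuous_uFun).bddAbove
  exact (measure_mono fun g hg => hU (mem_image_of_mem _ hg)).trans_lt (haarG_uFun_lt_top U)

lemma setLIntegral_rpow_eq {U ν : ℝ} (hU : 1 ≤ U) : (∫⁻ y in Icc (4 * U + 2)⁻¹ (4 * U + 2),
      ENNReal.ofReal (4 * √(y * U) / y ^ 2) * ENNReal.ofReal (y ^ (1 / 2 + ν))) =
    ENNReal.ofReal (4 * √U * ∫ y in (4 * U + 2)⁻¹..(4 * U + 2), y ^ (ν - 1)) := by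
  have hY : (4 * U + 2)⁻¹ ≤ 4 * U + 2 := by
    rw [inv_le_iff_one_le_mul₀ (by positivity)]; nlinarith
  have hpos : ∀ y ∈ Icc (4 * U + 2)⁻¹ (4 * U + 2), 0 < y := fun y hy =>
    lt_of_lt_of_le (by positivity) hy.1
  have hc : ContinuousOn (fun y : ℝ => 4 * √U * y ^ (ν - 1)) (Icc (4 * U + 2)⁻¹ (4 * U + 2)) :=
    ContinuousOn.mul (by fun_prop)
      (ContinuousOn.rpow_const (by fun_prop) fun y hy => Or.inl (hpos y hy).ne')
  rw [← intervalIntegral.integral_const_mul, intervalIntegral.integral_of_le hY, ← integral_Icc_eq_integral_Ioc,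
    ofReal_integral_eq_lintegral_ofReal (hc.integrableOn_compact isCompact_Icc)]
  · refine setLIntegral_congr_fun measurableSet_Icc fun y hy => ?_
    have hy' := hpos y hy
    rw [← ENNReal.ofReal_mul (by positivity), Real.sqrt_mul hy'.le, Real.sqrt_eq_rpow y,
      ← Real.rpow_natCast y 2]
    congr 1
    rw [mul_div_assoc, mul_div_right_comm, ← Real.rpow_sub hy']
    rw [show 4 * (y ^ (1 / 2 - ((2 : ℕ) : ℝ)) * √U) * y ^ (1 / 2 + ν) = 4 * √U *
      (y ^ (1 / 2 - ((2 : ℕ) : ℝ)) * y ^ (1 / 2 + ν)) by ring, ← Real.rpow_add hy']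
    congr 2
    push_cast; ring
  · filter_upwards [ae_restrict_mem measurableSet_Icc] with y hy
    have := hpos y hy
    simp only [Pi.zero_apply]
    positivity

lemma setLIntegral_rpow_le_log {U ν : ℝ} (hU : 1 ≤ U) (hν : 0 ≤ ν) :
    ∫⁻ g in {g | uFun g ≤ U}, ENNReal.ofReal (iwasawaY g ^ (1 / 2 + ν)) ∂haarG ≤
      ENNReal.ofReal (4 * √U * ((4 * U + 2) ^ ν * (2 * Real.log (4 * U + 2)))) := by
  have hY : (4 * U + 2)⁻¹ ≤ 4 * U + 2 := by
    rw [inv_le_iff_one_le_mul₀ (by positivity)]; nlinarith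
  have hY0 : 0 < (4 * U + 2)⁻¹ := by positivity
  refine (setLIntegral_uFun_le (φ := fun y => ENNReal.ofReal (y ^ (1 / 2 + ν)))
    (by fun_prop)).trans ?_
  rw [setLIntegral_rpow_eq hU]
  refine ENNReal.ofReal_le_ofReal ?_
  gcongr
  have hlog : ∫ y in (4 * U + 2)⁻¹..(4 * U + 2), (4 * U + 2) ^ ν * y⁻¹
      = (4 * U + 2) ^ ν * (2 * Real.log (4 * U + 2)) := by
    rw [intervalIntegral.integral_const_mul, integral_inv_of_pos hY0 (by positivity), div_inv_eq_mul,
      ← pow_two, Real.log_pow]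
    push_cast; ring
  rw [← hlog]
  have hne : ∀ y ∈ uIcc (4 * U + 2)⁻¹ (4 * U + 2), y ≠ 0 := fun y hy => by
    rw [uIcc_of_le hY] at hy; exact (hY0.trans_le hy.1).ne'
  refine intervalIntegral.integral_mono_on hY ?_ ?_ fun y hy => ?_
  · exact (ContinuousOn.rpow_const (by fun_prop) fun y hy => Or.inl (hne y hy)).intervalIntegrable
  · exact (ContinuousOn.mul (by fun_prop) (ContinuousOn.inv₀ (by fun_prop) hne)).intervalIntegrable
  · have hy0 := hY0.trans_le hy.1
    rw [Real.rpow_sub hy0, Real.rpow_one, div_eq_mul_inv]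
    gcongr
    exact hy.2

lemma setLIntegral_rpow_le_inv {U ν : ℝ} (hU : 1 ≤ U) (hν : 0 < ν) :
    ∫⁻ g in {g | uFun g ≤ U}, ENNReal.ofReal (iwasawaY g ^ (1 / 2 + ν)) ∂haarG ≤
      ENNReal.ofReal (4 * √U * ((4 * U + 2) ^ ν * (1 / ν))) := by
  have hY0 : 0 < (4 * U + 2)⁻¹ := by positivity
  refine (setLIntegral_uFun_le (φ := fun y => ENNReal.ofReal (y ^ (1 / 2 + ν)))
    (by fun_prop)).trans ?_
  rw [setLIntegral_rpow_eq hU]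
  refine ENNReal.ofReal_le_ofReal ?_
  gcongr
  rw [integral_rpow (Or.inl (by linarith)), sub_add_cancel, mul_one_div]
  gcongr
  have := Real.rpow_pos_of_pos hY0 ν
  linarith

/-- The integral of `y ^ (1/2 + ν)` over the ball `u ≤ U`. -/
lemma setLIntegral_rpow_le {U ν : ℝ} (hU : 1 ≤ U) (hν : 0 < ν) (hν2 : ν < 1 / 2) :
    ∫⁻ g in {g | uFun g ≤ U}, ENNReal.ofReal (iwasawaY g ^ (1 / 2 + ν)) ∂haarG ≤
      ENNReal.ofReal (144 * (U ^ (1 / 2 + ν) * min (1 / ν) (Real.log (1 + U)))) := by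
  have hlog : Real.log (4 * U + 2) ≤ 3 * Real.log (1 + U) := by
    rw [show (3 : ℝ) = ((3 : ℕ) : ℝ) by norm_num, ← Real.log_pow]
    exact Real.log_le_log (by positivity) (by
      have : 0 ≤ U ^ 3 := by positivity
      nlinarith)
  have hlog0 : 0 < Real.log (1 + U) := Real.log_pos (by linarith)
  have hpow : (4 * U + 2) ^ ν ≤ 6 * U ^ ν := by
    calc (4 * U + 2) ^ ν ≤ (6 * U) ^ ν := by gcongr; linarith
      _ = 6 ^ ν * U ^ ν := Real.mul_rpow (by norm_num) (by linarith)
      _ ≤ 6 ^ (1 : ℝ) * U ^ ν := by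
        gcongr
        · norm_num
        · linarith
      _ = 6 * U ^ ν := by rw [Real.rpow_one]
  have hU2 : U ^ (1 / 2 + ν) = √U * U ^ ν := by
    rw [Real.rpow_add (by linarith), Real.sqrt_eq_rpow]
  have hUν : 0 ≤ U ^ ν := Real.rpow_nonneg (by linarith) _
  rw [hU2, mul_min_of_nonneg _ _ (by positivity), mul_min_of_nonneg _ _ (by norm_num), ENNReal.ofReal_min]
  refine le_min ((setLIntegral_rpow_le_inv hU hν).trans (ENNReal.ofReal_le_ofReal ?_))
    ((setLIntegral_rpow_le_log hU hν.le).trans (ENNReal.ofReal_le_ofReal ?_))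
  · calc 4 * √U * ((4 * U + 2) ^ ν * (1 / ν)) ≤ 4 * √U * ((6 * U ^ ν) * (1 / ν)) := by gcongr
      _ = 24 * (√U * U ^ ν * (1 / ν)) := by ring
      _ ≤ 144 * (√U * U ^ ν * (1 / ν)) := by
        gcongr
        norm_num
  · calc 4 * √U * ((4 * U + 2) ^ ν * (2 * Real.log (4 * U + 2)))
        ≤ 4 * √U * ((6 * U ^ ν) * (2 * (3 * Real.log (1 + U)))) := by
          have : 0 ≤ Real.log (4 * U + 2) := Real.log_nonneg (by linarith)
          gcongr
      _ = 144 * (√U * U ^ ν * Real.log (1 + U)) := by ring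

lemma setLIntegral_sqrt_le {U : ℝ} (hU : 1 ≤ U) :
    ∫⁻ g in {g | uFun g ≤ U}, ENNReal.ofReal (iwasawaY g ^ (1 / 2 : ℝ)) ∂haarG ≤
      ENNReal.ofReal (144 * (U ^ (1 / 2 : ℝ) * Real.log (1 + U))) := by
  have hlog : Real.log (4 * U + 2) ≤ 3 * Real.log (1 + U) := by
    rw [show (3 : ℝ) = ((3 : ℕ) : ℝ) by norm_num, ← Real.log_pow]
    exact Real.log_le_log (by positivity) (by
      have : 0 ≤ U ^ 3 := by positivity
      nlinarith)
  have hlog0 : 0 < Real.log (1 + U) := Real.log_pos (by linarith)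
  have h := setLIntegral_rpow_le_log hU le_rfl
  rw [add_zero] at h
  refine h.trans (ENNReal.ofReal_le_ofReal ?_)
  rw [Real.rpow_zero, ← Real.sqrt_eq_rpow]
  nlinarith [mul_nonneg (Real.sqrt_nonneg U) hlog0.le, Real.sqrt_nonneg U,
    mul_le_mul_of_nonneg_left hlog (Real.sqrt_nonneg U)]

lemma setLIntegral_abs_rpow_le {X : ℝ} (hX : 0 ≤ X) :
    ∫⁻ x in Icc (-X) X, ENNReal.ofReal (|x| ^ (-(1 / 2) : ℝ)) ≤ ENNReal.ofReal (4 * √X) := by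
  have h1 : ∫⁻ x in Icc 0 X, ENNReal.ofReal (|x| ^ (-(1 / 2) : ℝ)) = ENNReal.ofReal (2 * √X) := by
    have hi : IntervalIntegrable (fun x : ℝ => x ^ (-(1 / 2) : ℝ)) volume 0 X :=
      intervalIntegral.intervalIntegrable_rpow' (by norm_num)
    have hv : ∫ x in (0 : ℝ)..X, x ^ (-(1 / 2) : ℝ) = 2 * √X := by
      rw [integral_rpow (Or.inl (by norm_num)), Real.sqrt_eq_rpow]
      norm_num
      ring
    rw [← hv, intervalIntegral.integral_of_le hX, ofReal_integral_eq_lintegral_ofReal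
      ((intervalIntegrable_iff_integrableOn_Ioc_of_le hX).1 hi), setLIntegral_congr Ioc_ae_eq_Icc.symm]
    · refine setLIntegral_congr_fun measurableSet_Ioc fun x hx => ?_
      rw [abs_of_pos hx.1]
    · filter_upwards [ae_restrict_mem measurableSet_Ioc] with x hx
      exact Real.rpow_nonneg hx.1.le _
  have h2 : ∫⁻ x in Icc (-X) 0, ENNReal.ofReal (|x| ^ (-(1 / 2) : ℝ)) = ENNReal.ofReal (2 * √X) := by
    rw [← h1, ← (Measure.measurePreserving_neg (volume : Measure ℝ)).setLIntegral_comp_preimage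
      measurableSet_Icc (by fun_prop)]
    simp
  rw [← Icc_union_Icc_eq_Icc (b := 0) (by linarith) hX]
  refine (lintegral_union_le _ _ _).trans ?_
  rw [h1, h2, ← ENNReal.ofReal_add (by positivity) (by positivity)]
  exact ENNReal.ofReal_le_ofReal (by linarith)

/-- The integral of `(1 + u) ^ (-1/2)` over the ball `u ≤ U`. -/
lemma setLIntegral_inv_sqrt_le {U : ℝ} (hU : 1 ≤ U) :
    ∫⁻ g in {g | uFun g ≤ U}, ENNReal.ofReal (√(1 + uFun g)⁻¹) ∂haarG ≤
      ENNReal.ofReal (200 * U ^ (1 / 2 : ℝ)) := by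
  have hm : MeasurableSet {g : G | uFun g ≤ U} := measurableSet_le (by fun_prop) (by fun_prop)
  have hY0 : 0 < (4 * U + 2)⁻¹ := by positivity
  rw [← lintegral_indicator hm]
  have hmeas : Measurable fun g : G => ENNReal.ofReal (√(1 + uFun g)⁻¹) := by
    have := continuous_uFun.measurable
    fun_prop
  refine (lintegral_haarG_le (hmeas.indicator hm)
    (fun y x => (Ici (4 * U + 2)⁻¹).indicator (fun y => ENNReal.ofReal (2 * √y)) y *
      (Icc (-(2 * √(y * U))) (2 * √(y * U))).indicator
        (fun x => ENNReal.ofReal (|x| ^ (-(1 / 2) : ℝ))) x) ?_).trans ?_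
  · intro x y θ hy hx
    by_cases h : uFun (iwasawaMap (x, y, θ)) ≤ U
    · rw [indicator_of_mem (by exact h)]
      rw [uFun_iwasawaMap x hy] at h ⊢
      obtain ⟨h1, h2⟩ := mem_of_uFun_le hy h
      have h1' : y ∈ Ici (4 * U + 2)⁻¹ := h1.1
      -- `4 (1 + u) y = (y + 1)² + x²` is at least `|x|`
      rw [indicator_of_mem h1', indicator_of_mem h2, ← ENNReal.ofReal_mul (by positivity)]
      refine ENNReal.ofReal_le_ofReal ?_
      have hx' := abs_pos.2 hx
      rw [Real.sqrt_le_left (by positivity), mul_pow, mul_pow, Real.sq_sqrt hy.le,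
        ← Real.rpow_natCast (|x| ^ _), ← Real.rpow_mul hx'.le]
      have : (1 + ((y - 1) ^ 2 + x ^ 2) / (4 * y))⁻¹ = 4 * y / ((y + 1) ^ 2 + x ^ 2) := by
        rw [inv_eq_one_div, div_eq_div_iff (by positivity) (by positivity)]
        field_simp
        ring
      rw [this]
      norm_num
      rw [Real.rpow_neg_one, div_eq_mul_inv]
      gcongr
      nlinarith [sq_abs x, sq_nonneg (|x| - 1)]
    · rw [indicator_of_notMem (by exact h)]; exact zero_le
  · calc _ ≤ ∫⁻ y in Ioi (0 : ℝ), (Ici (4 * U + 2)⁻¹).indicator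
          (fun y => ENNReal.ofReal (8 * √2 * U ^ (1 / 4 : ℝ) * y ^ (-(5 / 4) : ℝ))) y := by
          refine setLIntegral_mono' measurableSet_Ioi fun y hy => ?_
          have hy' : (0 : ℝ) < y := hy
          by_cases h : y ∈ Ici (4 * U + 2)⁻¹
          · rw [indicator_of_mem h, lintegral_const_mul _ (by
              refine Measurable.indicator (by fun_prop) measurableSet_Icc),
              lintegral_indicator measurableSet_Icc, indicator_of_mem h]
            refine (mul_le_mul_right (mul_le_mul_right (setLIntegral_abs_rpow_le (by positivity)) _) _).trans ?_
            rw [← ENNReal.ofReal_mul (by positivity), ← ENNReal.ofReal_mul (by positivity)]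
            refine ENNReal.ofReal_le_ofReal (le_of_eq ?_)
            have e1 : √(2 * √(y * U)) = √2 * (y ^ (1 / 4 : ℝ) * U ^ (1 / 4 : ℝ)) := by
              rw [Real.sqrt_mul (by norm_num), Real.sqrt_eq_rpow (√_), Real.sqrt_eq_rpow (y * U),
                ← Real.rpow_mul (by positivity), Real.mul_rpow hy'.le (by linarith)]
              norm_num
            have e2 : y ^ (-(5 / 4) : ℝ) = 1 / y ^ 2 * y ^ (1 / 2 : ℝ) * y ^ (1 / 4 : ℝ) := by
              rw [one_div, ← Real.rpow_natCast, ← Real.rpow_neg hy'.le, ← Real.rpow_add hy',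
                ← Real.rpow_add hy']
              norm_num
            rw [e1, e2, Real.sqrt_eq_rpow y]
            ring
          · rw [indicator_of_notMem h, indicator_of_notMem h]; simp
      _ ≤ ∫⁻ y in Ioi (4 * U + 2)⁻¹,
          ENNReal.ofReal (8 * √2 * U ^ (1 / 4 : ℝ) * y ^ (-(5 / 4) : ℝ)) := by
          refine (setLIntegral_le_lintegral _ _).trans ?_
          rw [lintegral_indicator measurableSet_Ici, setLIntegral_congr Ioi_ae_eq_Ici]
      _ = ENNReal.ofReal (8 * √2 * U ^ (1 / 4 : ℝ) * ∫ y in Ioi (4 * U + 2)⁻¹, y ^ (-(5 / 4) : ℝ)) := by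
          rw [← integral_const_mul, ofReal_integral_eq_lintegral_ofReal]
          · exact (integrableOn_Ioi_rpow_of_lt (by norm_num) hY0).const_mul _
          · filter_upwards [ae_restrict_mem measurableSet_Ioi] with y hy
            have : (0 : ℝ) < y := hY0.trans hy
            simp only [Pi.zero_apply]
            positivity
      _ ≤ _ := by
          refine ENNReal.ofReal_le_ofReal ?_
          rw [integral_Ioi_rpow_of_lt (by norm_num) hY0]
          have e : (4 * U + 2)⁻¹ ^ (-(5 / 4) + 1 : ℝ) ≤ 2 * U ^ (1 / 4 : ℝ) := by
            rw [Real.inv_rpow (by positivity), ← Real.rpow_neg (by positivity)]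
            calc (4 * U + 2) ^ (-(-(5 / 4) + 1) : ℝ) ≤ (16 * U) ^ (-(-(5 / 4) + 1) : ℝ) :=
                  Real.rpow_le_rpow (by positivity) (by linarith) (by norm_num)
              _ = (2 ^ 4) ^ (1 / 4 : ℝ) * U ^ (1 / 4 : ℝ) := by
                  rw [Real.mul_rpow (by norm_num) (by linarith)]; norm_num
              _ = 2 * U ^ (1 / 4 : ℝ) := by
                  rw [← Real.rpow_natCast, ← Real.rpow_mul (by norm_num)]; norm_num
          have e2 : U ^ (1 / 2 : ℝ) = U ^ (1 / 4 : ℝ) * U ^ (1 / 4 : ℝ) := by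
            rw [← Real.rpow_add (by linarith)]; norm_num
          have e4 : 0 ≤ U ^ (1 / 4 : ℝ) := by positivity
          rw [show -(4 * U + 2)⁻¹ ^ (-(5 / 4) + 1 : ℝ) / (-(5 / 4) + 1)
            = 4 * (4 * U + 2)⁻¹ ^ (-(5 / 4) + 1 : ℝ) by ring, e2]
          calc 8 * √2 * U ^ (1 / 4 : ℝ) * (4 * (4 * U + 2)⁻¹ ^ (-(5 / 4) + 1 : ℝ))
              ≤ 8 * 1.5 * U ^ (1 / 4 : ℝ) * (4 * (2 * U ^ (1 / 4 : ℝ))) := by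
                gcongr
                rw [Real.sqrt_le_left (by norm_num)]; norm_num
            _ ≤ _ := by nlinarith

end SL2Spectral
namespace SL2Spectral

/-! ### Pointwise bounds for the harmonics -/

open MeasureTheory Set

@[fun_prop]
lemma continuous_iwasawaPhase : Continuous iwasawaPhase := by
  have : iwasawaPhase = fun g => rowC g / ‖rowC g‖ := funext iwasawaPhase_eq
  rw [this]
  exact Continuous.div (by fun_prop) (by fun_prop) fun g => by
    simpa using rowC_ne_zero g

@[fun_prop]
lemma continuous_phiBasic (ℓ : ℤ) (ν : ℂ) : Continuous (phiBasic ℓ ν) := by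
  unfold phiBasic
  refine Continuous.mul ?_ (Continuous.zpow₀ (by fun_prop) ℓ fun g => Or.inl (iwasawaPhase_ne_zero g))
  refine Continuous.cpow (Complex.continuous_ofReal.comp continuous_iwasawaY) continuous_const fun g => ?_
  exact Complex.ofReal_mem_slitPlane.2 (iwasawaY_pos g)

lemma continuous_phiTyped_integrand (ℓ₁ ℓ₂ : ℤ) (ν : ℂ) : Continuous fun p : G × ℝ =>
    phiBasic ℓ₂ ν (kMat p.2 * p.1) * Complex.exp (-Complex.I * (ℓ₁ : ℂ) * (p.2 : ℂ)) := by
  have := continuous_phiBasic ℓ₂ ν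
  fun_prop

lemma continuous_phiTyped (ℓ₁ ℓ₂ : ℤ) (ν : ℂ) : Continuous (phiTyped ℓ₁ ℓ₂ ν) := by
  unfold phiTyped
  refine continuous_const.mul ?_
  exact intervalIntegral.continuous_parametric_intervalIntegral_of_continuous'
    (continuous_phiTyped_integrand ℓ₁ ℓ₂ ν) _ _

/-- The average of `y ^ σ` over left rotations, a spherical function. -/
noncomputable def sphericalAvg (σ : ℝ) (g : G) : ℝ :=
  1 / (2 * Real.pi) * ∫ t in (0 : ℝ)..(2 * Real.pi), iwasawaY (kMat t * g) ^ σ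

lemma norm_phiTyped_le (ℓ₁ ℓ₂ : ℤ) (ν : ℂ) (g : G) :
    ‖phiTyped ℓ₁ ℓ₂ ν g‖ ≤ sphericalAvg (1 / 2 + ν.re) g := by
  have hπ := Real.pi_pos
  rw [phiTyped, norm_mul, Complex.norm_real, Real.norm_of_nonneg (by positivity), sphericalAvg]
  gcongr
  refine (intervalIntegral.norm_integral_le_integral_norm (by positivity)).trans (le_of_eq ?_)
  refine intervalIntegral.integral_congr fun t _ => ?_
  rw [norm_mul, norm_phiBasic, Complex.norm_exp]
  simp

lemma norm_zpow_sub_zpow_le {z w : ℂ} (hz : ‖z‖ = 1) (hw : ‖w‖ = 1) (m : ℤ) :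
    ‖z ^ m - w ^ m‖ ≤ |(m : ℝ)| * ‖z - w‖ := by
  have hnat : ∀ {z w : ℂ}, ‖z‖ = 1 → ‖w‖ = 1 → ∀ n : ℕ, ‖z ^ n - w ^ n‖ ≤ n * ‖z - w‖ := by
    intro z w hz hw n
    induction n with
    | zero => simp
    | succ n ih =>
      have : z ^ (n + 1) - w ^ (n + 1) = (z ^ n - w ^ n) * z + w ^ n * (z - w) := by ring
      rw [this]
      refine (norm_add_le _ _).trans ?_
      rw [norm_mul, norm_mul, hz, norm_pow, hw, one_pow, one_mul, mul_one]
      push_cast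
      linarith
  have hz0 : z ≠ 0 := norm_ne_zero_iff.1 (by rw [hz]; exact one_ne_zero)
  have hw0 : w ≠ 0 := norm_ne_zero_iff.1 (by rw [hw]; exact one_ne_zero)
  obtain ⟨n, rfl | rfl⟩ := m.eq_nat_or_neg
  · simpa using hnat hz hw n
  · have h1 := hnat (z := z⁻¹) (w := w⁻¹) (by simp [hz]) (by simp [hw]) n
    have h2 : ‖z⁻¹ - w⁻¹‖ = ‖z - w‖ := by
      rw [inv_sub_inv hz0 hw0, norm_div, norm_mul, hz, hw, mul_one, div_one, norm_sub_rev]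
    rw [h2] at h1
    simpa using h1

section exceptional

variable (g : G)

lemma normSq_sub : ‖cartanP g‖ ^ 2 - ‖cartanQ g‖ ^ 2 = 1 := by
  rw [normSq_cartanP, normSq_cartanQ]; ring

lemma conj_exp_I_mul (t : ℝ) :
    (starRingEnd ℂ) (Complex.exp (Complex.I * t)) = Complex.exp (-(Complex.I * t)) := by
  rw [← Complex.exp_conj]; congr 1; simp

lemma exp_mul_exp_neg (z : ℂ) : Complex.exp z * Complex.exp (-z) = 1 := by
  rw [← Complex.exp_add]; simp

/-- The derivative of `|d - ic|²` along left rotations is at most `4 |d - ic|` once it is multiplied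
with `|r - c r̄|`, `r = d - ic`, twice the distance of `r` from the line on which the modulus is
largest. -/
lemma exists_line : ∃ c : ℂ, ‖c‖ = 1 ∧ ∀ t : ℝ,
    |4 * (cartanP g * (starRingEnd ℂ) (cartanQ g) * Complex.exp (Complex.I * t) ^ 2).im| *
      ‖rowC (kMat t * g) - c * (starRingEnd ℂ) (rowC (kMat t * g))‖ ≤ 4 * ‖rowC (kMat t * g)‖ := by
  set P := cartanP g with hP
  set Q := cartanQ g with hQ
  rcases eq_or_ne Q 0 with hQ0 | hQ0
  · exact ⟨1, by simp, fun t => by simp [hQ0]⟩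
  have hP0 : P ≠ 0 := cartanP_ne_zero g
  have ha := norm_pos_iff.2 hP0
  have hb := norm_pos_iff.2 hQ0
  have hab := normSq_sub g
  rw [← hP, ← hQ] at hab
  set α := ‖P‖ with hα
  set β := ‖Q‖ with hβ
  have hα0 : (α : ℂ) ≠ 0 := by exact_mod_cast ha.ne'
  have hβ0 : (β : ℂ) ≠ 0 := by exact_mod_cast hb.ne'
  have hPP : P * (starRingEnd ℂ) P = (α : ℂ) ^ 2 := Complex.mul_conj' P
  have hQQ : Q * (starRingEnd ℂ) Q = (β : ℂ) ^ 2 := Complex.mul_conj' Q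
  -- `d - ic = P e + Q e⁻¹` is largest when the two terms have the same phase, so on the line through
  -- a square root of `(Q / |Q|) (P / |P|)`
  refine ⟨(Q / β) * (P / α), by
    rw [norm_mul, norm_div, norm_div, Complex.norm_real, Complex.norm_real, norm_norm, norm_norm,
      div_self hb.ne', div_self ha.ne', one_mul], fun t => ?_⟩
  rw [rowC_kMat_mul, ← hP, ← hQ]
  have hee := exp_mul_exp_neg (Complex.I * t)
  have hconj := conj_exp_I_mul t
  have hne : ‖Complex.exp (Complex.I * t)‖ = 1 := by
    rw [mul_comm]; exact Complex.norm_exp_ofReal_mul_I t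
  set e := Complex.exp (Complex.I * t)
  set e' := Complex.exp (-(Complex.I * t))
  have hconj' : (starRingEnd ℂ) e' = e := by rw [← hconj, Complex.conj_conj]
  set z := P * (starRingEnd ℂ) Q * e ^ 2 with hz
  have hzn : ‖z‖ = α * β := by
    rw [hz, norm_mul, norm_mul, RCLike.norm_conj, norm_pow, hne, one_pow, mul_one]
  have hzsq : z.re ^ 2 + z.im ^ 2 = (α * β) ^ 2 := by
    rw [← hzn, Complex.sq_norm, Complex.normSq_apply]; ring
  have hN : ‖P * e + Q * e'‖ ^ 2 = α ^ 2 + β ^ 2 + 2 * z.re := by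
    have : ((‖P * e + Q * e'‖ ^ 2 : ℝ) : ℂ) = ((α ^ 2 + β ^ 2 + 2 * z.re : ℝ) : ℂ) := by
      have h3 : (2 : ℂ) * (z.re : ℂ) = z + (starRingEnd ℂ) z := by rw [Complex.add_conj]; push_cast; ring
      push_cast
      rw [h3, ← Complex.mul_conj', ← hPP, ← hQQ]
      simp only [map_add, map_mul, map_pow, hz, hconj, hconj', Complex.conj_conj]
      linear_combination (P * (starRingEnd ℂ) P + Q * (starRingEnd ℂ) Q) * hee
    exact_mod_cast this
  have hD : ‖P * e + Q * e' - Q / β * (P / α) * (starRingEnd ℂ) (P * e + Q * e')‖ ^ 2 * (α * β)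
      = 2 * (α - β) ^ 2 * (α * β - z.re) := by
    have h1 : P * e + Q * e' - Q / β * (P / α) * (starRingEnd ℂ) (P * e + Q * e')
        = ((α - β : ℝ) : ℂ) * (P * e / α - Q * e' / β) := by
      simp only [map_add, map_mul, hconj, hconj']
      push_cast
      field_simp
      linear_combination (-Q * e') * hPP - (P * e) * hQQ
    have h2 : ((‖P * e / α - Q * e' / β‖ ^ 2 * (α * β) : ℝ) : ℂ) = ((2 * (α * β - z.re) : ℝ) : ℂ) := by
      push_cast
      have h3 : (2 : ℂ) * (z.re : ℂ) = z + (starRingEnd ℂ) z := by rw [Complex.add_conj]; push_cast; ring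
      rw [← Complex.mul_conj', mul_sub, h3]
      simp only [map_sub, map_mul, map_pow, map_div₀, hz, hconj, hconj', Complex.conj_conj,
        Complex.conj_ofReal]
      have hPP' : P * (starRingEnd ℂ) P / (α : ℂ) ^ 2 = 1 := by rw [hPP]; field_simp
      have hQQ' : Q * (starRingEnd ℂ) Q / (β : ℂ) ^ 2 = 1 := by rw [hQQ]; field_simp
      field_simp
      field_simp at hPP' hQQ'
      linear_combination (β ^ 2 * e * e') * hPP' + (α ^ 2 * e * e') * hQQ' + 2 * α ^ 2 * β ^ 2 * hee
    have h2' : ‖P * e / α - Q * e' / β‖ ^ 2 * (α * β) = 2 * (α * β - z.re) := by exact_mod_cast h2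
    rw [h1, norm_mul, Complex.norm_real, mul_pow, Real.norm_eq_abs, sq_abs, mul_assoc, h2']
    ring
  have hmain : (4 * z.im) ^ 2 *
      ‖P * e + Q * e' - Q / β * (P / α) * (starRingEnd ℂ) (P * e + Q * e')‖ ^ 2 ≤
      (4 * ‖P * e + Q * e'‖) ^ 2 := by
    have hp : 0 < α * β := mul_pos ha hb
    have hre : |z.re| ≤ α * β := by rw [← hzn]; exact Complex.abs_re_le_norm z
    obtain ⟨hr1, hr2⟩ := abs_le.1 hre
    refine le_of_mul_le_mul_right ?_ hp
    rw [mul_assoc, hD, mul_pow, mul_pow, hN]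
    have e1 : z.im ^ 2 = (α * β - z.re) * (α * β + z.re) := by linear_combination hzsq
    rw [e1]
    have e2 : α * β * (α - β) ^ 2 ≤ 1 / 4 := by
      have h1 : (α - β) * (α + β) = 1 := by linear_combination hab
      have h2 : α * β ≤ (α + β) ^ 2 / 4 := by nlinarith [sq_nonneg (α - β)]
      have h3 : ((α - β) * (α + β)) ^ 2 = 1 := by rw [h1]; norm_num
      nlinarith [sq_nonneg (α - β)]
    have e3 : 0 ≤ (α - β) ^ 2 := sq_nonneg _
    -- `|Im z|² = (αβ - Re z)(αβ + Re z)`, and `2 (αβ + Re z) ≤ |d - ic|²`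
    have e4 : (α * β - z.re) * (α * β - z.re) ≤ (2 * (α * β)) * (2 * (α * β)) := by
      apply mul_le_mul <;> linarith
    have e5 : 0 ≤ α * β + z.re := by linarith
    calc 4 ^ 2 * ((α * β - z.re) * (α * β + z.re)) * (2 * (α - β) ^ 2 * (α * β - z.re))
        = 32 * ((α * β - z.re) * (α * β - z.re)) * (α - β) ^ 2 * (α * β + z.re) := by ring
      _ ≤ 32 * ((2 * (α * β)) * (2 * (α * β))) * (α - β) ^ 2 * (α * β + z.re) := by gcongr
      _ = 128 * (α * β) * (α * β * (α - β) ^ 2) * (α * β + z.re) := by ring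
      _ ≤ 128 * (α * β) * (1 / 4) * (α * β + z.re) := by gcongr
      _ = 16 * (2 * (α * β) + 2 * z.re) * (α * β) := by ring
      _ ≤ 4 ^ 2 * (α ^ 2 + β ^ 2 + 2 * z.re) * (α * β) := by
        have : 2 * (α * β) ≤ α ^ 2 + β ^ 2 := by nlinarith [sq_nonneg (α - β)]
        gcongr
        · linarith
        · norm_num
  have := Real.sqrt_le_sqrt hmain
  rwa [Real.sqrt_mul (by positivity), Real.sqrt_sq_eq_abs, Real.sqrt_sq (norm_nonneg _),
    Real.sqrt_sq (by positivity)] at this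

/-- The harmonics with left weight `0` and a different right weight degenerate as `ν → 1/2`, where
the constants form a subrepresentation: the Fourier integral is integrated by parts. -/
lemma norm_phiTyped_zero_le {ν : ℝ} (h1 : ν < 1 / 2) {m : ℤ} (hm : m ≠ 0) :
    ‖phiTyped 0 (2 * m) ν g‖ ≤ 2 * (1 / 2 - ν) * sphericalAvg (1 / 2 + ν) g := by
  obtain ⟨c, hc, hline⟩ := exists_line g
  set P := cartanP g with hP
  set Q := cartanQ g with hQ
  set s := 1 / 2 - ν with hs
  have hs0 : 0 < s := by rw [hs]; linarith
  have hab := normSq_sub g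
  have hPQ : P * (starRingEnd ℂ) P - Q * (starRingEnd ℂ) Q = 1 := by
    rw [Complex.mul_conj', Complex.mul_conj']; exact_mod_cast hab
  set f : ℝ → ℂ := fun t => P * Complex.exp (Complex.I * t) + Q * Complex.exp (-(Complex.I * t)) with hf
  set fb : ℝ → ℂ := fun t => (starRingEnd ℂ) P * Complex.exp (-(Complex.I * t)) +
    (starRingEnd ℂ) Q * Complex.exp (Complex.I * t) with hfb
  have hfrow : ∀ t, f t = rowC (kMat t * g) := fun t => (rowC_kMat_mul g t).symm
  have hconj : ∀ t, (starRingEnd ℂ) (f t) = fb t := fun t => by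
    simp only [hf, hfb, map_add, map_mul, conj_exp_I_mul]
    rw [← conj_exp_I_mul, Complex.conj_conj]
  have hf0 : ∀ t, f t ≠ 0 := fun t => by rw [hfrow]; exact rowC_ne_zero _
  have hfb0 : ∀ t, fb t ≠ 0 := fun t => by rw [← hconj]; simpa using hf0 t
  set N : ℝ → ℝ := fun t => ‖f t‖ ^ 2 with hN
  have hN0 : ∀ t, 0 < N t := fun t => by
    have := norm_pos_iff.2 (hf0 t)
    simp only [hN]; positivity
  have hNf : ∀ t, N t = (f t * fb t).re := fun t => by
    rw [← hconj, Complex.mul_conj']; simp only [hN]; norm_cast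
  have hNf' : ∀ t, (N t : ℂ) = f t * fb t := fun t => by
    rw [← hconj, Complex.mul_conj']; simp only [hN]; norm_cast
  have he : ∀ t : ℝ, HasDerivAt (fun t : ℝ => Complex.exp (Complex.I * t))
      (Complex.I * Complex.exp (Complex.I * t)) t := fun t => by
    have := ((Complex.ofRealCLM.hasDerivAt (x := t)).const_mul Complex.I).cexp
    simp only [Complex.ofRealCLM_apply, Complex.ofReal_one, mul_one] at this
    rwa [mul_comm] at this
  have he' : ∀ t : ℝ, HasDerivAt (fun t : ℝ => Complex.exp (-(Complex.I * t)))
      (-Complex.I * Complex.exp (-(Complex.I * t))) t := fun t => by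
    have := ((Complex.ofRealCLM.hasDerivAt (x := t)).const_mul Complex.I).neg.cexp
    simp only [Complex.ofRealCLM_apply, Complex.ofReal_one, mul_one] at this
    rwa [mul_comm] at this
  have hdf := fun t => ((he t).const_mul P).add ((he' t).const_mul Q)
  have hdfb := fun t => ((he' t).const_mul ((starRingEnd ℂ) P)).add
    ((he t).const_mul ((starRingEnd ℂ) Q))
  set N' : ℝ → ℝ := fun t => -(4 * (P * (starRingEnd ℂ) Q * Complex.exp (Complex.I * t) ^ 2).im)
    with hN'
  have hdN : ∀ t, HasDerivAt N (N' t) t := fun t => by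
    have h2 := Complex.reCLM.hasFDerivAt.comp_hasDerivAt t ((hdf t).mul (hdfb t))
    have : N = Complex.reCLM ∘ (f * fb) := funext hNf
    rw [this]
    refine h2.congr_deriv ?_
    have hz : (P * (starRingEnd ℂ) Q * Complex.exp (Complex.I * t) ^ 2) -
      (starRingEnd ℂ) (P * (starRingEnd ℂ) Q * Complex.exp (Complex.I * t) ^ 2) =
      ((2 * (P * (starRingEnd ℂ) Q * Complex.exp (Complex.I * t) ^ 2).im : ℝ) : ℂ) * Complex.I :=
      Complex.sub_conj _
    rw [Complex.reCLM_apply]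
    have : ∀ w : ℂ, w = ((N' t : ℝ) : ℂ) → w.re = N' t := fun w hw => by rw [hw, Complex.ofReal_re]
    apply this
    simp only [hN']
    push_cast at hz ⊢
    simp only [map_mul, map_pow, Complex.conj_conj, conj_exp_I_mul] at hz
    simp only [Pi.add_apply]
    linear_combination 2 * Complex.I * hz + 4 *
      (P * (starRingEnd ℂ) Q * Complex.exp (Complex.I * t) ^ 2).im * Complex.I_sq
  have hdE : ∀ t, HasDerivAt (fun t => f t / fb t) (2 * Complex.I / N t * (f t / fb t)) t := fun t => by
    refine ((hdf t).div (hdfb t) (hfb0 t)).congr_deriv ?_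
    rw [hNf']
    have h1 := hf0 t
    have h2 := hfb0 t
    have hee := exp_mul_exp_neg (Complex.I * t)
    change (_ * fb t - f t * _) / fb t ^ 2 = _
    rw [div_mul_div_comm, div_eq_div_iff (by positivity) (by positivity)]
    have key : (P * (Complex.I * Complex.exp (Complex.I * t)) +
        Q * (-Complex.I * Complex.exp (-(Complex.I * t)))) * fb t - f t *
        ((starRingEnd ℂ) P * (-Complex.I * Complex.exp (-(Complex.I * t))) +
        (starRingEnd ℂ) Q * (Complex.I * Complex.exp (Complex.I * t))) = 2 * Complex.I := by
      simp only [hf, hfb]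
      linear_combination (2 * Complex.I * (P * (starRingEnd ℂ) P - Q * (starRingEnd ℂ) Q)) * hee +
        2 * Complex.I * hPQ
    rw [key]; ring
  set E : ℝ → ℂ := fun t => f t / fb t with hE
  have hE0 : ∀ t, E t ≠ 0 := fun t => div_ne_zero (hf0 t) (hfb0 t)
  have hEn : ∀ t, ‖E t‖ = 1 := fun t => by
    simp only [hE]
    rw [norm_div, ← hconj, RCLike.norm_conj, div_self (norm_ne_zero_iff.2 (hf0 t))]
  have hdEm : ∀ t, HasDerivAt (fun t => E t ^ m) (2 * Complex.I * m / N t * E t ^ m) t := fun t => by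
    refine ((hasDerivAt_zpow m (E t) (Or.inl (hE0 t))).comp t (hdE t)).congr_deriv ?_
    rw [zpow_sub_one₀ (hE0 t)]
    have := hE0 t
    change _ * (2 * Complex.I / N t * E t) = _
    field_simp
  have hdNs : ∀ t, HasDerivAt (fun t => ((N t ^ s : ℝ) : ℂ)) ((N' t * s * N t ^ (s - 1) : ℝ) : ℂ) t :=
    fun t => ((hdN t).rpow_const (Or.inl (hN0 t).ne')).ofReal_comp
  have hdH := fun t => (hdNs t).mul ((hdEm t).sub_const (c ^ m))
  have hcf : Continuous f := by fun_prop
  have hcfb : Continuous fb := by fun_prop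
  have hcN : Continuous N := by fun_prop
  have hcN' : Continuous N' := by
    simp only [hN']
    exact (continuous_const.mul (Complex.continuous_im.comp (by fun_prop))).neg
  have hcE : Continuous fun t => E t ^ m :=
    Continuous.zpow₀ (hcf.div hcfb hfb0) m fun t => Or.inl (hE0 t)
  have hcNs : ∀ r : ℝ, Continuous fun t => N t ^ r := fun r =>
    hcN.rpow_const fun t => Or.inl (hN0 t).ne'
  -- the two terms of the derivative of `N ^ s * (E ^ m - c ^ m)`
  set A : ℝ → ℂ := fun t => ((N' t * s * N t ^ (s - 1) : ℝ) : ℂ) * (E t ^ m - c ^ m) with hA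
  set D : ℝ → ℂ := fun t => ((N t ^ (s - 1) : ℝ) : ℂ) * E t ^ m with hD
  have hcNsC : Continuous fun t => ((N t ^ (s - 1) : ℝ) : ℂ) :=
    Complex.continuous_ofReal.comp (hcNs _)
  have hcA : Continuous A := by
    refine Continuous.mul (Complex.continuous_ofReal.comp ?_) (hcE.sub continuous_const)
    exact (hcN'.mul continuous_const).mul (hcNs _)
  have hcD : Continuous D := hcNsC.mul hcE
  have hder : ∀ t, HasDerivAt (fun t => ((N t ^ s : ℝ) : ℂ) * (E t ^ m - c ^ m))
      (A t + (2 * Complex.I * m) * D t) t := fun t => by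
    refine (hdH t).congr_deriv ?_
    simp only [hA, hD]
    have hNt := hN0 t
    have : ((N t ^ s : ℝ) : ℂ) = ((N t ^ (s - 1) : ℝ) : ℂ) * N t := by
      rw [← Complex.ofReal_mul, Real.rpow_sub_one hNt.ne', div_mul_cancel₀ _ hNt.ne']
    have hNc : (N t : ℂ) ≠ 0 := by exact_mod_cast hNt.ne'
    rw [this]
    field_simp
  have hint := intervalIntegral.integral_eq_sub_of_hasDerivAt (a := 0) (b := 2 * Real.pi)
    (fun t _ => hder t) ((hcA.add (continuous_const.mul hcD)).intervalIntegrable _ _)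
  have hper : f (2 * Real.pi) = f 0 := by
    rw [hfrow, hfrow, kMat_two_pi, kMat_zero]
  have hperb : fb (2 * Real.pi) = fb 0 := by rw [← hconj, hper, hconj]
  have hH : ((N (2 * Real.pi) ^ s : ℝ) : ℂ) * (E (2 * Real.pi) ^ m - c ^ m)
      - ((N 0 ^ s : ℝ) : ℂ) * (E 0 ^ m - c ^ m) = 0 := by
    simp only [hN, hE, hper, hperb, sub_self]
  have hadd := intervalIntegral.integral_add (μ := volume) (f := A)
    (g := fun t => (2 * Complex.I * m) * D t) (hcA.intervalIntegrable 0 (2 * Real.pi))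
    ((continuous_const.mul hcD).intervalIntegrable 0 (2 * Real.pi))
  rw [hH, hadd, intervalIntegral.integral_const_mul] at hint
  have hAbound : ∀ t, ‖A t‖ ≤ 4 * |(m : ℝ)| * s * N t ^ (s - 1) := fun t => by
    have h3 := norm_zpow_sub_zpow_le (hEn t) hc m
    have h4 := hline t
    rw [← hfrow, hconj] at h4
    have h5 : ‖E t - c‖ = ‖f t - c * fb t‖ / ‖f t‖ := by
      have : E t - c = (f t - c * fb t) / fb t := by
        rw [sub_div, mul_div_cancel_right₀ _ (hfb0 t)]
      rw [this, norm_div, ← hconj, RCLike.norm_conj]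
    have hfn := norm_pos_iff.2 (hf0 t)
    have h6 : |N' t| * ‖E t - c‖ ≤ 4 := by
      rw [h5, ← mul_div_assoc, div_le_iff₀ hfn]
      simpa only [hN', abs_neg] using h4
    have h7 : 0 ≤ N t ^ (s - 1) := Real.rpow_nonneg (hN0 t).le _
    simp only [hA]
    rw [norm_mul, Complex.norm_real, Real.norm_eq_abs, abs_mul, abs_mul, abs_of_pos hs0, abs_of_nonneg h7]
    calc |N' t| * s * N t ^ (s - 1) * ‖E t ^ m - c ^ m‖
        ≤ |N' t| * s * N t ^ (s - 1) * (|(m : ℝ)| * ‖E t - c‖) := by gcongr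
      _ = (|N' t| * ‖E t - c‖) * (s * N t ^ (s - 1) * |(m : ℝ)|) := by ring
      _ ≤ 4 * (s * N t ^ (s - 1) * |(m : ℝ)|) := by gcongr
      _ = _ := by ring
  have hπ := Real.pi_pos
  have hI : ‖∫ t in (0 : ℝ)..(2 * Real.pi), D t‖ ≤
      2 * s * ∫ t in (0 : ℝ)..(2 * Real.pi), N t ^ (s - 1) := by
    have h8 : ‖∫ t in (0 : ℝ)..(2 * Real.pi), A t‖ ≤
        ∫ t in (0 : ℝ)..(2 * Real.pi), 4 * |(m : ℝ)| * s * N t ^ (s - 1) :=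
      intervalIntegral.norm_integral_le_of_norm_le (by positivity)
        (Filter.Eventually.of_forall fun t _ => hAbound t)
        ((continuous_const.mul (hcNs _)).intervalIntegrable _ _)
    rw [intervalIntegral.integral_const_mul] at h8
    have h9 : ∫ t in (0 : ℝ)..(2 * Real.pi), A t =
        -(2 * Complex.I * m * ∫ t in (0 : ℝ)..(2 * Real.pi), D t) := by linear_combination hint
    rw [h9, norm_neg, norm_mul, norm_mul, norm_mul, Complex.norm_I, Complex.norm_intCast,
      Complex.norm_ofNat] at h8
    have hmp : 0 < |(m : ℝ)| := abs_pos.2 (by exact_mod_cast hm)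
    refine le_of_mul_le_mul_left ?_ (by positivity : 0 < 2 * |(m : ℝ)|)
    linarith
  have hY : ∀ t, iwasawaY (kMat t * g) = (N t)⁻¹ := fun t => by
    rw [iwasawaY_eq, ← hfrow]
  have hrp : ∀ t, iwasawaY (kMat t * g) ^ (1 / 2 + ν) = N t ^ (s - 1) := fun t => by
    rw [hY, Real.inv_rpow (hN0 t).le, ← Real.rpow_neg (hN0 t).le]; congr 1; rw [hs]; ring
  have hDphi : ∀ t : ℝ, phiBasic (2 * m) ν (kMat t * g) * Complex.exp (-Complex.I * ((0 : ℤ) : ℂ) * t) = D t := by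
    intro t
    have hph : iwasawaPhase (kMat t * g) ^ (2 * m) = E t ^ m := by
      rw [zpow_mul, iwasawaPhase_eq, ← hfrow]
      congr 1
      simp only [hE]
      have hfn : ((‖f t‖ : ℝ) : ℂ) ≠ 0 := by exact_mod_cast norm_ne_zero_iff.2 (hf0 t)
      rw [← hconj, zpow_ofNat, div_pow, ← Complex.mul_conj']
      have h1 := hf0 t
      have h2 : (starRingEnd ℂ) (f t) ≠ 0 := by simpa using h1
      field_simp
    rw [phiBasic, hph]
    simp only [hD, Int.cast_zero, mul_zero, zero_mul, Complex.exp_zero, mul_one]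
    rw [← hrp, Complex.ofReal_cpow (iwasawaY_pos _).le]
    push_cast
    rfl
  rw [phiTyped, norm_mul, Complex.norm_real, Real.norm_of_nonneg (by positivity), sphericalAvg]
  simp only [hDphi, hrp]
  calc 1 / (2 * Real.pi) * ‖∫ t in (0 : ℝ)..(2 * Real.pi), D t‖
      ≤ 1 / (2 * Real.pi) * (2 * s * ∫ t in (0 : ℝ)..(2 * Real.pi), N t ^ (s - 1)) := by gcongr
    _ = _ := by ring

end exceptional

end SL2Spectral
namespace SL2Spectral

/-! ### Smooth functions and integration by parts -/

open MeasureTheory Set Filter Topology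

/-- The matrix entries of an element of `G`. -/
def entries (g : G) : Fin 2 → Fin 2 → ℝ := fun i j => g i j

lemma continuous_entries : Continuous entries :=
  continuous_pi fun i => continuous_pi fun j => continuous_entry i j

/-- A measure preserving one-parameter group of transformations of `G` whose generating vector field
is the restriction of a linear vector field on the space of matrices. -/
structure IsLinearFlow (T : ℝ → G → G) : Prop where
  zero : ∀ g, T 0 g = g
  add : ∀ s t g, T (s + t) g = T t (T s g)
  cont : Continuous fun p : ℝ × G => T p.1 p.2
  preserving : ∀ t, MeasurePreserving (T t) haarG haarG
  generator : ∃ L : (Fin 2 → Fin 2 → ℝ) →L[ℝ] (Fin 2 → Fin 2 → ℝ), ∀ g,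
    HasDerivAt (fun t => entries (T t g)) (L (entries g)) 0

/-- The derivative of a function along a flow. -/
noncomputable def lieDeriv (T : ℝ → G → G) (f : G → ℂ) (g : G) : ℂ := deriv (fun t => f (T t g)) 0

/-- Smooth functions vanishing outside a given set. -/
def IsTest (K : Set G) (f : G → ℂ) : Prop := SmoothOnG f ∧ ∀ g, g ∉ K → f g = 0

lemma SmoothOnG.continuous {f : G → ℂ} (hf : SmoothOnG f) : Continuous f := by
  refine continuous_iff_continuousAt.2 fun g => ?_
  obtain ⟨φ, hφ, he⟩ := hf g
  exact (hφ.continuous.comp continuous_entries).continuousAt.congr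
    (he.mono fun h hh => hh.symm)

lemma SmoothOnG.add {f₁ f₂ : G → ℂ} (h₁ : SmoothOnG f₁) (h₂ : SmoothOnG f₂) :
    SmoothOnG fun g => f₁ g + f₂ g := fun g => by
  obtain ⟨φ₁, hφ₁, he₁⟩ := h₁ g
  obtain ⟨φ₂, hφ₂, he₂⟩ := h₂ g
  refine ⟨fun M => φ₁ M + φ₂ M, hφ₁.add hφ₂, ?_⟩
  filter_upwards [he₁, he₂] with h k₁ k₂
  rw [k₁, k₂]

lemma SmoothOnG.const_mul {f : G → ℂ} (hf : SmoothOnG f) (c : ℂ) :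
    SmoothOnG fun g => c * f g := fun g => by
  obtain ⟨φ, hφ, he⟩ := hf g
  refine ⟨fun M => c * φ M, contDiff_const.mul hφ, ?_⟩
  filter_upwards [he] with h k
  rw [k]

lemma IsTest.add {K : Set G} {f₁ f₂ : G → ℂ} (h₁ : IsTest K f₁) (h₂ : IsTest K f₂) :
    IsTest K fun g => f₁ g + f₂ g :=
  ⟨h₁.1.add h₂.1, fun g hg => by simp only [h₁.2 g hg, h₂.2 g hg, add_zero]⟩

lemma IsTest.const_mul {K : Set G} {f : G → ℂ} (hf : IsTest K f) (c : ℂ) :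
    IsTest K fun g => c * f g :=
  ⟨hf.1.const_mul c, fun g hg => by simp only [hf.2 g hg, mul_zero]⟩

section flow

variable {T : ℝ → G → G} (hT : IsLinearFlow T)
include hT

lemma IsLinearFlow.continuous_orbit (g : G) : Continuous fun t => T t g := by
  have := hT.cont
  exact this.comp (by fun_prop : Continuous fun t : ℝ => (t, g))

lemma IsLinearFlow.continuous_map (t : ℝ) : Continuous (T t) := by
  have := hT.cont
  exact this.comp (by fun_prop : Continuous fun g : G => (t, g))

lemma IsLinearFlow.neg_apply (t : ℝ) (g : G) : T (-t) (T t g) = g := by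
  rw [← hT.add, add_neg_cancel, hT.zero]

lemma IsLinearFlow.hasDerivAt_of_zero {f f' : G → ℂ}
    (h : ∀ g, HasDerivAt (fun t => f (T t g)) (f' g) 0) (g : G) (s : ℝ) :
    HasDerivAt (fun t => f (T t g)) (f' (T s g)) s := by
  have h1 : HasDerivAt (fun t => f (T t (T s g))) (f' (T s g)) (s - s) := by
    rw [sub_self]; exact h (T s g)
  have h2 := h1.comp_sub_const s s
  refine h2.congr_of_eventuallyEq (Eventually.of_forall fun t => ?_)
  change f (T t g) = f (T (t - s) (T s g))
  rw [← hT.add, add_sub_cancel]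

/-- The derivative along a flow in terms of a local extension to the space of matrices. -/
lemma IsLinearFlow.hasDerivAt_of_eventually
    {L : (Fin 2 → Fin 2 → ℝ) →L[ℝ] (Fin 2 → Fin 2 → ℝ)}
    (hL : ∀ g, HasDerivAt (fun t => entries (T t g)) (L (entries g)) 0)
    {F : G → ℂ} {f : (Fin 2 → Fin 2 → ℝ) → ℂ} (hf : ContDiff ℝ ∞ f) {g : G}
    (he : ∀ᶠ h in 𝓝 g, F h = f (entries h)) :
    HasDerivAt (fun t => F (T t g)) (fderiv ℝ f (entries g) (L (entries g))) 0 := by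
  have h1 : HasFDerivAt f (fderiv ℝ f (entries g)) (entries (T 0 g)) := by
    rw [hT.zero]
    exact (hf.differentiable (by simp) _).hasFDerivAt
  have h2 := h1.comp_hasDerivAt 0 (hL g)
  refine h2.congr_of_eventuallyEq ?_
  have h3 : Tendsto (fun t => T t g) (𝓝 0) (𝓝 g) := by
    have := (hT.continuous_orbit g).tendsto 0
    rwa [hT.zero] at this
  exact h3.eventually he

lemma SmoothOnG.hasDerivAt_lieDeriv {F : G → ℂ} (hF : SmoothOnG F) (g : G) :
    HasDerivAt (fun t => F (T t g)) (lieDeriv T F g) 0 := by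
  obtain ⟨L, hL⟩ := hT.generator
  obtain ⟨f, hf, he⟩ := hF g
  exact (hT.hasDerivAt_of_eventually hL hf he).differentiableAt.hasDerivAt

lemma SmoothOnG.lieDeriv {F : G → ℂ} (hF : SmoothOnG F) : SmoothOnG (lieDeriv T F) := by
  obtain ⟨L, hL⟩ := hT.generator
  intro g
  obtain ⟨f, hf, he⟩ := hF g
  refine ⟨fun M => fderiv ℝ f M (L M), (hf.fderiv_right (by simp)).clm_apply L.contDiff, ?_⟩
  filter_upwards [eventually_eventually_nhds.2 he] with h hh
  exact (hT.hasDerivAt_of_eventually hL hf hh).deriv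

lemma IsTest.lieDeriv {K : Set G} (hK : IsClosed K) {F : G → ℂ} (hF : IsTest K F) :
    IsTest K (lieDeriv T F) := by
  refine ⟨hF.1.lieDeriv hT, fun g hg => ?_⟩
  have h1 : ∀ᶠ t in 𝓝 (0 : ℝ), T t g ∈ Kᶜ := by
    have h2 := (hT.continuous_orbit g).tendsto 0
    rw [hT.zero] at h2
    exact h2.eventually (hK.isOpen_compl.mem_nhds hg)
  have h3 : (fun t => F (T t g)) =ᶠ[𝓝 0] fun _ => 0 := h1.mono fun t ht => hF.2 _ ht
  rw [SL2Spectral.lieDeriv, h3.deriv_eq, deriv_const]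

/-- The integral of a derivative along a measure preserving flow vanishes. -/
lemma IsLinearFlow.integral_eq_zero {K : Set G} (hK : IsCompact K) {f f' : G → ℂ}
    (hf : Continuous f) (hf' : Continuous f') (h0 : ∀ g, g ∉ K → f g = 0)
    (h0' : ∀ g, g ∉ K → f' g = 0) (h : ∀ g, HasDerivAt (fun t => f (T t g)) (f' g) 0) :
    ∫ g, f' g ∂haarG = 0 := by
  obtain ⟨C, hC⟩ := hK.exists_bound_of_continuousOn hf'.continuousOn
  have hC0 : ∀ g, ‖f' g‖ ≤ max C 0 := fun g => by
    by_cases hg : g ∈ K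
    · exact (hC g hg).trans (le_max_left _ _)
    · rw [h0' g hg]; simp
  -- for small times, the support of `f' ∘ T t` stays in a compact set
  set K' : Set G := (fun p : ℝ × G => T p.1 p.2) '' (Icc (-1) 1 ×ˢ K) with hK'
  have hK'c : IsCompact K' := (isCompact_Icc.prod hK).image hT.cont
  have hmem : ∀ t ∈ Icc (-1 : ℝ) 1, ∀ g, T t g ∈ K → g ∈ K' := fun t ht g hg =>
    ⟨(-t, T t g), ⟨⟨by linarith [ht.2], by linarith [ht.1]⟩, hg⟩, hT.neg_apply t g⟩
  have hint : Integrable f haarG :=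
    hf.integrable_of_hasCompactSupport (HasCompactSupport.intro hK h0)
  have key := hasDerivAt_integral_of_dominated_loc_of_deriv_le (μ := haarG) (𝕜 := ℝ)
    (F := fun t g => f (T t g)) (F' := fun t g => f' (T t g)) (x₀ := 0)
    (bound := K'.indicator fun _ => max C 0) (s := Icc (-1) 1)
    (Icc_mem_nhds (by norm_num) (by norm_num))
    (Eventually.of_forall fun t => (hf.comp (hT.continuous_map t)).aestronglyMeasurable)
    (by simpa only [hT.zero] using hint)
    (hf'.comp (hT.continuous_map 0)).aestronglyMeasurable
    (Eventually.of_forall fun g t ht => by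
      by_cases hg : T t g ∈ K
      · rw [indicator_of_mem (hmem t ht g hg)]; exact hC0 _
      · rw [h0' _ hg, norm_zero]
        exact indicator_nonneg (fun _ _ => le_max_right _ _) _)
    ((integrable_indicator_iff hK'c.measurableSet).2
      (continuousOn_const.integrableOn_compact hK'c))
    (Eventually.of_forall fun g t _ => hT.hasDerivAt_of_zero h g t)
  have hconst : (fun t => ∫ g, f (T t g) ∂haarG) = fun _ => ∫ g, f g ∂haarG := by
    funext t
    have hm := hT.preserving t
    rw [← integral_map hm.measurable.aemeasurable hf.aestronglyMeasurable, hm.map_eq]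
  have h1 := key.2
  rw [hconst] at h1
  have h2 := h1.unique (hasDerivAt_const 0 _)
  simpa only [hT.zero] using h2

/-- Integration by parts along a flow. -/
lemma IsTest.integral_lieDeriv_mul {K : Set G} (hK : IsCompact K) {F h h' : G → ℂ}
    (hF : IsTest K F) (hh : Continuous h) (hh' : Continuous h')
    (hd : ∀ g, HasDerivAt (fun t => h (T t g)) (h' g) 0) :
    ∫ g, SL2Spectral.lieDeriv T F g * h g ∂haarG = -∫ g, F g * h' g ∂haarG := by
  have hD := hF.lieDeriv hT hK.isClosed
  have hi : ∀ {u v : G → ℂ}, IsTest K u → Continuous v → Integrable (fun g => u g * v g) haarG :=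
    fun {u v} hu hv => (hu.1.continuous.mul hv).integrable_of_hasCompactSupport
      (HasCompactSupport.intro hK fun g hg => by
        change u g * v g = 0
        rw [hu.2 g hg, zero_mul])
  have h1 := hT.integral_eq_zero hK (f := fun g => F g * h g)
    (f' := fun g => SL2Spectral.lieDeriv T F g * h g + F g * h' g)
    (hF.1.continuous.mul hh) ((hD.1.continuous.mul hh).add (hF.1.continuous.mul hh'))
    (fun g hg => by rw [hF.2 g hg, zero_mul])
    (fun g hg => by rw [hF.2 g hg, hD.2 g hg, zero_mul, zero_mul, add_zero])
    (fun g => by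
      have h2 := (hF.1.hasDerivAt_lieDeriv hT g).mul (hd g)
      simp only [hT.zero] at h2
      exact h2)
  rw [integral_add (hi hD hh) (hi hF hh')] at h1
  exact eq_neg_of_add_eq_zero_left h1

end flow

lemma isLinearFlow_mul_right {c : ℝ → G} (hc : Continuous c) (h0 : c 0 = 1)
    (hadd : ∀ s t, c (s + t) = c s * c t) {X : Fin 2 → Fin 2 → ℝ}
    (hX : ∀ i j, HasDerivAt (fun t => c t i j) (X i j) 0) :
    IsLinearFlow fun t g => g * c t where
  zero g := by rw [h0, mul_one]
  add s t g := by rw [hadd, mul_assoc]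
  cont := by fun_prop
  preserving t := measurePreserving_mul_right haarG (c t)
  generator := by
    refine ⟨LinearMap.toContinuousLinearMap
      { toFun := fun M i j => M i 0 * X 0 j + M i 1 * X 1 j
        map_add' := fun M N => by ext i j; simp only [Pi.add_apply]; ring
        map_smul' := fun a M => by
          ext i j; simp only [Pi.smul_apply, smul_eq_mul, RingHom.id_apply]; ring }, fun g => ?_⟩
    refine hasDerivAt_pi.2 fun i => hasDerivAt_pi.2 fun j => ?_
    have h := ((hX 0 j).const_mul (g i 0)).add ((hX 1 j).const_mul (g i 1))
    refine h.congr_of_eventuallyEq (Eventually.of_forall fun t => ?_)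
    exact mul_apply' g (c t) i j

lemma isLinearFlow_mul_left {c : ℝ → G} (hc : Continuous c) (h0 : c 0 = 1)
    (hadd : ∀ s t, c (s + t) = c t * c s) {X : Fin 2 → Fin 2 → ℝ}
    (hX : ∀ i j, HasDerivAt (fun t => c t i j) (X i j) 0) :
    IsLinearFlow fun t g => c t * g where
  zero g := by rw [h0, one_mul]
  add s t g := by rw [hadd, mul_assoc]
  cont := by fun_prop
  preserving t := measurePreserving_mul_left haarG (c t)
  generator := by
    refine ⟨LinearMap.toContinuousLinearMap
      { toFun := fun M i j => X i 0 * M 0 j + X i 1 * M 1 j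
        map_add' := fun M N => by ext i j; simp only [Pi.add_apply]; ring
        map_smul' := fun a M => by
          ext i j; simp only [Pi.smul_apply, smul_eq_mul, RingHom.id_apply]; ring }, fun g => ?_⟩
    refine hasDerivAt_pi.2 fun i => hasDerivAt_pi.2 fun j => ?_
    have h := ((hX i 0).mul_const (g 0 j)).add ((hX i 1).mul_const (g 1 j))
    refine h.congr_of_eventuallyEq (Eventually.of_forall fun t => ?_)
    exact mul_apply' (c t) g i j

lemma hasDerivAt_nMat (i j : Fin 2) :
    HasDerivAt (fun t => nMat t i j) (!![0, 1; 0, 0] i j) 0 := by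
  fin_cases i <;> fin_cases j
  · exact hasDerivAt_const _ _
  · exact hasDerivAt_id _
  · exact hasDerivAt_const _ _
  · exact hasDerivAt_const _ _

lemma hasDerivAt_kMat (i j : Fin 2) :
    HasDerivAt (fun t => kMat t i j) (!![0, 1; -1, 0] i j) 0 := by
  have hc := Real.hasDerivAt_cos 0
  have hs := Real.hasDerivAt_sin 0
  simp only [Real.sin_zero, Real.cos_zero, neg_zero] at hc hs
  fin_cases i <;> fin_cases j
  · exact hc
  · exact hs
  · exact hs.neg
  · exact hc

lemma aMat_exp_apply (t : ℝ) (i j : Fin 2) : aMat (Real.exp (2 * t)) i j =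
    !![Real.exp t, 0; 0, Real.exp (-t)] i j := by
  have h : √(Real.exp (2 * t)) = Real.exp t := by
    rw [two_mul, Real.exp_add, Real.sqrt_mul_self (Real.exp_pos t).le]
  fin_cases i <;> fin_cases j
  · exact (aMat_00 (Real.exp_pos _)).trans h
  · exact aMat_01 (Real.exp_pos _)
  · exact aMat_10 (Real.exp_pos _)
  · refine (aMat_11 (Real.exp_pos _)).trans ?_
    rw [h, one_div, ← Real.exp_neg]
    rfl

lemma hasDerivAt_aMat_exp (i j : Fin 2) :
    HasDerivAt (fun t => aMat (Real.exp (2 * t)) i j) (!![1, 0; 0, -1] i j) 0 := by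
  simp only [aMat_exp_apply]
  have h1 := Real.hasDerivAt_exp 0
  have h2 := (hasDerivAt_neg (0 : ℝ)).exp
  simp only [neg_zero, Real.exp_zero, mul_neg, mul_one] at h1 h2
  fin_cases i <;> fin_cases j
  · exact h1
  · exact hasDerivAt_const _ _
  · exact hasDerivAt_const _ _
  · exact h2

lemma isLinearFlow_nMat : IsLinearFlow fun t g => g * nMat t :=
  isLinearFlow_mul_right continuous_nMat nMat_zero nMat_add hasDerivAt_nMat

lemma isLinearFlow_kMat : IsLinearFlow fun t g => g * kMat t :=
  isLinearFlow_mul_right continuous_kMat kMat_zero kMat_add hasDerivAt_kMat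

lemma isLinearFlow_kMat_left : IsLinearFlow fun t g => kMat t * g :=
  isLinearFlow_mul_left continuous_kMat kMat_zero (fun s t => by rw [add_comm, kMat_add])
    hasDerivAt_kMat

lemma isLinearFlow_aMat : IsLinearFlow fun t g => g * aMat (Real.exp (2 * t)) :=
  isLinearFlow_mul_right
    (continuousOn_aMat.comp_continuous (by fun_prop) fun t => Real.exp_pos _)
    (by rw [mul_zero, Real.exp_zero, aMat_eq one_pos]; apply ext' <;> simp)
    (fun s t => by
      apply ext' <;> simp only [mul_apply', aMat_exp_apply] <;> simp [← Real.exp_add, add_comm])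
    hasDerivAt_aMat_exp

end SL2Spectral
namespace SL2Spectral

/-! ### Differential operators and the harmonics -/

open MeasureTheory Set Filter Topology

/-- `φ_ℓ` with the complex power of `y` written through the real logarithm of `|d - ic|²`. -/
lemma phiBasic_eq (ℓ : ℤ) (ν : ℂ) (g : G) :
    phiBasic ℓ ν g = Complex.exp (-(1 / 2 + ν) * Real.log (‖rowC g‖ ^ 2)) *
      iwasawaPhase g ^ ℓ := by
  have h : 0 < ‖rowC g‖ ^ 2 := by have := norm_pos_iff.2 (rowC_ne_zero g); positivity
  rw [phiBasic, iwasawaY_eq, Complex.cpow_def_of_ne_zero (by exact_mod_cast (inv_pos.2 h).ne'),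
    ← Complex.ofReal_log (inv_pos.2 h).le, Real.log_inv]
  congr 2
  push_cast
  ring

/-- The derivative of the basic harmonics along a curve, in terms of the bottom row. -/
lemma hasDerivAt_phiBasic (ℓ : ℤ) (ν : ℂ) {γ : ℝ → G} {r' : ℂ} {t : ℝ}
    (h : HasDerivAt (fun t => rowC (γ t)) r' t) :
    HasDerivAt (fun t => phiBasic ℓ ν (γ t)) (phiBasic ℓ ν (γ t) *
      (((ℓ - 1) / 2 - ν) * (r' / rowC (γ t)) -
        ((ℓ + 1) / 2 + ν) * ((starRingEnd ℂ) r' / (starRingEnd ℂ) (rowC (γ t))))) t := by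
  set r := fun t => rowC (γ t) with hr
  have hr0 : ∀ t, r t ≠ 0 := fun t => rowC_ne_zero _
  have hN0 : ∀ t, 0 < ‖r t‖ ^ 2 := fun t => by have := norm_pos_iff.2 (hr0 t); positivity
  have hconj : HasDerivAt (fun t => (starRingEnd ℂ) (r t)) ((starRingEnd ℂ) r') t :=
    Complex.conjCLE.toContinuousLinearMap.hasFDerivAt.comp_hasDerivAt t h
  have hc0 : (starRingEnd ℂ) (r t) ≠ 0 := by simpa using hr0 t
  have hNC : ((‖r t‖ ^ 2 : ℝ) : ℂ) = r t * (starRingEnd ℂ) (r t) := by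
    rw [Complex.mul_conj']; norm_cast
  have hprod := h.mul hconj
  have hN : HasDerivAt (fun t => ‖r t‖ ^ 2)
      ((r' * (starRingEnd ℂ) (r t) + r t * (starRingEnd ℂ) r').re) t := by
    have h1 := Complex.reCLM.hasFDerivAt.comp_hasDerivAt t hprod
    refine h1.congr_of_eventuallyEq (Eventually.of_forall fun s => ?_)
    change ‖r s‖ ^ 2 = (r s * (starRingEnd ℂ) (r s)).re
    rw [Complex.mul_conj']; norm_cast
  have hN'C : (((r' * (starRingEnd ℂ) (r t) + r t * (starRingEnd ℂ) r').re : ℝ) : ℂ) =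
      r' * (starRingEnd ℂ) (r t) + r t * (starRingEnd ℂ) r' := by
    rw [← Complex.conj_eq_iff_re]
    simp only [map_add, map_mul, Complex.conj_conj]
    ring
  have hlog := (hN.log (hN0 t).ne').ofReal_comp
  have hE := (hlog.const_mul (-(1 / 2 + ν))).cexp
  -- the phase is `r * exp (- log |r|² / 2)`
  have hph : ∀ s, iwasawaPhase (γ s) = r s * Complex.exp (-(1 / 2) * Real.log (‖r s‖ ^ 2)) := by
    intro s
    have hn := norm_pos_iff.2 (hr0 s)
    rw [iwasawaPhase_eq, div_eq_mul_inv, Real.log_pow]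
    congr 1
    have h2 : (-(1 / 2) * ((((2 : ℕ) : ℝ) * Real.log ‖r s‖ : ℝ) : ℂ)) = ((-Real.log ‖r s‖ : ℝ) : ℂ) := by
      push_cast; ring
    rw [h2, ← Complex.ofReal_exp, Real.exp_neg, Real.exp_log hn, Complex.ofReal_inv]
  have hP := (h.mul (hlog.const_mul (-(1 / 2) : ℂ)).cexp)
  have hP' : HasDerivAt (fun s => iwasawaPhase (γ s)) _ t :=
    hP.congr_of_eventuallyEq (Eventually.of_forall fun s => hph s)
  have hPz := (hasDerivAt_zpow ℓ (iwasawaPhase (γ t))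
    (Or.inl (iwasawaPhase_ne_zero (γ t)))).comp t hP'
  have hall := hE.mul hPz
  have hfun : (fun t => phiBasic ℓ ν (γ t)) = fun t =>
      Complex.exp (-(1 / 2 + ν) * Real.log (‖r t‖ ^ 2)) * iwasawaPhase (γ t) ^ ℓ :=
    funext fun t => phiBasic_eq ℓ ν (γ t)
  rw [hfun]
  refine hall.congr_deriv ?_
  simp only [Function.comp_apply]
  rw [phiBasic_eq, zpow_sub_one₀ (iwasawaPhase_ne_zero (γ t)), hph t]
  have hexp : Complex.exp (-(1 / 2) * Real.log (‖r t‖ ^ 2)) ≠ 0 := Complex.exp_ne_zero _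
  have hr1 := hr0 t
  rw [Complex.ofReal_div, hN'C, hNC]
  change _ = Complex.exp (-(1 / 2 + ν) * (Real.log (‖r t‖ ^ 2) : ℝ)) * (_ * _) ^ ℓ *
    (_ * (r' / r t) - _ * (_ / (starRingEnd ℂ) (r t)))
  field_simp
  ring

lemma phiBasic_add_two (ℓ : ℤ) (ν : ℂ) (g : G) :
    phiBasic (ℓ + 2) ν g = phiBasic ℓ ν g * (rowC g / (starRingEnd ℂ) (rowC g)) := by
  rw [phiBasic, phiBasic, zpow_add₀ (iwasawaPhase_ne_zero g), ← mul_assoc]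
  congr 1
  have h1 := rowC_ne_zero g
  have h2 : (starRingEnd ℂ) (rowC g) ≠ 0 := by simpa using h1
  have h3 : ((‖rowC g‖ : ℝ) : ℂ) ≠ 0 := by exact_mod_cast norm_ne_zero_iff.2 h1
  rw [iwasawaPhase_eq, zpow_ofNat, div_pow, ← Complex.mul_conj']
  field_simp

lemma phiBasic_sub_two (ℓ : ℤ) (ν : ℂ) (g : G) :
    phiBasic (ℓ - 2) ν g = phiBasic ℓ ν g * ((starRingEnd ℂ) (rowC g) / rowC g) := by
  have h := phiBasic_add_two (ℓ - 2) ν g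
  rw [sub_add_cancel] at h
  have h1 := rowC_ne_zero g
  have h2 : (starRingEnd ℂ) (rowC g) ≠ 0 := by simpa using h1
  rw [h]
  field_simp

/-- The variation of the bottom row of `g` under right multiplication by `exp (t X)`. -/
noncomputable def rowVariation (X : Fin 2 → Fin 2 → ℝ) (g : G) : ℂ :=
  ((g 1 0 * X 0 1 + g 1 1 * X 1 1 : ℝ) : ℂ) - Complex.I * ((g 1 0 * X 0 0 + g 1 1 * X 1 0 : ℝ) : ℂ)

lemma hasDerivAt_rowC_mul {c : ℝ → G} {X : Fin 2 → Fin 2 → ℝ}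
    (hX : ∀ i j, HasDerivAt (fun t => c t i j) (X i j) 0) (g : G) :
    HasDerivAt (fun t => rowC (g * c t)) (rowVariation X g) 0 := by
  have e : ∀ j, HasDerivAt (fun t => (((g * c t) 1 j : ℝ) : ℂ))
      ((g 1 0 * X 0 j + g 1 1 * X 1 j : ℝ) : ℂ) 0 := fun j => by
    have h := (((hX 0 j).const_mul (g 1 0)).add ((hX 1 j).const_mul (g 1 1))).ofReal_comp
    refine h.congr_of_eventuallyEq (Eventually.of_forall fun t => ?_)
    change (((g * c t) 1 j : ℝ) : ℂ) = _
    rw [mul_apply']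
    rfl
  exact (e 1).sub ((e 0).const_mul Complex.I)

/-- The derivative of `phiBasic ℓ ν` in the direction of the left invariant vector field `X`. -/
noncomputable def phiVariation (X : Fin 2 → Fin 2 → ℝ) (ℓ : ℤ) (ν : ℂ) (g : G) : ℂ :=
  phiBasic ℓ ν g * (((ℓ - 1) / 2 - ν) * (rowVariation X g / rowC g) -
    ((ℓ + 1) / 2 + ν) * ((starRingEnd ℂ) (rowVariation X g) / (starRingEnd ℂ) (rowC g)))

@[fun_prop]
lemma continuous_phiVariation (X : Fin 2 → Fin 2 → ℝ) (ℓ : ℤ) (ν : ℂ) :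
    Continuous (phiVariation X ℓ ν) := by
  have h1 : Continuous (rowVariation X) := by unfold rowVariation; fun_prop
  have h2 : ∀ g, (starRingEnd ℂ) (rowC g) ≠ 0 := fun g => by simpa using rowC_ne_zero g
  unfold phiVariation
  refine (continuous_phiBasic ℓ ν).mul ((continuous_const.mul
    (h1.div continuous_rowC rowC_ne_zero)).sub (continuous_const.mul
      ((Complex.continuous_conj.comp h1).div (Complex.continuous_conj.comp continuous_rowC) h2)))

lemma raising_phiBasic (ℓ : ℤ) (ν : ℂ) (g : G) :
    2 * Complex.I * phiVariation !![0, 1; 0, 0] ℓ ν g + phiVariation !![1, 0; 0, -1] ℓ ν g -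
      Complex.I * phiVariation !![0, 1; -1, 0] ℓ ν g = (1 + 2 * ν + ℓ) * phiBasic (ℓ + 2) ν g := by
  have h1 := rowC_ne_zero g
  have h2 : (starRingEnd ℂ) (rowC g) ≠ 0 := by simpa using h1
  rw [phiBasic_add_two]
  unfold phiVariation
  field_simp
  simp [rowVariation, rowC]
  ring_nf
  simp
  ring

lemma lowering_phiBasic (ℓ : ℤ) (ν : ℂ) (g : G) :
    -2 * Complex.I * phiVariation !![0, 1; 0, 0] ℓ ν g + phiVariation !![1, 0; 0, -1] ℓ ν g +
      Complex.I * phiVariation !![0, 1; -1, 0] ℓ ν g = (1 + 2 * ν - ℓ) * phiBasic (ℓ - 2) ν g := by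
  have h1 := rowC_ne_zero g
  have h2 : (starRingEnd ℂ) (rowC g) ≠ 0 := by simpa using h1
  rw [phiBasic_sub_two]
  unfold phiVariation
  field_simp
  simp [rowVariation, rowC]
  ring_nf
  simp
  ring

lemma rotation_phiBasic (ℓ : ℤ) (ν : ℂ) (g : G) :
    phiVariation !![0, 1; -1, 0] ℓ ν g = Complex.I * ℓ * phiBasic ℓ ν g := by
  have h1 := rowC_ne_zero g
  have h2 : (starRingEnd ℂ) (rowC g) ≠ 0 := by simpa using h1
  unfold phiVariation
  field_simp
  simp [rowVariation, rowC]
  ring_nf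
  simp

lemma integral_linear_combination {u v w : G → ℂ} (hu : Integrable u haarG)
    (hv : Integrable v haarG) (hw : Integrable w haarG) (a b c : ℂ) :
    ∫ g, (a * u g + b * v g + c * w g) ∂haarG =
      a * ∫ g, u g ∂haarG + b * ∫ g, v g ∂haarG + c * ∫ g, w g ∂haarG := by
  rw [integral_add (f := fun g => a * u g + b * v g) ((hu.const_mul a).add (hv.const_mul b))
    (hw.const_mul c), integral_add (hu.const_mul a) (hv.const_mul b), integral_const_mul,
    integral_const_mul, integral_const_mul]

section parts

variable {K : Set G} (hK : IsCompact K) {F : G → ℂ} (hF : IsTest K F)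
include hF

lemma IsTest.x1 (hK : IsClosed K) : IsTest K (x1 F) := hF.lieDeriv isLinearFlow_nMat hK
lemma IsTest.x2 (hK : IsClosed K) : IsTest K (x2 F) := hF.lieDeriv isLinearFlow_aMat hK
lemma IsTest.x3 (hK : IsClosed K) : IsTest K (x3 F) := hF.lieDeriv isLinearFlow_kMat hK
lemma IsTest.dtheta (hK : IsClosed K) : IsTest K (dtheta F) := hF.x3 hK
lemma IsTest.dphi (hK : IsClosed K) : IsTest K (dphi F) := hF.lieDeriv isLinearFlow_kMat_left hK

lemma IsTest.raising (hK : IsClosed K) : IsTest K (raising F) := by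
  have := (((hF.x1 hK).const_mul (2 * Complex.I)).add (hF.x2 hK)).add
    ((hF.x3 hK).const_mul (-Complex.I))
  convert this using 1
  ext g
  simp only [SL2Spectral.raising]
  ring

lemma IsTest.lowering (hK : IsClosed K) : IsTest K (lowering F) := by
  have := (((hF.x1 hK).const_mul (-2 * Complex.I)).add (hF.x2 hK)).add
    ((hF.x3 hK).const_mul Complex.I)
  exact this

lemma IsTest.casimir (hK : IsClosed K) : IsTest K (casimir F) := by
  have := ((((hF.lowering hK).raising hK).const_mul (-(1 / 4))).add
    (((hF.x3 hK).x3 hK).const_mul (1 / 4))).add ((hF.x3 hK).const_mul (-(1 / 2) * Complex.I))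
  convert this using 1
  ext g
  simp only [SL2Spectral.casimir]
  ring

include hK

lemma IsTest.integrable_mul {h : G → ℂ} (hh : Continuous h) :
    Integrable (fun g => F g * h g) haarG :=
  (hF.1.continuous.mul hh).integrable_of_hasCompactSupport
    (HasCompactSupport.intro hK fun g hg => by
      change F g * h g = 0
      rw [hF.2 g hg, zero_mul])

lemma IsTest.integral_lieDeriv_mul_phiBasic (ℓ : ℤ) (ν : ℂ) (k : G) {c : ℝ → G}
    (hT : IsLinearFlow fun t g => g * c t) {X : Fin 2 → Fin 2 → ℝ}
    (hX : ∀ i j, HasDerivAt (fun t => c t i j) (X i j) 0) :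
    ∫ g, SL2Spectral.lieDeriv (fun t g => g * c t) F g * phiBasic ℓ ν (k * g) ∂haarG =
      -∫ g, F g * phiVariation X ℓ ν (k * g) ∂haarG := by
  have h1 := continuous_phiBasic ℓ ν
  refine hF.integral_lieDeriv_mul hT hK (by fun_prop) (by fun_prop) fun g => ?_
  simp only [← mul_assoc]
  have h2 := hasDerivAt_phiBasic ℓ ν (hasDerivAt_rowC_mul hX (k * g))
  have h0 : c 0 = 1 := by simpa using hT.zero 1
  simp only [h0, mul_one] at h2
  exact h2

lemma IsTest.integral_x3_mul (ℓ : ℤ) (ν : ℂ) (k : G) :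
    ∫ g, SL2Spectral.x3 F g * phiBasic ℓ ν (k * g) ∂haarG =
      -(Complex.I * ℓ) * ∫ g, F g * phiBasic ℓ ν (k * g) ∂haarG := by
  have h := hF.integral_lieDeriv_mul_phiBasic hK ℓ ν k isLinearFlow_kMat hasDerivAt_kMat
  refine h.trans ?_
  simp only [rotation_phiBasic]
  rw [neg_mul, ← integral_const_mul]
  congr 2
  ext g
  ring

lemma IsTest.integral_combination_mul (ℓ : ℤ) (ν : ℂ) (k : G) (a b : ℂ) :
    ∫ g, (a * SL2Spectral.x1 F g + SL2Spectral.x2 F g + b * SL2Spectral.x3 F g) *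
      phiBasic ℓ ν (k * g) ∂haarG =
      -∫ g, F g * (a * phiVariation !![0, 1; 0, 0] ℓ ν (k * g) +
        phiVariation !![1, 0; 0, -1] ℓ ν (k * g) +
        b * phiVariation !![0, 1; -1, 0] ℓ ν (k * g)) ∂haarG := by
  have hc : Continuous fun g => phiBasic ℓ ν (k * g) := by
    have := continuous_phiBasic ℓ ν
    fun_prop
  have hv : ∀ X, Continuous fun g => phiVariation X ℓ ν (k * g) := fun X => by fun_prop
  have i1 := (hF.x1 hK.isClosed).integrable_mul hK hc
  have i2 := (hF.x2 hK.isClosed).integrable_mul hK hc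
  have i3 := (hF.x3 hK.isClosed).integrable_mul hK hc
  have j1 := hF.integrable_mul hK (hv !![0, 1; 0, 0])
  have j2 := hF.integrable_mul hK (hv !![1, 0; 0, -1])
  have j3 := hF.integrable_mul hK (hv !![0, 1; -1, 0])
  have e1 := hF.integral_lieDeriv_mul_phiBasic hK ℓ ν k isLinearFlow_nMat hasDerivAt_nMat
  have e2 := hF.integral_lieDeriv_mul_phiBasic hK ℓ ν k isLinearFlow_aMat hasDerivAt_aMat_exp
  have e3 := hF.integral_lieDeriv_mul_phiBasic hK ℓ ν k isLinearFlow_kMat hasDerivAt_kMat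
  change ∫ g, SL2Spectral.x1 F g * _ ∂haarG = _ at e1
  change ∫ g, SL2Spectral.x2 F g * _ ∂haarG = _ at e2
  change ∫ g, SL2Spectral.x3 F g * _ ∂haarG = _ at e3
  have l1 : ∀ g, (a * SL2Spectral.x1 F g + SL2Spectral.x2 F g + b * SL2Spectral.x3 F g) *
      phiBasic ℓ ν (k * g) = a * (SL2Spectral.x1 F g * phiBasic ℓ ν (k * g)) +
        1 * (SL2Spectral.x2 F g * phiBasic ℓ ν (k * g)) +
        b * (SL2Spectral.x3 F g * phiBasic ℓ ν (k * g)) := fun g => by ring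
  have l2 : ∀ g, F g * (a * phiVariation !![0, 1; 0, 0] ℓ ν (k * g) +
        phiVariation !![1, 0; 0, -1] ℓ ν (k * g) +
        b * phiVariation !![0, 1; -1, 0] ℓ ν (k * g)) =
      a * (F g * phiVariation !![0, 1; 0, 0] ℓ ν (k * g)) +
        1 * (F g * phiVariation !![1, 0; 0, -1] ℓ ν (k * g)) +
        b * (F g * phiVariation !![0, 1; -1, 0] ℓ ν (k * g)) := fun g => by ring
  simp only [l1, l2]
  rw [integral_linear_combination i1 i2 i3, integral_linear_combination j1 j2 j3, e1, e2, e3]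
  ring

lemma IsTest.integral_raising_mul (ℓ : ℤ) (ν : ℂ) (k : G) :
    ∫ g, SL2Spectral.raising F g * phiBasic ℓ ν (k * g) ∂haarG =
      -(1 + 2 * ν + ℓ) * ∫ g, F g * phiBasic (ℓ + 2) ν (k * g) ∂haarG := by
  have h := hF.integral_combination_mul hK ℓ ν k (2 * Complex.I) (-Complex.I)
  simp only [neg_mul, ← sub_eq_add_neg] at h
  refine h.trans ?_
  simp only [raising_phiBasic]
  rw [neg_mul, ← integral_const_mul]
  congr 2
  ext g
  ring

lemma IsTest.integral_lowering_mul (ℓ : ℤ) (ν : ℂ) (k : G) :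
    ∫ g, SL2Spectral.lowering F g * phiBasic ℓ ν (k * g) ∂haarG =
      -(1 + 2 * ν - ℓ) * ∫ g, F g * phiBasic (ℓ - 2) ν (k * g) ∂haarG := by
  refine (hF.integral_combination_mul hK ℓ ν k (-2 * Complex.I) Complex.I).trans ?_
  simp only [lowering_phiBasic]
  rw [neg_mul, ← integral_const_mul]
  congr 2
  ext g
  ring

/-- The basic harmonics are eigenfunctions of the Casimir operator, in the weak sense. -/
lemma IsTest.integral_casimir_mul_phiBasic (ℓ : ℤ) (ν : ℂ) (k : G) :
    ∫ g, SL2Spectral.casimir F g * phiBasic ℓ ν (k * g) ∂haarG =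
      (1 / 4 - ν ^ 2) * ∫ g, F g * phiBasic ℓ ν (k * g) ∂haarG := by
  have hc : Continuous fun g => phiBasic ℓ ν (k * g) := by
    have := continuous_phiBasic ℓ ν
    fun_prop
  have hKc := hK.isClosed
  have i1 := ((hF.lowering hKc).raising hKc).integrable_mul hK hc
  have i2 := ((hF.x3 hKc).x3 hKc).integrable_mul hK hc
  have i3 := (hF.x3 hKc).integrable_mul hK hc
  have e1 := (hF.lowering hKc).integral_raising_mul hK ℓ ν k
  have e2 := hF.integral_lowering_mul hK (ℓ + 2) ν k
  have e3 := (hF.x3 hKc).integral_x3_mul hK ℓ ν k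
  have e4 := hF.integral_x3_mul hK ℓ ν k
  rw [e2, add_sub_cancel_right] at e1
  rw [e4] at e3
  have l : ∀ g, SL2Spectral.casimir F g * phiBasic ℓ ν (k * g) =
      -(1 / 4) * (SL2Spectral.raising (SL2Spectral.lowering F) g * phiBasic ℓ ν (k * g)) +
      (1 / 4) * (SL2Spectral.x3 (SL2Spectral.x3 F) g * phiBasic ℓ ν (k * g)) +
      -(1 / 2) * Complex.I * (SL2Spectral.x3 F g * phiBasic ℓ ν (k * g)) := fun g => by
    rw [SL2Spectral.casimir]; ring
  simp only [l]
  rw [integral_linear_combination i1 i2 i3, e1, e3, e4]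
  push_cast
  linear_combination ((ℓ : ℂ) ^ 2 / 4 + ℓ / 2) * (∫ g, F g * phiBasic ℓ ν (k * g) ∂haarG) *
    Complex.I_sq

end parts

end SL2Spectral
namespace SL2Spectral

/-! ### Coefficients of smooth functions -/

open MeasureTheory Set Filter Topology

instance : SFinite haarG := by
  unfold haarG
  infer_instance

section parts

variable {K : Set G} (hK : IsCompact K) {F : G → ℂ} (hF : IsTest K F)
include hK hF

/-- The integral against a harmonic as a Fourier integral over left rotations. -/
lemma IsTest.integral_mul_phiTyped (ℓ₁ ℓ₂ : ℤ) (ν : ℂ) :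
    ∫ g, F g * phiTyped ℓ₁ ℓ₂ ν g ∂haarG = ((1 / (2 * Real.pi) : ℝ) : ℂ) *
      ∫ t in (0 : ℝ)..(2 * Real.pi), Complex.exp (-Complex.I * (ℓ₁ : ℂ) * (t : ℂ)) *
        ∫ g, F g * phiBasic ℓ₂ ν (kMat t * g) ∂haarG := by
  have hπ := Real.pi_pos
  set q : G → ℝ → ℂ := fun g t => F g * (phiBasic ℓ₂ ν (kMat t * g) *
    Complex.exp (-Complex.I * (ℓ₁ : ℂ) * (t : ℂ))) with hq
  have hqc : Continuous (Function.uncurry q) := by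
    have h1 := continuous_phiTyped_integrand ℓ₁ ℓ₂ ν
    have h2 := hF.1.continuous
    exact (h2.comp continuous_fst).mul h1
  obtain ⟨C, hC⟩ := (hK.prod (isCompact_Icc (a := (0 : ℝ)) (b := 2 * Real.pi))).exists_bound_of_continuousOn
    hqc.continuousOn
  have hint : Integrable (Function.uncurry q)
      (haarG.prod (volume.restrict (Ioc 0 (2 * Real.pi)))) := by
    have hb1 : Integrable (K.indicator fun _ => C) haarG :=
      (integrable_indicator_iff hK.measurableSet).2 (continuousOn_const.integrableOn_compact hK)
    have hb := hb1.mul_prod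
      (integrable_const (μ := (volume : Measure ℝ).restrict (Ioc 0 (2 * Real.pi))) (1 : ℝ))
    refine hb.mono' hqc.aestronglyMeasurable ?_
    have hmem : ∀ᵐ p ∂(haarG.prod (volume.restrict (Ioc 0 (2 * Real.pi)))),
        p.2 ∈ Ioc 0 (2 * Real.pi) :=
      Measure.quasiMeasurePreserving_snd.ae (ae_restrict_mem measurableSet_Ioc)
    filter_upwards [hmem] with p hp
    rw [mul_one]
    by_cases hg : p.1 ∈ K
    · rw [indicator_of_mem hg]
      exact hC p ⟨hg, Ioc_subset_Icc_self hp⟩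
    · rw [indicator_of_notMem hg]
      simp [Function.uncurry, hq, hF.2 _ hg]
  have h1 : ∀ g, F g * phiTyped ℓ₁ ℓ₂ ν g =
      ((1 / (2 * Real.pi) : ℝ) : ℂ) * ∫ t in Ioc 0 (2 * Real.pi), q g t := fun g => by
    rw [phiTyped, intervalIntegral.integral_of_le (by positivity)]
    simp only [hq]
    rw [integral_const_mul]
    ring
  simp only [h1]
  rw [integral_const_mul, integral_integral_swap hint, intervalIntegral.integral_of_le (by positivity)]
  congr 2
  ext t
  rw [← integral_const_mul]
  congr 1
  ext g
  simp only [hq]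
  ring

lemma IsTest.integral_casimir_mul (ℓ₁ ℓ₂ : ℤ) (ν : ℂ) :
    ∫ g, SL2Spectral.casimir F g * phiTyped ℓ₁ ℓ₂ ν g ∂haarG =
      (1 / 4 - ν ^ 2) * ∫ g, F g * phiTyped ℓ₁ ℓ₂ ν g ∂haarG := by
  rw [(hF.casimir hK.isClosed).integral_mul_phiTyped hK, hF.integral_mul_phiTyped hK]
  simp only [hF.integral_casimir_mul_phiBasic hK, mul_left_comm _ (1 / 4 - ν ^ 2)]
  rw [intervalIntegral.integral_const_mul, mul_left_comm]

lemma IsTest.integral_dphi_mul (ℓ₁ ℓ₂ : ℤ) (ν : ℂ) :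
    ∫ g, SL2Spectral.dphi F g * phiTyped ℓ₁ ℓ₂ ν g ∂haarG =
      -(Complex.I * ℓ₁) * ∫ g, F g * phiTyped ℓ₁ ℓ₂ ν g ∂haarG := by
  have hc := continuous_phiTyped ℓ₁ ℓ₂ ν
  have h := hF.integral_lieDeriv_mul isLinearFlow_kMat_left hK hc
    (h' := fun g => Complex.I * ℓ₁ * phiTyped ℓ₁ ℓ₂ ν g) (by fun_prop) fun g => by
      simp only [phiTyped_kMat_mul]
      have h1 := ((Complex.ofRealCLM.hasDerivAt (x := (0 : ℝ))).const_mul (Complex.I * ℓ₁)).cexp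
      simpa using h1.mul_const (phiTyped ℓ₁ ℓ₂ ν g)
  refine h.trans ?_
  rw [neg_mul, ← integral_const_mul]
  congr 2
  ext g
  ring

lemma IsTest.integral_dtheta_mul (ℓ₁ ℓ₂ : ℤ) (ν : ℂ) :
    ∫ g, SL2Spectral.dtheta F g * phiTyped ℓ₁ ℓ₂ ν g ∂haarG =
      -(Complex.I * ℓ₂) * ∫ g, F g * phiTyped ℓ₁ ℓ₂ ν g ∂haarG := by
  have hc := continuous_phiTyped ℓ₁ ℓ₂ ν
  have h := hF.integral_lieDeriv_mul isLinearFlow_kMat hK hc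
    (h' := fun g => Complex.I * ℓ₂ * phiTyped ℓ₁ ℓ₂ ν g) (by fun_prop) fun g => by
      simp only [phiTyped_mul_kMat]
      have h1 := ((Complex.ofRealCLM.hasDerivAt (x := (0 : ℝ))).const_mul (Complex.I * ℓ₂)).cexp
      simpa using h1.mul_const (phiTyped ℓ₁ ℓ₂ ν g)
  refine h.trans ?_
  rw [neg_mul, ← integral_const_mul]
  congr 2
  ext g
  ring

end parts

lemma IsTest.iterate {K : Set G} {D : (G → ℂ) → G → ℂ}
    (hD : ∀ F, IsTest K F → IsTest K (D F)) {F : G → ℂ} (hF : IsTest K F) (n : ℕ) :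
    IsTest K (D^[n] F) := by
  induction n with
  | zero => exact hF
  | succ n ih => rw [Function.iterate_succ_apply']; exact hD _ ih

lemma integral_iterate_mul {K : Set G} {D : (G → ℂ) → G → ℂ} {q : G → ℂ} {c : ℂ}
    (hD : ∀ F, IsTest K F → IsTest K (D F))
    (hc : ∀ F, IsTest K F → ∫ g, D F g * q g ∂haarG = c * ∫ g, F g * q g ∂haarG)
    {F : G → ℂ} (hF : IsTest K F) (n : ℕ) :
    ∫ g, (D^[n] F) g * q g ∂haarG = c ^ n * ∫ g, F g * q g ∂haarG := by
  induction n with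
  | zero => simp
  | succ n ih =>
    rw [Function.iterate_succ_apply', hc _ (hF.iterate hD n), ih, pow_succ]
    ring

lemma conj_harmonicP (ℓ₁ ℓ₂ : ℤ) (ν : ℂ) : ∃ C : ℂ, ∀ g, (starRingEnd ℂ) (harmonicP ℓ₁ ℓ₂ ν g) =
    C * phiTyped (-ℓ₁) (-ℓ₂) ((starRingEnd ℂ) ν) g :=
  ⟨_, fun g => by rw [harmonicP, map_mul, conj_phiTyped]⟩

lemma continuous_harmonicP (ℓ₁ ℓ₂ : ℤ) (ν : ℂ) : Continuous (harmonicP ℓ₁ ℓ₂ ν) :=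
  continuous_const.mul (continuous_phiTyped ℓ₁ ℓ₂ ν)

/-- The trivial bound for the coefficient of `D F`, rewritten as a bound for the coefficient of `F`
when the harmonic is an eigenfunction of the transpose of `D`. -/
lemma norm_mul_innerG_le {K : Set G} {U B M : ℝ} (hKU : ∀ g ∈ K, uFun g ≤ U)
    (hB : 0 ≤ B) {ℓ₁ ℓ₂ : ℤ} {ν : ℂ}
    (hM : ∫⁻ g in {g | uFun g ≤ U}, ENNReal.ofReal ‖harmonicP ℓ₁ ℓ₂ ν g‖ ∂haarG ≤ ENNReal.ofReal M)
    (hM0 : 0 ≤ M) {F F' : G → ℂ} (hF : IsTest K F) (hF' : IsTest K F') (hF'B : ∀ g, ‖F' g‖ ≤ B)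
    {c : ℂ} (hc : ∫ g, F' g * phiTyped (-ℓ₁) (-ℓ₂) ((starRingEnd ℂ) ν) g ∂haarG =
      c * ∫ g, F g * phiTyped (-ℓ₁) (-ℓ₂) ((starRingEnd ℂ) ν) g ∂haarG) :
    ‖innerG F (harmonicP ℓ₁ ℓ₂ ν)‖ * ‖c‖ ≤ B * M := by
  obtain ⟨C, hC⟩ := conj_harmonicP ℓ₁ ℓ₂ ν
  have hPc := continuous_harmonicP ℓ₁ ℓ₂ ν
  have hFc := hF.1.continuous
  have h1 : innerG F (harmonicP ℓ₁ ℓ₂ ν) * c =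
      ∫ g, F' g * (starRingEnd ℂ) (harmonicP ℓ₁ ℓ₂ ν g) ∂haarG := by
    rw [innerG, integralG_eq (f := fun g => F g * (starRingEnd ℂ) (harmonicP ℓ₁ ℓ₂ ν g))
      (hFc.mul (Complex.continuous_conj.comp hPc)).measurable]
    simp only [hC, mul_left_comm _ C]
    rw [integral_const_mul, integral_const_mul, hc]
    ring
  have hS : MeasurableSet {g : G | uFun g ≤ U} := measurableSet_le (by fun_prop) (by fun_prop)
  rw [← norm_mul, h1]
  refine (norm_integral_le_lintegral_norm _).trans ?_
  refine ENNReal.toReal_le_of_le_ofReal (by positivity) ?_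
  rw [ENNReal.ofReal_mul hB]
  refine le_trans ?_ (mul_le_mul_right hM (ENNReal.ofReal B))
  rw [← lintegral_indicator hS, ← lintegral_const_mul' _ _ ENNReal.ofReal_ne_top]
  refine lintegral_mono fun g => ?_
  by_cases hg : g ∈ K
  · rw [indicator_of_mem (show g ∈ {g : G | uFun g ≤ U} from hKU g hg), ← ENNReal.ofReal_mul hB,
      norm_mul, RCLike.norm_conj]
    exact ENNReal.ofReal_le_ofReal (mul_le_mul_of_nonneg_right (hF'B g) (norm_nonneg _))
  · rw [hF'.2 g hg]; simp

lemma uFun_kMat_mul (t : ℝ) (g : G) : uFun (kMat t * g) = uFun g := by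
  simp only [uFun, mul_apply', kMat_00, kMat_01, kMat_10, kMat_11]
  linear_combination (g 0 0 ^ 2 + g 0 1 ^ 2 + g 1 0 ^ 2 + g 1 1 ^ 2) / 4 * Real.sin_sq_add_cos_sq t

/-- Averaging over left rotations does not change the integral over a ball. -/
lemma setLIntegral_sphericalAvg_le (σ U : ℝ) :
    ∫⁻ g in {g | uFun g ≤ U}, ENNReal.ofReal (sphericalAvg σ g) ∂haarG ≤
      ∫⁻ g in {g | uFun g ≤ U}, ENNReal.ofReal (iwasawaY g ^ σ) ∂haarG := by
  have hπ := Real.pi_pos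
  set S : Set G := {g | uFun g ≤ U}
  have hS : MeasurableSet S := measurableSet_le (by fun_prop) (by fun_prop)
  have hcr : Continuous fun g => iwasawaY g ^ σ :=
    continuous_iwasawaY.rpow_const fun g => Or.inl (iwasawaY_pos g).ne'
  have hcp : Continuous fun p : G × ℝ => iwasawaY (kMat p.2 * p.1) ^ σ :=
    Continuous.rpow_const (by fun_prop) fun p => Or.inl (iwasawaY_pos _).ne'
  have h1 : ∀ g, ENNReal.ofReal (sphericalAvg σ g) = ENNReal.ofReal (1 / (2 * Real.pi)) *
      ∫⁻ t in Ioc 0 (2 * Real.pi), ENNReal.ofReal (iwasawaY (kMat t * g) ^ σ) := fun g => by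
    have hc : Continuous fun t => iwasawaY (kMat t * g) ^ σ :=
      Continuous.rpow_const (by fun_prop) fun t => Or.inl (iwasawaY_pos _).ne'
    rw [sphericalAvg, ENNReal.ofReal_mul (by positivity),
      intervalIntegral.integral_of_le (by positivity), ofReal_integral_eq_lintegral_ofReal
        (hc.integrableOn_Ioc)
        (Eventually.of_forall fun t => Real.rpow_nonneg (iwasawaY_pos _).le _)]
  have h2 : ∀ t : ℝ, ∫⁻ g in S, ENNReal.ofReal (iwasawaY (kMat t * g) ^ σ) ∂haarG =
      ∫⁻ g in S, ENNReal.ofReal (iwasawaY g ^ σ) ∂haarG := fun t => by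
    have h3 := (measurePreserving_mul_left haarG (kMat t)).setLIntegral_comp_preimage hS
      (f := fun g => ENNReal.ofReal (iwasawaY g ^ σ)) hcr.measurable.ennreal_ofReal
    have h4 : (fun g => kMat t * g) ⁻¹' S = S := by
      ext g
      change uFun (kMat t * g) ≤ U ↔ uFun g ≤ U
      rw [uFun_kMat_mul]
    rwa [h4] at h3
  simp only [h1]
  rw [lintegral_const_mul' _ _ ENNReal.ofReal_ne_top, lintegral_lintegral_swap
    hcp.measurable.ennreal_ofReal.aemeasurable]
  simp only [h2]
  rw [lintegral_const, Measure.restrict_apply MeasurableSet.univ, univ_inter, Real.volume_Ioc,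
    sub_zero, mul_left_comm, ← ENNReal.ofReal_mul (by positivity), one_div,
    inv_mul_cancel₀ (by positivity), ENNReal.ofReal_one, mul_one]

lemma sphericalAvg_nonneg (σ : ℝ) (g : G) : 0 ≤ sphericalAvg σ g := by
  have hπ := Real.pi_pos
  refine mul_nonneg (by positivity) (intervalIntegral.integral_nonneg (by positivity) fun t _ => ?_)
  exact Real.rpow_nonneg (iwasawaY_pos _).le _

lemma norm_harmonicP_le_of_re_eq_zero {ν : ℂ} (hν : ν.re = 0) (ℓ₁ ℓ₂ : ℤ) (g : G) :
    ‖harmonicP ℓ₁ ℓ₂ ν g‖ ≤ sphericalAvg (1 / 2) g := by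
  have h := sq_norm_harmonicP ℓ₁ ℓ₂ ν g
  rw [normRatio_of_re_eq_zero hν, normRatio_of_re_eq_zero hν, div_one, one_mul,
    sq_eq_sq₀ (norm_nonneg _) (norm_nonneg _)] at h
  rw [h]
  simpa [hν] using norm_phiTyped_le ℓ₁ ℓ₂ ν g

lemma norm_harmonicP_le_of_real {ν : ℝ} (h0 : 0 < ν) (h1 : ν < 1 / 2) {ℓ₁ ℓ₂ : ℤ}
    (h : ℓ₁ ≡ ℓ₂ [ZMOD 2]) (g : G) :
    ‖harmonicP ℓ₁ ℓ₂ ν g‖ ≤ 2 * (1 + |(ℓ₂ : ℝ)|) * sphericalAvg (1 / 2 + ν) g := by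
  have hA := sphericalAvg_nonneg (1 / 2 + ν) g
  have hp := normRatio_real_pos h0 h1 ℓ₂.natAbs
  have hab : (ℓ₂.natAbs : ℝ) = |(ℓ₂ : ℝ)| := by rw [Nat.cast_natAbs, Int.cast_abs]
  have hn := abs_nonneg (ℓ₂ : ℝ)
  rw [← sq_le_sq₀ (norm_nonneg _) (by positivity), sq_norm_harmonicP]
  by_cases hcase : ℓ₁.natAbs ≠ 0 ∨ ℓ₂.natAbs = 0
  · have h2 := normRatio_real_le_mul h0 h1 (a := ℓ₁.natAbs) (b := ℓ₂.natAbs)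
      (by unfold Int.ModEq at h; omega) hcase
    have h3 : normRatio ν ℓ₁.natAbs / normRatio ν ℓ₂.natAbs ≤ 1 + |(ℓ₂ : ℝ)| := by
      rw [div_le_iff₀ hp, ← hab]; exact h2
    have h4 : ‖phiTyped ℓ₁ ℓ₂ ν g‖ ^ 2 ≤ sphericalAvg (1 / 2 + ν) g ^ 2 := by
      have := norm_phiTyped_le ℓ₁ ℓ₂ ν g
      rw [Complex.ofReal_re] at this
      gcongr
    calc _ ≤ (1 + |(ℓ₂ : ℝ)|) * sphericalAvg (1 / 2 + ν) g ^ 2 := by gcongr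
      _ ≤ (2 * (1 + |(ℓ₂ : ℝ)|)) ^ 2 * sphericalAvg (1 / 2 + ν) g ^ 2 := by
        gcongr
        nlinarith
      _ = _ := by ring
  · push Not at hcase
    obtain ⟨h10, h20⟩ := hcase
    obtain rfl : ℓ₁ = 0 := Int.natAbs_eq_zero.1 h10
    obtain ⟨m, rfl⟩ : ∃ m, ℓ₂ = 2 * m := ⟨ℓ₂ / 2, by unfold Int.ModEq at h; omega⟩
    have hm : m ≠ 0 := by rintro rfl; simp at h20
    have h2 := half_sub_mul_normRatio_zero_le h0 h1 (b := (2 * m).natAbs) (by omega) h20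
    have h3 := norm_phiTyped_zero_le g h1 hm
    have hs : 0 < 1 / 2 - ν := by linarith
    rw [hab] at h2
    have h4 : (1 / 2 - ν) * (normRatio ν (0 : ℤ).natAbs / normRatio ν (2 * m).natAbs) ≤
        |((2 * m : ℤ) : ℝ)| := by
      rw [← mul_div_assoc, div_le_iff₀ hp]; exact h2
    have hq : 0 ≤ normRatio ν (0 : ℤ).natAbs / normRatio ν (2 * m).natAbs :=
      (div_pos (normRatio_real_pos h0 h1 _) hp).le
    -- the singularity of the normalisation at `ν = 1/2` is compensated by the harmonic
    calc _ ≤ normRatio ν (0 : ℤ).natAbs / normRatio ν (2 * m).natAbs *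
          (2 * (1 / 2 - ν) * sphericalAvg (1 / 2 + ν) g) ^ 2 := by gcongr
      _ = (1 / 2 - ν) * (normRatio ν (0 : ℤ).natAbs / normRatio ν (2 * m).natAbs) *
          (4 * (1 / 2 - ν)) * sphericalAvg (1 / 2 + ν) g ^ 2 := by ring
      _ ≤ |((2 * m : ℤ) : ℝ)| * 2 * sphericalAvg (1 / 2 + ν) g ^ 2 := by
        gcongr
        linarith
      _ ≤ (2 * (1 + |((2 * m : ℤ) : ℝ)|)) ^ 2 * sphericalAvg (1 / 2 + ν) g ^ 2 := by
        gcongr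
        nlinarith
      _ = _ := by ring

end SL2Spectral
namespace SL2Spectral

/-! ### Decay of the coefficients -/

open MeasureTheory Set Filter Topology

lemma mul_one_add_pow_le {N R x y z : ℝ} (J : ℕ) (hN : 0 ≤ N) (hx : 0 ≤ x) (hy : 0 ≤ y)
    (hz : 0 ≤ z) (h1 : N ≤ R) (h2 : N * x ^ J ≤ R) (h3 : N * y ^ J ≤ R) (h4 : N * z ^ J ≤ R) :
    N ≤ 4 ^ J * R / (1 + x + y + z) ^ J := by
  rw [le_div_iff₀ (by positivity)]
  have key : ∀ m : ℝ, N * m ^ J ≤ R → 1 ≤ m → x ≤ m → y ≤ m → z ≤ m →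
      N * (1 + x + y + z) ^ J ≤ 4 ^ J * R := fun m hm k1 k2 k3 k4 => by
    have : (1 + x + y + z) ^ J ≤ (4 * m) ^ J := by gcongr; linarith
    calc N * (1 + x + y + z) ^ J ≤ N * (4 * m) ^ J := by gcongr
      _ = 4 ^ J * (N * m ^ J) := by rw [mul_pow]; ring
      _ ≤ _ := by gcongr
  refine key (max (max 1 x) (max y z)) ?_ (by simp) (by simp) (by simp) (by simp)
  rcases max_choice (max 1 x) (max y z) with h | h <;> rw [h]
  · rcases max_choice 1 x with h' | h' <;> rw [h']
    · simpa using h1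
    · exact h2
  · rcases max_choice y z with h' | h' <;> rw [h']
    · exact h3
    · exact h4

lemma mul_mul_pow_le {N B M δ x : ℝ} (hδ : 0 < δ) (n : ℕ)
    (h : N * x ^ (2 * n) ≤ B * (1 / δ) ^ (2 * n) * M) : N * ((δ * x) ^ 2) ^ n ≤ B * M := by
  have hδn : 0 < δ ^ (2 * n) := by positivity
  calc N * ((δ * x) ^ 2) ^ n = (N * x ^ (2 * n)) * δ ^ (2 * n) := by
        rw [← pow_mul, mul_pow]; ring
    _ ≤ (B * (1 / δ) ^ (2 * n) * M) * δ ^ (2 * n) := by gcongr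
    _ = B * M := by rw [one_div, inv_pow]; field_simp

section decay

variable {J : ℕ} {δ U B : ℝ} (hδ : 0 < δ) {F : G → ℂ} (hF : SmoothOnG F)
  (hFc : HasCompactSupport F) (hFU : ∀ g, F g ≠ 0 → uFun g ≤ U)
  (hB : ∀ J₀ J₁ J₂ : ℕ, 2 * J₀ + J₁ + J₂ ≤ 2 * J → ∀ g,
    ‖(casimir^[J₀] (dphi^[J₁] (dtheta^[J₂] F))) g‖ ≤ B * (1 / δ) ^ (2 * J₀ + J₁ + J₂))
  {ℓ₁ ℓ₂ : ℤ} {ν : ℂ} {M : ℝ} (hM0 : 0 ≤ M)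
  (hM : ∫⁻ g in {g | uFun g ≤ U}, ENNReal.ofReal ‖harmonicP ℓ₁ ℓ₂ ν g‖ ∂haarG ≤ ENNReal.ofReal M)
include hδ hF hFc hFU hB hM0 hM

/-- A bound for the integral of the harmonic over the ball gives a bound for the coefficient with
polynomial decay in the weights and in the Casimir eigenvalue. -/
lemma coefficient_bounds :
    ‖innerG F (harmonicP ℓ₁ ℓ₂ ν)‖ ≤ B * M ∧
    ‖innerG F (harmonicP ℓ₁ ℓ₂ ν)‖ * ((δ * ℓ₁) ^ 2) ^ J ≤ B * M ∧
    ‖innerG F (harmonicP ℓ₁ ℓ₂ ν)‖ * ((δ * ℓ₂) ^ 2) ^ J ≤ B * M ∧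
    ‖innerG F (harmonicP ℓ₁ ℓ₂ ν)‖ * ‖1 / 4 - ((starRingEnd ℂ) ν) ^ 2‖ ^ J ≤
      B * (1 / δ) ^ (2 * J) * M := by
  have hB0 : 0 ≤ B := by
    have h := (norm_nonneg _).trans (hB 0 0 0 (by omega) 1)
    simpa using h
  have hK : IsCompact (tsupport F) := hFc
  have hKc := hK.isClosed
  have hT : IsTest (tsupport F) F := ⟨hF, fun g hg => image_eq_zero_of_notMem_tsupport hg⟩
  have hKU : ∀ g ∈ tsupport F, uFun g ≤ U := by
    have hcl : IsClosed {g : G | uFun g ≤ U} := isClosed_le (by fun_prop) (by fun_prop)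
    exact closure_minimal (fun g hg => hFU g hg) hcl
  have cas := fun F' (h : IsTest (tsupport F) F') => h.casimir hKc
  have phi := fun F' (h : IsTest (tsupport F) F') => h.dphi hKc
  have the := fun F' (h : IsTest (tsupport F) F') => h.dtheta hKc
  have key := fun {B' : ℝ} (hB' : 0 ≤ B') {F' : G → ℂ} (hF' : IsTest (tsupport F) F') =>
    norm_mul_innerG_le hKU hB' hM hM0 hT hF'
  have hδ' : ∀ n : ℕ, 0 ≤ B * (1 / δ) ^ n := fun n => by positivity
  refine ⟨?_, mul_mul_pow_le hδ J ?_, mul_mul_pow_le hδ J ?_, ?_⟩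
  · have h := key hB0 hT (fun g => by simpa using hB 0 0 0 (by omega) g) (c := 1) (by rw [one_mul])
    simpa using h
  · have h := key (hδ' _) (hT.iterate phi (2 * J))
      (fun g => by simpa using hB 0 (2 * J) 0 (by omega) g)
      (integral_iterate_mul phi (fun F' h => h.integral_dphi_mul hK _ _ _) hT (2 * J))
    simpa [abs_pow, Even.pow_abs] using h
  · have h := key (hδ' _) (hT.iterate the (2 * J))
      (fun g => by simpa using hB 0 0 (2 * J) (by omega) g)
      (integral_iterate_mul the (fun F' h => h.integral_dtheta_mul hK _ _ _) hT (2 * J))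
    simpa [abs_pow, Even.pow_abs] using h
  · have h := key (hδ' _) (hT.iterate cas J)
      (fun g => by simpa using hB J 0 0 (by omega) g)
      (integral_iterate_mul cas (fun F' h => h.integral_casimir_mul hK _ _ _) hT J)
    rwa [norm_pow] at h

end decay

end SL2Spectral
theorem mainTheorem7 (J : ℕ) :
    ∃ K : ℝ, 0 < K ∧
      ∀ (δ U B : ℝ), 0 < δ → 1 ≤ U →
      ∀ F : SL2Spectral.G → ℂ, SL2Spectral.SmoothOnG F → HasCompactSupport F →
        (∀ g, F g ≠ 0 → SL2Spectral.uFun g ≤ U) →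
        (∀ J₀ J₁ J₂ : ℕ, 2 * J₀ + J₁ + J₂ ≤ 2 * J → ∀ g,
          ‖(SL2Spectral.casimir^[J₀] (SL2Spectral.dphi^[J₁] (SL2Spectral.dtheta^[J₂] F))) g‖
            ≤ B * (1 / δ) ^ (2 * J₀ + J₁ + J₂)) →
        (∀ (ν : ℂ) (ℓ₁ ℓ₂ : ℤ), ν.re = 0 → ℓ₁ ≡ ℓ₂ [ZMOD 2] →
          ‖SL2Spectral.innerG F (SL2Spectral.harmonicP ℓ₁ ℓ₂ ν)‖
            ≤ K * B * (U ^ (1 / 2 : ℝ) * Real.log (1 + U) /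
                (1 + (δ * ‖ν‖) ^ 2 + (δ * (ℓ₁ : ℝ)) ^ 2 + (δ * (ℓ₂ : ℝ)) ^ 2) ^ J)) ∧
        (∀ (ν : ℝ) (ℓ₁ ℓ₂ : ℤ), 0 < ν → ν < 1 / 2 → ℓ₁ ≡ ℓ₂ [ZMOD 2] →
          ‖SL2Spectral.innerG F (SL2Spectral.harmonicP ℓ₁ ℓ₂ (ν : ℂ))‖
            ≤ K * B * (U ^ (1 / 2 + ν) * (min (1 / ν) (Real.log (1 + U)) *
                  (1 + |(ℓ₁ : ℝ)|) * (1 + |(ℓ₂ : ℝ)|)) /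
                (1 + (δ * (ℓ₁ : ℝ)) ^ 2 + (δ * (ℓ₂ : ℝ)) ^ 2) ^ J)) ∧
        (∀ (k : ℕ) (ℓ₁ ℓ₂ : ℤ), 1 ≤ k → (k : ℤ) ≤ |ℓ₁| → (k : ℤ) ≤ |ℓ₂| →
          ℓ₁ ≡ (k : ℤ) [ZMOD 2] → ℓ₂ ≡ (k : ℤ) [ZMOD 2] →
          ‖SL2Spectral.innerG F (SL2Spectral.harmonicP ℓ₁ ℓ₂ (((k : ℂ) - 1) / 2))‖
            ≤ K * B * (U ^ (1 / 2 : ℝ) /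
                (1 + (δ * (((k : ℝ) - 1) / 2)) ^ 2 + (δ * (ℓ₁ : ℝ)) ^ 2
                  + (δ * (ℓ₂ : ℝ)) ^ 2) ^ J)) := by
  -- `144` and `200` come from the integrals over the ball, a factor `2` from the normalisation in the
  -- complementary series, and `4 ^ J` from combining four separate bounds
  refine ⟨288 * 4 ^ J, by positivity, fun δ U B hδ hU F hF hFc hFU hB => ?_⟩
  have hB0 : 0 ≤ B := by
    have h := (norm_nonneg _).trans (hB 0 0 0 (by omega) 1)
    simpa using h
  have hU0 : 0 < U := by linarith
  have hlog : 0 ≤ Real.log (1 + U) := Real.log_nonneg (by linarith)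
  have hmono : ∀ {f₁ f₂ : SL2Spectral.G → ℝ}, (∀ g, f₁ g ≤ f₂ g) →
      ∫⁻ g in {g | SL2Spectral.uFun g ≤ U}, ENNReal.ofReal (f₁ g) ∂SL2Spectral.haarG ≤
        ∫⁻ g in {g | SL2Spectral.uFun g ≤ U}, ENNReal.ofReal (f₂ g) ∂SL2Spectral.haarG :=
    fun h => MeasureTheory.lintegral_mono fun g => ENNReal.ofReal_le_ofReal (h g)
  have hsq : ∀ x : ℝ, 0 ≤ (δ * x) ^ 2 := fun x => sq_nonneg _
  refine ⟨fun ν ℓ₁ ℓ₂ hν _ => ?_, fun ν ℓ₁ ℓ₂ h0 h1 hℓ => ?_, fun k ℓ₁ ℓ₂ hk h1 h2 e1 e2 => ?_⟩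
  · obtain ⟨b1, b2, b3, b4⟩ := SL2Spectral.coefficient_bounds hδ hF hFc hFU hB (by positivity)
      (((hmono (SL2Spectral.norm_harmonicP_le_of_re_eq_zero hν ℓ₁ ℓ₂)).trans
        (SL2Spectral.setLIntegral_sphericalAvg_le _ U)).trans (SL2Spectral.setLIntegral_sqrt_le hU))
    -- on the imaginary axis the Casimir eigenvalue is `1 / 4 + |ν|²`
    have hev : ‖ν‖ ^ 2 ≤ ‖1 / 4 - ((starRingEnd ℂ) ν) ^ 2‖ := by
      have hre : (1 / 4 - ((starRingEnd ℂ) ν) ^ 2).re = 1 / 4 + ‖ν‖ ^ 2 := by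
        rw [Complex.sq_norm, Complex.normSq_apply]
        simp [pow_two, hν]
      calc ‖ν‖ ^ 2 ≤ (1 / 4 - ((starRingEnd ℂ) ν) ^ 2).re := by rw [hre]; linarith
        _ ≤ _ := Complex.re_le_norm _
    have b5 := SL2Spectral.mul_mul_pow_le hδ J (le_trans (mul_le_mul_of_nonneg_left
      ((pow_mul ‖ν‖ 2 J).trans_le (pow_le_pow_left₀ (sq_nonneg _) hev J)) (norm_nonneg _)) b4)
    refine (SL2Spectral.mul_one_add_pow_le J (norm_nonneg _) (hsq _) (hsq _) (hsq _)
      b1 b5 b2 b3).trans ?_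
    rw [← mul_div_assoc (288 * 4 ^ J * B)]
    refine div_le_div_of_nonneg_right ?_ (by positivity)
    have hX : 0 ≤ 4 ^ J * B * (U ^ (1 / 2 : ℝ) * Real.log (1 + U)) := by positivity
    linarith
  · have hm : 0 ≤ min (1 / ν) (Real.log (1 + U)) := le_min (by positivity) hlog
    obtain ⟨b1, b2, b3, -⟩ := SL2Spectral.coefficient_bounds (ν := (ν : ℂ)) (M := 2 *
      (1 + |(ℓ₂ : ℝ)|) * (144 * (U ^ (1 / 2 + ν) * min (1 / ν) (Real.log (1 + U))))) hδ hF hFc hFU hB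
      (by positivity) (by
        refine (hmono (SL2Spectral.norm_harmonicP_le_of_real h0 h1 hℓ)).trans ?_
        have hc : 0 ≤ 2 * (1 + |(ℓ₂ : ℝ)|) := by positivity
        simp only [ENNReal.ofReal_mul hc]
        rw [MeasureTheory.lintegral_const_mul' _ _ ENNReal.ofReal_ne_top]
        exact mul_le_mul_right ((SL2Spectral.setLIntegral_sphericalAvg_le _ U).trans
          (SL2Spectral.setLIntegral_rpow_le hU h0 h1)) _)
    have hN := norm_nonneg (SL2Spectral.innerG F (SL2Spectral.harmonicP ℓ₁ ℓ₂ (ν : ℂ)))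
    have b5 : ‖SL2Spectral.innerG F (SL2Spectral.harmonicP ℓ₁ ℓ₂ (ν : ℂ))‖ * (0 : ℝ) ^ J ≤ _ :=
      (mul_le_of_le_one_right hN (pow_le_one₀ le_rfl zero_le_one)).trans b1
    have h := SL2Spectral.mul_one_add_pow_le J hN le_rfl (hsq _) (hsq _) b1 b5 b2 b3
    rw [add_zero] at h
    refine h.trans ?_
    rw [← mul_div_assoc (288 * 4 ^ J * B)]
    refine div_le_div_of_nonneg_right ?_ (by positivity)
    have hX : 0 ≤ 4 ^ J * B * (U ^ (1 / 2 + ν) * min (1 / ν) (Real.log (1 + U)) *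
      (1 + |(ℓ₂ : ℝ)|)) * |(ℓ₁ : ℝ)| := by positivity
    linarith
  · obtain ⟨b1, b2, b3, -⟩ := SL2Spectral.coefficient_bounds hδ hF hFc hFU hB (by positivity)
      ((hmono fun g => Real.le_sqrt_of_sq_le
        (SL2Spectral.sq_norm_harmonicP_discrete hk h1 h2 e1 e2 g)).trans
          (SL2Spectral.setLIntegral_inv_sqrt_le hU))
    -- the spectral parameter is bounded by the weight
    have hkl : ((δ * (((k : ℝ) - 1) / 2)) ^ 2) ^ J ≤ ((δ * (ℓ₁ : ℝ)) ^ 2) ^ J := by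
      have hk' : (1 : ℝ) ≤ k := by exact_mod_cast hk
      have h1' : (k : ℝ) ≤ |(ℓ₁ : ℝ)| := by exact_mod_cast h1
      refine pow_le_pow_left₀ (sq_nonneg _) ?_ J
      rw [sq_le_sq, abs_mul, abs_mul]
      refine mul_le_mul_of_nonneg_left ?_ (abs_nonneg δ)
      rw [abs_of_nonneg (by linarith)]
      linarith
    have b5 := (mul_le_mul_of_nonneg_left hkl (norm_nonneg _)).trans b2
    refine (SL2Spectral.mul_one_add_pow_le J (norm_nonneg _) (hsq _) (hsq _) (hsq _)
      b1 b5 b2 b3).trans ?_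
    rw [← mul_div_assoc (288 * 4 ^ J * B)]
    refine div_le_div_of_nonneg_right ?_ (by positivity)
    have hX : 0 ≤ 4 ^ J * B * U ^ (1 / 2 : ℝ) := by positivity
    linarith
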